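/- For an integer $k\ge 1$, the problem $k$-MHE (Maximum Happy Edges) is the following. An instance consists of a finite simple undirected graph $G=(V,E)$, a partial vertex-coloring $c:S\to\{1,\dots,k\}$ with $S\subseteq V$, and an integer $\ell\ge 0$. The question is whether $c$ extends to a full coloring $c':V\to\{1,\dots,k\}$ (that is, $c'(v)=c(v)$ for all $v\in S$) under which at least $\ell$ edges are happy, where an edge is happy if its two endpoints have the same color. For every $k\ge 3$, $k$-MHE can be solved in time $O^*(2^{\ell})$; and $3$-MHE can be solved in time $O^*(1.89^{\ell})$. Here $O^*(f(\ell))$ means time at most $f(\ell)\cdot p(n)$ for some polynomial $p$, where $n=|V|$; algorithms are deterministic programs for a random access machine with logarithmic cost, the graph being given by its adjacency matrix. -/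

import Mathlib

/-! ## Random access machines with logarithmic cost

The memory is an infinite array of registers, each holding a natural number. Programs are
structured (assignment, composition, branching, loops), with indirect addressing. Every operation
is charged the bit lengths of the addresses and operands it handles (multiplication and division:
their product), so a program gains nothing from working with huge numbers. -/

namespace RAM

/-- Contents of the registers. -/
abbrev Mem : Type := ℕ → ℕ

/-- Arithmetic expressions; `load a` is the content of the register whose address is the value
of `a`; `sub` is truncated subtraction; `div` is integer division (with `x / 0 = 0`). -/
inductive Expr : Type
  | lit (c : ℕ) : Expr
  | load (a : Expr) : Expr
  | add (a b : Expr) : Expr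
  | sub (a b : Expr) : Expr
  | mul (a b : Expr) : Expr
  | div (a b : Expr) : Expr

/-- Logarithmic size of a number: its bit length plus one. -/
def len (x : ℕ) : ℕ := Nat.size x + 1

/-- Value of an expression. -/
def Expr.val (M : Mem) : Expr → ℕ
  | .lit c => c
  | .load a => M (a.val M)
  | .add a b => a.val M + b.val M
  | .sub a b => a.val M - b.val M
  | .mul a b => a.val M * b.val M
  | .div a b => a.val M / b.val M

/-- Cost of evaluating an expression. -/
def Expr.cost (M : Mem) : Expr → ℕ
  | .lit c => len c
  | .load a => a.cost M + len (a.val M) + len (M (a.val M))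
  | .add a b => a.cost M + b.cost M + len (a.val M) + len (b.val M)
  | .sub a b => a.cost M + b.cost M + len (a.val M) + len (b.val M)
  | .mul a b => a.cost M + b.cost M + len (a.val M) * len (b.val M)
  | .div a b => a.cost M + b.cost M + len (a.val M) * len (b.val M)

/-- Programs. `store a e` writes the value of `e` to the register whose address is the value of
`a`; `cond e P Q` runs `P` if `e` is nonzero and `Q` otherwise; `loop e P` runs `P` as long as `e`
is nonzero. -/
inductive Prog : Type
  | skip : Prog
  | store (a e : Expr) : Prog
  | seq (P Q : Prog) : Prog
  | cond (e : Expr) (P Q : Prog) : Prog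
  | loop (e : Expr) (P : Prog) : Prog

/-- `Run P M t M'`: started with memory `M`, the program `P` halts with memory `M'`, and the total
cost of the operations it performs is `t`. -/
inductive Run : Prog → Mem → ℕ → Mem → Prop
  | skip (M : Mem) : Run .skip M 1 M
  | store (a e : Expr) (M : Mem) :
      Run (.store a e) M (a.cost M + e.cost M + len (a.val M) + len (e.val M))
        (Function.update M (a.val M) (e.val M))
  | seq {P Q : Prog} {M M₁ M₂ : Mem} {s t : ℕ} :
      Run P M s M₁ → Run Q M₁ t M₂ → Run (.seq P Q) M (s + t) M₂
  | cond_true {e : Expr} {P Q : Prog} {M M' : Mem} {t : ℕ} :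
      e.val M ≠ 0 → Run P M t M' → Run (.cond e P Q) M (e.cost M + len (e.val M) + t) M'
  | cond_false {e : Expr} {P Q : Prog} {M M' : Mem} {t : ℕ} :
      e.val M = 0 → Run Q M t M' → Run (.cond e P Q) M (e.cost M + len (e.val M) + t) M'
  | loop_stop {e : Expr} {P : Prog} {M : Mem} :
      e.val M = 0 → Run (.loop e P) M (e.cost M + len (e.val M)) M
  | loop_step {e : Expr} {P : Prog} {M M₁ M₂ : Mem} {s t : ℕ} :
      e.val M ≠ 0 → Run P M s M₁ → Run (.loop e P) M₁ t M₂ →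
      Run (.loop e P) M (e.cost M + len (e.val M) + s + t) M₂

/-- The initial memory for an input word: the word in registers `0, 1, 2, …`, zeros after it. -/
def init (w : List ℕ) : Mem := fun r => w.getD r 0

/-- `P` decides the problem `L`, with instances written as words by `code`, in time at most
`T x` on every instance `x`; the answer (1 for YES, 0 for NO) is left in register `0`. -/
def DecidesWithin {ι : Type} (P : Prog) (code : ι → List ℕ) (L : ι → Prop) (T : ι → ℝ) : Prop :=
  ∀ x : ι, ∃ (t : ℕ) (M : Mem), Run P (init (code x)) t M ∧
    (L x → M 0 = 1) ∧ (¬ L x → M 0 = 0) ∧ (t : ℝ) ≤ T x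

/-- `L` can be solved in time `O*(f)`: some program decides it in time `f(x) · p(size x)` for
some polynomial `p`. -/
def SolvableInOStar {ι : Type} (code : ι → List ℕ) (L : ι → Prop) (size : ι → ℕ) (f : ι → ℝ) :
    Prop :=
  ∃ (P : Prog) (p : Polynomial ℕ), DecidesWithin P code L (fun x => f x * (p.eval (size x) : ℕ))

end RAM

/-! ## Maximum Happy Edges -/

/-- The happy edges of a vertex-colored graph: those whose endpoints have the same color. -/
def happyEdges {V κ : Type} (G : SimpleGraph V) (c : V → κ) : Set (Sym2 V) :=
  {e | e ∈ G.edgeSet ∧ ∀ u ∈ e, ∀ v ∈ e, c u = c v}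

/-- `c'` is an extended full coloring of the partial coloring `c` (`none` means uncolored). -/
def IsExtendedFullColoring {V κ : Type} (c : V → Option κ) (c' : V → κ) : Prop :=
  ∀ v i, c v = some i → c' v = i

/-- An instance of `k`-MHE: a simple graph on `n` vertices, a partial `k`-coloring of its vertices,
and the target number `ell` of happy edges. -/
structure MHE (k : ℕ) : Type where
  n : ℕ
  G : SimpleGraph (Fin n)
  c : Fin n → Option (Fin k)
  ell : ℕ

namespace MHE

/-- The YES-instances: some extended full coloring has at least `ell` happy edges. -/
def IsYes {k : ℕ} (I : MHE k) : Prop :=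
  ∃ c' : Fin I.n → Fin k, IsExtendedFullColoring I.c c' ∧ I.ell ≤ (happyEdges I.G c').ncard

open Classical in
/-- The input word of an instance: the number of vertices, the target, the colors of the vertices
(`0` for an uncolored vertex, `i + 1` for color `i : Fin k`), and the adjacency matrix, row by
row. -/
noncomputable def code {k : ℕ} (I : MHE k) : List ℕ :=
  I.n :: I.ell ::
    (List.ofFn (fun v : Fin I.n => (I.c v).elim 0 (fun i => (i : ℕ) + 1)) ++
      List.ofFn (fun p : Fin (I.n * I.n) => if I.G.Adj p.divNat p.modNat then 1 else 0))

end MHE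

/-! Contract the precolored vertices of each color to one terminal, and let the weight of an ordered
pair of vertices be the number of edges it stands for. `valOn` counts ordered pairs, so the target
becomes `2 * ell`. The terminals carry the colors, and the remaining vertices are open.

Some open vertices can be eliminated without loss. A vertex adjacent to terminals only contributes
at best its heaviest edge, because terminals have distinct colors. A vertex of degree at most two
contributes at best its heaviest edge, plus one more exactly when it has two neighbors of equal
color; joining those neighbors by an edge records this bonus. In both cases the target drops by the
heaviest weight (`sol_elim`), and the total weight does not grow (`sum_elim_le`).

An irreducible instance with `u` open vertices always has a good coloring. Growing the colored part
along edges gains one happy edge per vertex, and a part cut off from everything colored can be made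
monochromatic (`exists_coloring_two_mul_card`). With three colors, averaging over the three
colorings that are constant on the open vertices gives `7/6` happy edges per vertex
(`sol_three_of_le`). So the answer is YES unless `u < ell`, respectively `7 * u < 6 * ell`.

The remaining case is decided with `2 ^ u` times polynomially many operations on numbers of
polynomial bit length. A coloring is a partition of the open vertices into `k` classes. Give a class
a monomial whose exponent is a large multiple of its cardinality plus one, minus its weight.
Inclusion and exclusion over subsets (`even_sum_eq`), with the subset sums tabulated by `zeta`,
yields the sum of the monomials over all covers by `k` sets. Overlapping covers have larger
exponents, and the base exceeds the number of covers, so one residue tells whether a partition of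
sufficient weight exists (`sol_iff_mod`). For three colors the base is `2 ^ (6/7)`, which is below
`1.89`.

For the running time, the algorithm is written in a small array language whose loops are marked as
ordinary (polynomially many rounds) or big (at most `E` rounds). `Cmd.run_compile` turns a run
within the limits into a RAM run of bounded cost, and syntactically the main program nests big loops
only to depth one (`mainProg_bigDeg`). -/

/-! ## Structured array programs

A small language of counting-loop programs over named two-dimensional arrays, compiled to RAM
programs. Arrays are stored after the input word, whose registers are only read. -/

namespace ArrayProg

/-- The names of the arrays; a scalar variable is the entry `(0, 0)` of its array. -/
inductive Var : Type
  | n | t | N | L | W | al | u | V | a | b | ra | rb | v | d | du | mx | row | rd | i | j | p | q | X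
  | s | c | e | r | Q | pow | A | pw | pos | neg | pr | tot | ans
deriving DecidableEq

/-- A number below `64` naming the array. -/
def Var.idx (x : Var) : ℕ := x.ctorIdx

theorem Var.idx_injective : Function.Injective Var.idx := by
  intro x y h
  have := congrArg Var.ofNat h
  simpa [Var.idx, Var.ofNat_ctorIdx] using this

theorem Var.idx_lt (x : Var) : x.idx < 64 := by
  cases x <;> decide

/-- Contents of the arrays. -/
abbrev St : Type := Var → ℕ → ℕ → ℕ

/-- Overwriting one array entry. -/
def St.upd (S : St) (x : Var) (i j v : ℕ) : St :=
  fun y i' j' => if y = x ∧ i' = i ∧ j' = j then v else S y i' j'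

theorem St.upd_apply (S : St) (x : Var) (i j v : ℕ) (y : Var) (i' j' : ℕ) :
    S.upd x i j v y i' j' = if y = x ∧ i' = i ∧ j' = j then v else S y i' j' := rfl

theorem St.upd_of_ne (S : St) {x y : Var} (h : y ≠ x) (i j v : ℕ) : S.upd x i j v y = S y := by
  funext i' j'; simp [St.upd, h]

/-- Expressions. -/
inductive Ex : Type
  | lit (c : ℕ)
  | arr (x : Var) (i j : Ex)
  | add (e f : Ex)
  | sub (e f : Ex)
  | mul (e f : Ex)
  | div (e f : Ex)

namespace Ex

instance (n : ℕ) : OfNat Ex n := ⟨.lit n⟩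
instance : Add Ex := ⟨.add⟩
instance : Sub Ex := ⟨.sub⟩
instance : Mul Ex := ⟨.mul⟩
instance : Div Ex := ⟨.div⟩

/-- A scalar variable. -/
def var (x : Var) : Ex := .arr x 0 0

/-- Value of an expression. -/
def val (S : St) : Ex → ℕ
  | .lit c => c
  | .arr x i j => S x (i.val S) (j.val S)
  | .add e f => e.val S + f.val S
  | .sub e f => e.val S - f.val S
  | .mul e f => e.val S * f.val S
  | .div e f => e.val S / f.val S

section
variable (S : St) (e f : Ex)
@[simp] theorem val_lit (c : ℕ) : (lit c).val S = c := rfl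
@[simp] theorem val_two : (2 : Ex).val S = 2 := rfl
@[simp] theorem val_three : (3 : Ex).val S = 3 := rfl
@[simp] theorem val_zero : (0 : Ex).val S = 0 := rfl
@[simp] theorem val_one : (1 : Ex).val S = 1 := rfl
@[simp] theorem val_arr (x : Var) : (arr x e f).val S = S x (e.val S) (f.val S) := rfl
@[simp] theorem val_var (x : Var) : (var x).val S = S x 0 0 := rfl
@[simp] theorem val_add : (e + f).val S = e.val S + f.val S := rfl
@[simp] theorem val_sub : (e - f).val S = e.val S - f.val S := rfl
@[simp] theorem val_mul : (e * f).val S = e.val S * f.val S := rfl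
@[simp] theorem val_div : (e / f).val S = e.val S / f.val S := rfl
end

/-- The arrays an expression reads. -/
def reads : Ex → Var → Bool
  | .lit _, _ => false
  | .arr x i j, y => x = y || (i.reads y || j.reads y)
  | .add e f, y => e.reads y || f.reads y
  | .sub e f, y => e.reads y || f.reads y
  | .mul e f, y => e.reads y || f.reads y
  | .div e f, y => e.reads y || f.reads y

/-- The expression reads none of the arrays given by `f`. -/
def avoids (f : Var → Bool) : Ex → Bool
  | .lit _ => true
  | .arr x i j => !f x && (i.avoids f && j.avoids f)
  | .add e g => e.avoids f && g.avoids f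
  | .sub e g => e.avoids f && g.avoids f
  | .mul e g => e.avoids f && g.avoids f
  | .div e g => e.avoids f && g.avoids f

/-- `avoids` recurses over the expression only, so well-formedness of a concrete program evaluates
without quantifying over array names; this recovers the quantified form used in proofs. -/
theorem avoids_and_eq_false {f : Var → Bool} {e : Ex} (h : e.avoids f = true) (y : Var) :
    (f y && e.reads y) = false := by
  induction e with
  | lit c => simp [reads]
  | arr x i j ihi ihj =>
    simp only [avoids, Bool.and_eq_true] at h
    have h1 := ihi h.2.1
    have h2 := ihj h.2.2
    by_cases hx : x = y
    · subst hx
      have := h.1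
      simp_all
    · simp_all [reads]
  | add e g ihe ihg | sub e g ihe ihg | mul e g ihe ihg | div e g ihe ihg =>
    simp only [avoids, Bool.and_eq_true] at h
    have h1 := ihe h.1
    have h2 := ihg h.2
    simp_all [reads]

theorem val_congr {S S' : St} (e : Ex) (h : ∀ y, e.reads y = true → S y = S' y) :
    e.val S = e.val S' := by
  induction e with
  | lit c => rfl
  | arr x i j ihi ihj =>
    simp only [reads, Bool.or_eq_true] at h
    simp only [val_arr]
    rw [ihi fun y hy => h y (Or.inr (Or.inl hy)), ihj fun y hy => h y (Or.inr (Or.inr hy)),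
      h x (by simp)]
  | add e f ihe ihf | sub e f ihe ihf | mul e f ihe ihf | div e f ihe ihf =>
    simp only [reads, Bool.or_eq_true] at h
    simp only [val]
    rw [ihe fun y hy => h y (Or.inl hy), ihf fun y hy => h y (Or.inr hy)]

end Ex

/-- Programs: assignments, `read x e` copying the input register `e` to `x`, sequences,
branches, and loops in which `x` counts from `0` to the value of `e`. The flag of a loop tells which of two bounds is claimed for the number of rounds. -/
inductive Cmd : Type
  | skip
  | set (x : Var) (i j e : Ex)
  | read (x : Var) (e : Ex)
  | seq (c d : Cmd)
  | ite (e : Ex) (c d : Cmd)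
  | countLoop (big : Bool) (x : Var) (e : Ex) (c : Cmd)

namespace Cmd

/-- Assignment to a scalar variable. -/
def put (x : Var) (e : Ex) : Cmd := .set x 0 0 e

/-- The state in which round `m` of a loop with counter `x` and body `f` starts. -/
def rounds (f : St → St) (x : Var) (S : St) : ℕ → St
  | 0 => S.upd x 0 0 0
  | m + 1 => (f (rounds f x S m)).upd x 0 0 (m + 1)

/-- The state after running a program. -/
def exec (w : ℕ → ℕ) : Cmd → St → St
  | .skip, S => S
  | .set x i j e, S => S.upd x (i.val S) (j.val S) (e.val S)
  | .read x e, S => S.upd x 0 0 (w (e.val S))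
  | .seq c d, S => d.exec w (c.exec w S)
  | .ite e c d, S => if e.val S ≠ 0 then c.exec w S else d.exec w S
  | .countLoop _ x e c, S => rounds (c.exec w) x S (e.val S)

/-- The arrays a program may write. -/
def writes : Cmd → Var → Bool
  | .skip, _ => false
  | .set x _ _ _, y => x = y
  | .read x _, y => x = y
  | .seq c d, y => c.writes y || d.writes y
  | .ite _ c d, y => c.writes y || d.writes y
  | .countLoop _ x _ c, y => x = y || c.writes y

theorem rounds_frame {f : St → St} {x y : Var} (hy : y ≠ x) (hf : ∀ S, f S y = S y) (S : St)
    (m : ℕ) : rounds f x S m y = S y := by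
  induction m with
  | zero => exact St.upd_of_ne _ hy _ _ _
  | succ m ih => rw [rounds, St.upd_of_ne _ hy, hf, ih]

/-- Since `writes` is computable, every later claim that an array survives a subprogram reduces to
`rfl`. -/
theorem exec_frame (w : ℕ → ℕ) (c : Cmd) {y : Var} (hy : c.writes y = false) (S : St) :
    c.exec w S y = S y := by
  induction c generalizing S with
  | skip => rfl
  | set x i j e | read x e =>
    simp only [writes, decide_eq_false_iff_not] at hy
    exact St.upd_of_ne _ (Ne.symm hy) _ _ _
  | seq c d ihc ihd =>
    simp only [writes, Bool.or_eq_false_iff] at hy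
    rw [exec, ihd hy.2, ihc hy.1]
  | ite e c d ihc ihd =>
    simp only [writes, Bool.or_eq_false_iff] at hy
    rw [exec]
    split_ifs
    · exact ihc hy.1 S
    · exact ihd hy.2 S
  | countLoop big x e c ih =>
    simp only [writes, Bool.or_eq_false_iff, decide_eq_false_iff_not] at hy
    exact rounds_frame (Ne.symm hy.1) (ih hy.2) S _

/-- Loops do not modify their counter or the data their bound depends on. -/
def wf : Cmd → Bool
  | .skip => true
  | .set _ _ _ _ => true
  | .read _ _ => true
  | .seq c d => c.wf && d.wf
  | .ite _ c d => c.wf && d.wf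
  | .countLoop _ x e c => !c.writes x && (!e.reads x && (e.avoids c.writes && c.wf))

end Cmd

/-- Resource limits of a run: the input word, the bit length of the array entries, and the bounds
for the two kinds of loops. -/
structure Lim : Type where
  w : ℕ → ℕ
  B : ℕ
  K : ℕ
  E : ℕ

/-- The bound for a kind of loops. -/
def Lim.rounds (l : Lim) (big : Bool) : ℕ := if big then l.E else l.K

/-- A run stays within the limits. -/
def Cmd.Ok (l : Lim) : Cmd → St → Prop
  | .skip, _ => True
  | .set _ _ _ e, S => e.val S < 2 ^ l.B
  | .read _ e, S => e.val S < l.w 0 * l.w 0 + l.w 0 + 2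
  | .seq c d, S => c.Ok l S ∧ d.Ok l (c.exec l.w S)
  | .ite e c d, S => (e.val S ≠ 0 → c.Ok l S) ∧ (e.val S = 0 → d.Ok l S)
  | .countLoop big x e c, S => e.val S ≤ l.rounds big ∧
      ∀ m < e.val S, c.Ok l (Cmd.rounds (c.exec l.w) x S m)

/-- Started in `S`, the program stays within the limits and ends in a state satisfying `P`. -/
def Tri (l : Lim) (c : Cmd) (S : St) (P : St → Prop) : Prop := c.Ok l S ∧ P (c.exec l.w S)

/-! ### Proof rules for runs within the limits -/

namespace Tri

variable {l : Lim} {S : St} {P : St → Prop}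

theorem skip (h : P S) : Tri l .skip S P := ⟨trivial, h⟩

theorem set {x : Var} {i j e : Ex} (hb : e.val S < 2 ^ l.B)
    (h : P (S.upd x (i.val S) (j.val S) (e.val S))) : Tri l (.set x i j e) S P :=
  ⟨hb, h⟩

theorem put {x : Var} {e : Ex} (hb : e.val S < 2 ^ l.B)
    (h : P (S.upd x 0 0 (e.val S))) : Tri l (.put x e) S P := ⟨hb, h⟩

theorem read {x : Var} {e : Ex} (hb : e.val S < l.w 0 * l.w 0 + l.w 0 + 2)
    (h : P (S.upd x 0 0 (l.w (e.val S)))) : Tri l (.read x e) S P := ⟨hb, h⟩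

theorem seq {c d : Cmd} (h : Tri l c S fun S' => Tri l d S' P) : Tri l (.seq c d) S P :=
  ⟨⟨h.1, h.2.1⟩, h.2.2⟩

/-- Weakening also supplies the frame condition, so postconditions need only mention what a
subprogram changes. -/
theorem mono {c : Cmd} {P' : St → Prop} (h : Tri l c S P)
    (hP : ∀ S', (∀ y, c.writes y = false → S' y = S y) → P S' → P' S') : Tri l c S P' :=
  ⟨h.1, hP _ (fun _ hy => Cmd.exec_frame _ _ hy _) h.2⟩

theorem ite {e : Ex} {c d : Cmd} (hc : e.val S ≠ 0 → Tri l c S P)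
    (hd : e.val S = 0 → Tri l d S P) : Tri l (.ite e c d) S P := by
  refine ⟨⟨fun h => (hc h).1, fun h => (hd h).1⟩, ?_⟩
  rw [Cmd.exec]
  split_ifs with h
  · exact (hc h).2
  · exact (hd (not_not.1 h)).2

/-- The invariant is stated for the state after the counter has been set. Therefore the step has to
establish it for the body's result with the counter overwritten by `m + 1`. -/
theorem countLoop {big : Bool} {x : Var} {e : Ex} {c : Cmd} {n : ℕ} (I : ℕ → St → Prop)
    (hn : e.val S = n) (hb : n ≤ l.rounds big)
    (h0 : I 0 (S.upd x 0 0 0))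
    (hs : ∀ m < n, ∀ S', (∀ y, (Cmd.countLoop big x e c).writes y = false → S' y = S y) →
      S' x 0 0 = m → I m S' → Tri l c S' fun S'' => I (m + 1) (S''.upd x 0 0 (m + 1)))
    (hP : ∀ S', (∀ y, (Cmd.countLoop big x e c).writes y = false → S' y = S y) → I n S' → P S') :
    Tri l (.countLoop big x e c) S P := by
  subst hn
  have hfr : ∀ m, ∀ y, (Cmd.countLoop big x e c).writes y = false →
      Cmd.rounds (c.exec l.w) x S m y = S y := by
    intro m y hy
    simp only [Cmd.writes, Bool.or_eq_false_iff, decide_eq_false_iff_not] at hy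
    exact Cmd.rounds_frame (Ne.symm hy.1) (fun S => Cmd.exec_frame _ _ hy.2 S) S m
  have hcnt : ∀ m, Cmd.rounds (c.exec l.w) x S m x 0 0 = m := by
    intro m
    cases m <;> simp [Cmd.rounds, St.upd]
  have key : ∀ m ≤ e.val S, I m (Cmd.rounds (c.exec l.w) x S m) := by
    intro m
    induction m with
    | zero => exact fun _ => h0
    | succ m ih =>
      intro hm
      exact (hs m hm _ (hfr m) (hcnt m) (ih (by omega))).2
  exact ⟨⟨hb, fun m hm => (hs m hm _ (hfr m) (hcnt m) (key m hm.le)).1⟩,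
    hP _ (hfr _) (key _ le_rfl)⟩

end Tri

/-! ### Compilation -/

open RAM (Expr Prog Run Mem len)

/-- The first register after the input word. -/
def baseExpr : Expr :=
  .add (.add (.mul (.load (.lit 0)) (.load (.lit 0))) (.load (.lit 0))) (.lit 2)

/-- The register of an array entry. -/
def addrExpr (x : Var) (i j : Expr) : Expr :=
  .add (.add baseExpr (.mul (.lit 64) (.add (.mul (.add i j) (.add i j)) i))) (.lit x.idx)

/-- Compilation of expressions. -/
def Ex.compile : Ex → Expr
  | .lit c => .lit c
  | .arr x i j => .load (addrExpr x i.compile j.compile)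
  | .add e f => .add e.compile f.compile
  | .sub e f => .sub e.compile f.compile
  | .mul e f => .mul e.compile f.compile
  | .div e f => .div e.compile f.compile

/-- Compilation of programs. -/
def Cmd.compile : Cmd → Prog
  | .skip => .skip
  | .set x i j e => .store (addrExpr x i.compile j.compile) e.compile
  | .read x e => .store (addrExpr x (.lit 0) (.lit 0)) (.load e.compile)
  | .seq c d => .seq c.compile d.compile
  | .ite e c d => .cond e.compile c.compile d.compile
  | .countLoop _ x e c => .seq (.store (addrExpr x (.lit 0) (.lit 0)) (.lit 0))
      (.loop (.sub e.compile (Ex.var x).compile)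
        (.seq c.compile (.store (addrExpr x (.lit 0) (.lit 0))
          (.add (Ex.var x).compile (.lit 1)))))

/-- The register of an array entry, given the input word. -/
def addr (w : ℕ → ℕ) (x : Var) (i j : ℕ) : ℕ :=
  w 0 * w 0 + w 0 + 2 + 64 * ((i + j) * (i + j) + i) + x.idx

/-- The residue modulo 64 gives the array name. The number `(i + j) ^ 2 + i` lies between the
squares of `i + j` and `i + j + 1`, so it determines `i + j` and then `i`. -/
theorem addr_inj {w : ℕ → ℕ} {x y : Var} {i j i' j' : ℕ}
    (h : addr w x i j = addr w y i' j') : x = y ∧ i = i' ∧ j = j' := by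
  have hx := x.idx_lt
  have hy := y.idx_lt
  unfold addr at h
  have h1 : x.idx = y.idx := by omega
  have h2 : (i + j) * (i + j) + i = (i' + j') * (i' + j') + i' := by omega
  have h3 : i + j = i' + j' := by
    rcases lt_trichotomy (i + j) (i' + j') with h | h | h
    · nlinarith
    · exact h
    · nlinarith
  have h4 : i = i' := by rw [h3] at h2; omega
  exact ⟨Var.idx_injective h1, h4, by omega⟩

/-- The memory `M` holds the input word `w` followed by the arrays `S`. -/
def Rep (w : ℕ → ℕ) (S : St) (M : Mem) : Prop :=
  (∀ r < w 0 * w 0 + w 0 + 2, M r = w r) ∧ ∀ x i j, M (addr w x i j) = S x i j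

theorem Rep.val_addrExpr {w : ℕ → ℕ} {S : St} {M : Mem} (h : Rep w S M) (x : Var) (i j : Expr) :
    (addrExpr x i j).val M = addr w x (i.val M) (j.val M) := by
  simp [addrExpr, baseExpr, Expr.val, addr, h.1 0 (by omega)]

theorem Rep.val_compile {w : ℕ → ℕ} {S : St} {M : Mem} (h : Rep w S M) (e : Ex) :
    e.compile.val M = e.val S := by
  induction e with
  | lit c => rfl
  | arr x i j ihi ihj =>
    rw [Ex.compile, Expr.val, h.val_addrExpr, ihi, ihj, h.2]; rfl
  | add e f ihe ihf | sub e f ihe ihf | mul e f ihe ihf | div e f ihe ihf =>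
    simp [Ex.compile, Expr.val, Ex.val, ihe, ihf]

theorem Rep.update {w : ℕ → ℕ} {S : St} {M : Mem} (h : Rep w S M) (x : Var) (i j v : ℕ) :
    Rep w (S.upd x i j v) (Function.update M (addr w x i j) v) := by
  refine ⟨fun r hr => ?_, fun y i' j' => ?_⟩
  · rw [Function.update_of_ne, h.1 r hr]
    unfold addr; omega
  · by_cases hy : y = x ∧ i' = i ∧ j' = j
    · obtain ⟨rfl, rfl, rfl⟩ := hy
      simp [St.upd]
    · rw [Function.update_of_ne, h.2, St.upd_apply, if_neg hy]
      exact fun he => hy (addr_inj he)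

/-! ### Cost of evaluating expressions -/

/-- A bound for the growth of the bit length under evaluation. -/
def weight : Expr → ℕ
  | .lit c => Nat.size c + 1
  | .load _ => 1
  | .add a b => weight a + weight b
  | .sub a _ => weight a
  | .mul a b => weight a + weight b
  | .div a _ => weight a

theorem one_le_weight (e : Expr) : 1 ≤ weight e := by
  induction e <;> simp only [weight] <;> omega

/-- A bound for the cost of an evaluation, in units of the squared bit length. -/
def evalCost : Expr → ℕ
  | .lit c => Nat.size c + 1
  | .load a => evalCost a + weight a + 1
  | .add a b => evalCost a + evalCost b + weight a + weight b
  | .sub a b => evalCost a + evalCost b + weight a + weight b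
  | .mul a b => evalCost a + evalCost b + weight a * weight b
  | .div a b => evalCost a + evalCost b + weight a * weight b

/-- Bit lengths at most add up under sums and products, while a load starts again from a register
value; so the growth depends only on the expression. -/
theorem val_lt_two_pow {M : Mem} {B : ℕ} (hB : 1 ≤ B) (hM : ∀ r, M r < 2 ^ B) (e : Expr) :
    e.val M < 2 ^ (B * weight e) := by
  induction e with
  | lit c =>
    refine (Nat.lt_size_self c).trans_le (Nat.pow_le_pow_right (by norm_num) ?_)
    simp only [weight]; nlinarith
  | load a => simpa [weight, Expr.val] using hM _
  | add a b iha ihb =>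
    have h1 : 2 ≤ 2 ^ (B * weight a) := by
      simpa using Nat.pow_le_pow_right (n := 2) (by norm_num) (Nat.mul_le_mul hB (one_le_weight a))
    have h2 : 2 ≤ 2 ^ (B * weight b) := by
      simpa using Nat.pow_le_pow_right (n := 2) (by norm_num) (Nat.mul_le_mul hB (one_le_weight b))
    simp only [Expr.val, weight, Nat.mul_add, pow_add]
    nlinarith
  | sub a b iha ihb => exact (Nat.sub_le _ _).trans_lt iha
  | mul a b iha ihb =>
    simp only [Expr.val, weight, Nat.mul_add, pow_add]
    exact Nat.mul_lt_mul'' iha ihb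
  | div a b iha ihb => exact (Nat.div_le_self _ _).trans_lt iha

theorem len_le_of_lt {v B m : ℕ} (hm : 1 ≤ m) (h : v < 2 ^ (B * m)) : len v ≤ m * (B + 1) := by
  have := Nat.size_le.2 h
  unfold len; nlinarith

theorem len_val_le {M : Mem} {B : ℕ} (hB : 1 ≤ B) (hM : ∀ r, M r < 2 ^ B) (e : Expr) :
    len (e.val M) ≤ weight e * (B + 1) :=
  len_le_of_lt (one_le_weight e) (val_lt_two_pow hB hM e)

theorem len_val_le_sq {M : Mem} {B : ℕ} (hB : 1 ≤ B) (hM : ∀ r, M r < 2 ^ B) (e : Expr) :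
    len (e.val M) ≤ weight e * (B + 1) ^ 2 :=
  (len_val_le hB hM e).trans (Nat.mul_le_mul_left _ (Nat.le_self_pow (by norm_num) _))

/-- The square comes from multiplication and division, which are charged the product of two lengths;
all other charges are linear in the bit length. -/
theorem cost_le {M : Mem} {B : ℕ} (hB : 1 ≤ B) (hM : ∀ r, M r < 2 ^ B) (e : Expr) :
    e.cost M ≤ evalCost e * (B + 1) ^ 2 := by
  induction e with
  | lit c =>
    have := len_val_le_sq hB hM (.lit c)
    simpa [evalCost, weight, Expr.cost, Expr.val] using this
  | load a iha =>
    have h1 := len_val_le_sq hB hM a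
    have h2 := len_val_le_sq hB hM (.load a)
    simp only [weight, Expr.val] at h2
    simp only [Expr.cost, evalCost, Nat.add_mul]
    omega
  | add a b iha ihb | sub a b iha ihb =>
    have h1 := len_val_le_sq hB hM a
    have h2 := len_val_le_sq hB hM b
    simp only [Expr.cost, evalCost, Nat.add_mul]
    omega
  | mul a b iha ihb | div a b iha ihb =>
    have h1 := Nat.mul_le_mul (len_val_le hB hM a) (len_val_le hB hM b)
    have h2 : weight a * (B + 1) * (weight b * (B + 1)) = weight a * weight b * (B + 1) ^ 2 := by
      ring
    simp only [Expr.cost, evalCost, Nat.add_mul]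
    omega

/-- A bound for the cost of a store. -/
def storeCost (a e : Expr) : ℕ := evalCost a + evalCost e + weight a + weight e

theorem run_store {M : Mem} {B : ℕ} (hB : 1 ≤ B) (hM : ∀ r, M r < 2 ^ B) (a e : Expr) :
    ∃ t, Run (.store a e) M t (Function.update M (a.val M) (e.val M)) ∧
      t ≤ storeCost a e * (B + 1) ^ 2 := by
  refine ⟨_, .store a e M, ?_⟩
  have h1 := cost_le hB hM a
  have h2 := cost_le hB hM e
  have h3 := len_val_le_sq hB hM a
  have h4 := len_val_le_sq hB hM e
  simp only [storeCost, Nat.add_mul]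
  omega

theorem update_lt {M : Mem} {B : ℕ} (hM : ∀ r, M r < 2 ^ B) {a v : ℕ} (hv : v < 2 ^ B) (r : ℕ) :
    Function.update M a v r < 2 ^ B := by
  by_cases h : r = a
  · subst h; simpa using hv
  · rw [Function.update_of_ne h]; exact hM r

/-! ### Time bound for compiled programs -/

namespace Cmd

/-- The register of a scalar variable. -/
def scalar (x : Var) : Expr := addrExpr x (.lit 0) (.lit 0)

/-- The test of a compiled loop. -/
def test (x : Var) (e : Ex) : Expr := .sub e.compile (Ex.var x).compile

/-- The increment in a compiled loop. -/
def next (x : Var) : Expr := .add (Ex.var x).compile (.lit 1)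

/-- Coefficient of the time bound. -/
def coeff : Cmd → ℕ
  | .skip => 1
  | .set x i j e => storeCost (addrExpr x i.compile j.compile) e.compile
  | .read x e => storeCost (scalar x) (.load e.compile)
  | .seq c d => c.coeff + d.coeff
  | .ite e c d => evalCost e.compile + weight e.compile + c.coeff + d.coeff
  | .countLoop _ x e c => storeCost (scalar x) (.lit 0) + 2 * (evalCost (test x e) + weight (test x e)) +
      storeCost (scalar x) (next x) + c.coeff

/-- Exponent of the bound for ordinary loops in the time bound. -/
def deg : Cmd → ℕ
  | .seq c d => max c.deg d.deg
  | .ite _ c d => max c.deg d.deg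
  | .countLoop big _ _ c => c.deg + if big then 0 else 1
  | _ => 0

/-- Exponent of the bound for big loops in the time bound. -/
def bigDeg : Cmd → ℕ
  | .seq c d => max c.bigDeg d.bigDeg
  | .ite _ c d => max c.bigDeg d.bigDeg
  | .countLoop big _ _ c => c.bigDeg + if big then 1 else 0
  | _ => 0

end Cmd

theorem test_val {w : ℕ → ℕ} {S : St} {M : Mem} (h : Rep w S M) (x : Var) (e : Ex) :
    (Cmd.test x e).val M = e.val S - S x 0 0 := by
  rw [Cmd.test, Expr.val, h.val_compile, h.val_compile]; rfl

theorem next_val {w : ℕ → ℕ} {S : St} {M : Mem} (h : Rep w S M) (x : Var) :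
    (Cmd.next x).val M = S x 0 0 + 1 := by
  rw [Cmd.next, Expr.val, h.val_compile]; rfl

theorem scalar_val {w : ℕ → ℕ} {S : St} {M : Mem} (h : Rep w S M) (x : Var) :
    (Cmd.scalar x).val M = addr w x 0 0 := h.val_addrExpr _ _ _

/-- The compiled loop evaluates its bound anew before each round, so the bound must not depend on
the counter or on anything the body writes. -/
theorem Cmd.val_rounds {w : ℕ → ℕ} {x : Var} {e : Ex} {c : Cmd} (he : e.reads x = false)
    (hc : ∀ y, (c.writes y && e.reads y) = false) (S : St) (m : ℕ) :
    e.val (rounds (c.exec w) x S m) = e.val S := by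
  refine e.val_congr fun y hy => rounds_frame ?_ (fun S => exec_frame w c ?_ S) S m
  · rintro rfl; simp [he] at hy
  · have := hc y
    simpa [hy] using this

theorem Cmd.counter_rounds {f : St → St} {x : Var} (S : St) (m : ℕ) :
    rounds f x S m x 0 0 = m := by
  cases m <;> simp [rounds, St.upd]

/-- A run of a compiled loop, given runs of its body. -/
theorem run_loop {l : Lim} (hB : 1 ≤ l.B) {x : Var} {e : Ex} {c : Cmd}
    (hx : c.writes x = false) (he : e.reads x = false)
    (hc : ∀ y, (c.writes y && e.reads y) = false) {S : St} {T : ℕ} (hN : e.val S < 2 ^ l.B)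
    (hbody : ∀ m < e.val S, ∀ M, Rep l.w (Cmd.rounds (c.exec l.w) x S m) M →
      (∀ r, M r < 2 ^ l.B) → ∃ t M', Run c.compile M t M' ∧
        Rep l.w (c.exec l.w (Cmd.rounds (c.exec l.w) x S m)) M' ∧ (∀ r, M' r < 2 ^ l.B) ∧ t ≤ T)
    (n m : ℕ) (hnm : m + n = e.val S) (M : Mem) (hR : Rep l.w (Cmd.rounds (c.exec l.w) x S m) M)
    (hM : ∀ r, M r < 2 ^ l.B) :
    ∃ t M', Run (.loop (Cmd.test x e) (.seq c.compile (.store (Cmd.scalar x) (Cmd.next x)))) M t M' ∧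
      Rep l.w (Cmd.rounds (c.exec l.w) x S (e.val S)) M' ∧ (∀ r, M' r < 2 ^ l.B) ∧
      t ≤ (n + 1) * ((evalCost (Cmd.test x e) + weight (Cmd.test x e)) * (l.B + 1) ^ 2) +
        n * (T + storeCost (Cmd.scalar x) (Cmd.next x) * (l.B + 1) ^ 2) := by
  have hval : (Cmd.test x e).val M = e.val S - m := by
    rw [test_val hR, Cmd.val_rounds he hc, Cmd.counter_rounds]
  have hcost := cost_le hB hM (Cmd.test x e)
  have hlen := len_val_le_sq hB hM (Cmd.test x e)
  have htest : (Cmd.test x e).cost M + len ((Cmd.test x e).val M) ≤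
      (evalCost (Cmd.test x e) + weight (Cmd.test x e)) * (l.B + 1) ^ 2 := by
    rw [Nat.add_mul]; omega
  -- Here `m` rounds have been completed and `n` remain; the state before round `m` already has its
  -- counter at `m`.
  induction n generalizing m M with
  | zero =>
    refine ⟨_, M, Run.loop_stop (by rw [hval]; omega), ?_, hM, by omega⟩
    rwa [← hnm]
  | succ n ih =>
    obtain ⟨t₁, M₁, hr₁, hR₁, hM₁, ht₁⟩ := hbody m (by omega) M hR hM
    obtain ⟨t₂, hr₂, ht₂⟩ := run_store hB hM₁ (Cmd.scalar x) (Cmd.next x)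
    have hcnt : c.exec l.w (Cmd.rounds (c.exec l.w) x S m) x 0 0 = m := by
      rw [Cmd.exec_frame _ _ hx, Cmd.counter_rounds]
    rw [scalar_val hR₁, next_val hR₁, hcnt] at hr₂
    have hR₂ := hR₁.update x 0 0 (m + 1)
    have hM₂ := update_lt hM₁ (a := addr l.w x 0 0) (show m + 1 < 2 ^ l.B by omega)
    have hval₂ : (Cmd.test x e).val (Function.update M₁ (addr l.w x 0 0) (m + 1)) =
        e.val S - (m + 1) := by
      rw [test_val hR₂]
      change e.val (Cmd.rounds (c.exec l.w) x S (m + 1)) -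
        Cmd.rounds (c.exec l.w) x S (m + 1) x 0 0 = _
      rw [Cmd.val_rounds he hc, Cmd.counter_rounds]
    have hcost₂ := cost_le hB hM₂ (Cmd.test x e)
    have hlen₂ := len_val_le_sq hB hM₂ (Cmd.test x e)
    obtain ⟨t₃, M₃, hr₃, hR₃, hM₃, ht₃⟩ := ih (m + 1) (by omega) _ hR₂ hM₂ hval₂ hcost₂ hlen₂
      (by rw [Nat.add_mul]; omega)
    refine ⟨_, M₃, .loop_step (by rw [hval]; omega) (.seq hr₁ hr₂) hr₃, hR₃, hM₃, ?_⟩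
    rw [Nat.add_mul n 1, Nat.add_mul (n + 1) 1]
    omega

/-- Compiled programs run within the time bound. -/
theorem Cmd.run_compile {l : Lim} (hB : 1 ≤ l.B) (hK : 1 ≤ l.K) (hKB : l.K < 2 ^ l.B)
    (hE : 1 ≤ l.E) (hEB : l.E < 2 ^ l.B) (hw : ∀ r < l.w 0 * l.w 0 + l.w 0 + 2, l.w r < 2 ^ l.B)
    (c : Cmd) (hc : c.wf = true) (S : St) (M : Mem) (hR : Rep l.w S M) (hM : ∀ r, M r < 2 ^ l.B)
    (hok : c.Ok l S) :
    ∃ t M', Run c.compile M t M' ∧ Rep l.w (c.exec l.w S) M' ∧ (∀ r, M' r < 2 ^ l.B) ∧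
      t ≤ c.coeff * (l.K ^ c.deg * l.E ^ c.bigDeg) * (l.B + 1) ^ 2 := by
  have hmono : ∀ {a b a' b' : ℕ}, a ≤ a' → b ≤ b' → l.K ^ a * l.E ^ b ≤ l.K ^ a' * l.E ^ b' :=
    fun h h' => Nat.mul_le_mul (Nat.pow_le_pow_right hK h) (Nat.pow_le_pow_right hE h')
  have hpos : ∀ a b : ℕ, 1 ≤ l.K ^ a * l.E ^ b :=
    fun a b => Nat.mul_pos (Nat.pow_pos hK) (Nat.pow_pos hE)
  have hgrow : ∀ {t A q a b : ℕ}, t ≤ A * q → t ≤ A * (l.K ^ a * l.E ^ b) * q := by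
    intro t A q a b h
    refine h.trans (Nat.mul_le_mul_right _ ?_)
    exact Nat.le_mul_of_pos_right _ (hpos a b)
  induction c generalizing S M with
  | skip =>
    refine ⟨1, M, .skip M, hR, hM, hgrow ?_⟩
    simpa [coeff] using Nat.one_le_pow 2 (l.B + 1) (by omega)
  | set x i j e =>
    obtain ⟨t, hr, ht⟩ := run_store hB hM (addrExpr x i.compile j.compile) e.compile
    rw [hR.val_addrExpr, hR.val_compile, hR.val_compile, hR.val_compile] at hr
    exact ⟨t, _, hr, hR.update _ _ _ _, update_lt hM hok, hgrow ht⟩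
  | read x e =>
    obtain ⟨t, hr, ht⟩ := run_store hB hM (scalar x) (.load e.compile)
    rw [scalar_val hR, Expr.val, hR.val_compile, hR.1 _ hok] at hr
    exact ⟨t, _, hr, hR.update _ _ _ _, update_lt hM (hw _ hok), hgrow ht⟩
  | seq c d ihc ihd =>
    simp only [wf, Bool.and_eq_true] at hc
    obtain ⟨t₁, M₁, hr₁, hR₁, hM₁, ht₁⟩ := ihc hc.1 S M hR hM hok.1
    obtain ⟨t₂, M₂, hr₂, hR₂, hM₂, ht₂⟩ := ihd hc.2 _ M₁ hR₁ hM₁ hok.2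
    refine ⟨_, M₂, .seq hr₁ hr₂, hR₂, hM₂, ?_⟩
    simp only [coeff, deg, bigDeg, Nat.add_mul]
    refine Nat.add_le_add (ht₁.trans ?_) (ht₂.trans ?_)
    · gcongr <;> first | exact hK | exact hE | exact le_max_left _ _
    · gcongr <;> first | exact hK | exact hE | exact le_max_right _ _
  | ite e c d ihc ihd =>
    simp only [wf, Bool.and_eq_true] at hc
    have h1 := cost_le hB hM e.compile
    have h2 := len_val_le_sq hB hM e.compile
    have h3 : e.compile.cost M + len (e.compile.val M) ≤
        (evalCost e.compile + weight e.compile) *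
          (l.K ^ (ite e c d).deg * l.E ^ (ite e c d).bigDeg) * (l.B + 1) ^ 2 :=
      hgrow (by rw [Nat.add_mul]; omega)
    by_cases h : e.val S ≠ 0
    · obtain ⟨t, M', hr, hR', hM', ht⟩ := ihc hc.1 S M hR hM (hok.1 h)
      refine ⟨_, M', .cond_true (by rwa [hR.val_compile]) hr, ?_, hM', ?_⟩
      · rwa [exec, if_pos h]
      · have h4 : c.coeff * (l.K ^ c.deg * l.E ^ c.bigDeg) * (l.B + 1) ^ 2 ≤
            c.coeff * (l.K ^ (ite e c d).deg * l.E ^ (ite e c d).bigDeg) * (l.B + 1) ^ 2 := by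
          simp only [deg, bigDeg]
          gcongr <;> first | exact hK | exact hE | exact le_max_left _ _
        refine (Nat.add_le_add h3 (ht.trans h4)).trans ?_
        rw [coeff, Nat.add_mul _ d.coeff, Nat.add_mul _ (d.coeff * _),
          Nat.add_mul _ c.coeff, Nat.add_mul _ (c.coeff * _)]
        omega
    · obtain ⟨t, M', hr, hR', hM', ht⟩ := ihd hc.2 S M hR hM (hok.2 (not_not.1 h))
      refine ⟨_, M', .cond_false (by rw [hR.val_compile]; exact not_not.1 h) hr, ?_, hM', ?_⟩
      · rwa [exec, if_neg h]
      · have h4 : d.coeff * (l.K ^ d.deg * l.E ^ d.bigDeg) * (l.B + 1) ^ 2 ≤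
            d.coeff * (l.K ^ (ite e c d).deg * l.E ^ (ite e c d).bigDeg) * (l.B + 1) ^ 2 := by
          simp only [deg, bigDeg]
          gcongr <;> first | exact hK | exact hE | exact le_max_right _ _
        refine (Nat.add_le_add h3 (ht.trans h4)).trans ?_
        rw [coeff, Nat.add_mul _ d.coeff, Nat.add_mul _ (d.coeff * _),
          Nat.add_mul _ c.coeff, Nat.add_mul _ (c.coeff * _)]
        omega
  | countLoop big x e c ih =>
    simp only [wf, Bool.and_eq_true, Bool.not_eq_eq_eq_not, Bool.not_true] at hc
    obtain ⟨hx, he, hav, hcw⟩ := hc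
    have hce := Ex.avoids_and_eq_false hav
    have hrB : l.rounds big < 2 ^ l.B := by cases big <;> simpa [Lim.rounds]
    have hr1 : 1 ≤ l.rounds big := by cases big <;> simpa [Lim.rounds]
    obtain ⟨t₁, hr₁, ht₁⟩ := run_store hB hM (scalar x) (.lit 0)
    rw [scalar_val hR] at hr₁
    have hM₁ := update_lt hM (a := addr l.w x 0 0) (v := 0) (by positivity)
    obtain ⟨t₂, M₂, hr₂, hR₂, hM₂, ht₂⟩ := run_loop hB hx he hce (hok.1.trans_lt hrB)
      (fun m hm M hR hM => ih hcw _ M hR hM (hok.2 m hm)) (e.val S) 0 (by omega) _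
      (hR.update x 0 0 0) hM₁
    refine ⟨_, M₂, .seq hr₁ hr₂, hR₂, hM₂, ?_⟩
    have hfac : l.K ^ (Cmd.countLoop big x e c).deg * l.E ^ (Cmd.countLoop big x e c).bigDeg =
        l.rounds big * (l.K ^ c.deg * l.E ^ c.bigDeg) := by
      cases big <;> simp [deg, bigDeg, Lim.rounds, pow_succ] <;> ring
    rw [hfac, coeff]
    have hn := hok.1
    generalize l.rounds big = R at *
    generalize e.val S = n at *
    have hF := hpos c.deg c.bigDeg
    generalize l.K ^ c.deg * l.E ^ c.bigDeg = F at *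
    generalize storeCost (scalar x) (.lit 0) = C₁ at *
    generalize evalCost (test x e) + weight (test x e) = C₂ at *
    generalize storeCost (scalar x) (next x) = C₃ at *
    generalize (l.B + 1) ^ 2 = D at *
    have hRF : 1 ≤ R * F := Nat.mul_pos hr1 hF
    have e1 : C₁ * D ≤ R * F * (C₁ * D) := Nat.le_mul_of_pos_left _ hRF
    -- A loop with `n` rounds performs `n + 1` tests; this is where the factor 2 in `coeff` comes
    -- from.
    have hn2 : n + 1 ≤ 2 * (R * F) := by nlinarith
    have e2 : (n + 1) * (C₂ * D) ≤ 2 * (R * F) * (C₂ * D) := Nat.mul_le_mul_right _ hn2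
    have hn3 : n ≤ R * F := by nlinarith
    have e3 : n * (C₃ * D) ≤ R * F * (C₃ * D) := Nat.mul_le_mul_right _ hn3
    have e4 : n * (c.coeff * F * D) ≤ R * (c.coeff * F * D) := Nat.mul_le_mul_right _ hn
    calc t₁ + t₂ ≤ C₁ * D + ((n + 1) * (C₂ * D) + (n * (c.coeff * F * D) + n * (C₃ * D))) := by
          rw [Nat.mul_add] at ht₂; omega
      _ ≤ R * F * (C₁ * D) + (2 * (R * F) * (C₂ * D) + (R * (c.coeff * F * D) +
          R * F * (C₃ * D))) := by omega
      _ = _ := by ring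

end ArrayProg

/-! ## Weighted instances and elimination of vertices

Vertices are natural numbers below `N`; the first `k` of them are terminals, vertex `t` carrying
the color `t`, and the set `U` holds the vertices still to be colored. -/

namespace Weighted

open Finset

/-- Total weight of the ordered monochromatic pairs in `s`. -/
def valOn (s : Finset ℕ) (W : ℕ → ℕ → ℕ) (χ : ℕ → ℕ) : ℕ :=
  ∑ a ∈ s, ∑ b ∈ s, if χ a = χ b then W a b else 0

/-- Colorings by `0, …, k - 1` that respect the terminals. -/
def IsColoring (k : ℕ) (χ : ℕ → ℕ) : Prop := (∀ t < k, χ t = t) ∧ ∀ v, χ v < k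

/-- Some coloring has monochromatic weight at least `L`. -/
def Sol (k N : ℕ) (W : ℕ → ℕ → ℕ) (L : ℕ) : Prop :=
  ∃ χ, IsColoring k χ ∧ L ≤ valOn (range N) W χ

/-- Weights are symmetric, and only terminals and vertices of `U` carry weight. -/
structure Valid (k N : ℕ) (U : Finset ℕ) (W : ℕ → ℕ → ℕ) : Prop where
  symm : ∀ a < N, ∀ b < N, W a b = W b a
  zero : ∀ a < N, k ≤ a → a ∉ U → ∀ b < N, W a b = 0
  diag : ∀ a < N, k ≤ a → W a a = 0
  sub : U ⊆ Ico k N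

/-- Weighted degree. -/
def wdeg (N : ℕ) (W : ℕ → ℕ → ℕ) (v : ℕ) : ℕ := ∑ a ∈ range N, W v a

/-- The weights after eliminating `v`; if `D` holds, the neighbors of `v` get joined. -/
def elim (W : ℕ → ℕ → ℕ) (v : ℕ) (D : Prop) [Decidable D] (a b : ℕ) : ℕ :=
  if a = v ∨ b = v then 0 else W a b + if a ≠ b ∧ D then W v a * W v b else 0

/-- Vertices whose elimination is easy: degree at most two, or adjacent to terminals only. -/
def Reducible (k N : ℕ) (W : ℕ → ℕ → ℕ) (v : ℕ) : Prop :=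
  wdeg N W v ≤ 2 ∨ ∀ a < N, k ≤ a → W v a = 0

/-- Isolates the contribution of `v`: twice the weight of its edges into its own color class,
because each such edge appears in both orders. -/
theorem valOn_split {N v : ℕ} {W : ℕ → ℕ → ℕ} (hv : v < N) (hs : ∀ a < N, W a v = W v a)
    (h0 : W v v = 0) (χ : ℕ → ℕ) :
    valOn (range N) W χ = valOn (range N) (fun a b => if a = v ∨ b = v then 0 else W a b) χ +
      2 * ∑ a ∈ range N, if χ a = χ v then W v a else 0 := by
  have hvN := mem_range.2 hv
  have h : ∀ a ∈ range N, ∀ b ∈ range N, (if χ a = χ b then W a b else 0) =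
      (if χ a = χ b then (if a = v ∨ b = v then 0 else W a b) else 0) +
      ((if a = v then (if χ b = χ v then W v b else 0) else 0) +
        if b = v then (if χ a = χ v then W v a else 0) else 0) := by
    intro a ha b hb
    rw [mem_range] at ha hb
    by_cases h1 : a = v <;> by_cases h2 : b = v
    · subst h1; subst h2; simp [h0]
    · subst h1; simp [h2, eq_comm]
    · subst h2; simp [h1, hs a ha]
    · simp [h1, h2]
  unfold valOn
  rw [sum_congr rfl fun a ha => sum_congr rfl (h a ha)]
  simp only [sum_add_distrib]
  rw [two_mul]
  congr 2
  · rw [sum_comm]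
    exact sum_congr rfl fun b _ => by simp [hv]
  · exact sum_congr rfl fun b _ => by simp [hv]

theorem valOn_elim {N v : ℕ} {W : ℕ → ℕ → ℕ} (h0 : W v v = 0) (D : Prop) [Decidable D]
    (χ : ℕ → ℕ) :
    valOn (range N) (elim W v D) χ =
      valOn (range N) (fun a b => if a = v ∨ b = v then 0 else W a b) χ +
      ∑ a ∈ range N, ∑ b ∈ range N,
        if χ a = χ b then (if a ≠ b ∧ D then W v a * W v b else 0) else 0 := by
  unfold valOn elim
  rw [← sum_add_distrib]
  refine sum_congr rfl fun a _ => ?_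
  rw [← sum_add_distrib]
  refine sum_congr rfl fun b _ => ?_
  by_cases h1 : a = v
  · subst h1; simp [h0]
  by_cases h2 : b = v
  · subst h2; simp [h0]
  simp only [h1, h2, or_self, if_false]
  split_ifs <;> simp

theorem sum_mul_self_eq {ι : Type*} [DecidableEq ι] (s : Finset ι) (w : ι → ℕ) :
    (∑ a ∈ s, w a) ^ 2 = ∑ a ∈ s, w a ^ 2 +
      ∑ a ∈ s, ∑ b ∈ s, if a ≠ b then w a * w b else 0 := by
  rw [sq, sum_mul_sum, ← sum_add_distrib]
  refine sum_congr rfl fun a ha => ?_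
  have : w a ^ 2 = ∑ b ∈ s, if a = b then w a * w b else 0 := by simp [ha, sq]
  rw [this, ← sum_add_distrib]
  exact sum_congr rfl fun b _ => by by_cases h : a = b <;> simp [h]

/-- Upper bound for the contribution of an eliminated vertex. If `s` is the weight into one class,
then `s ^ 2` is the sum of the squares, at most `mx * s`, plus the joined weight inside the class;
since `s ≤ 2`, only three values have to be checked. -/
theorem two_mul_class_le {N mx : ℕ} {w χ : ℕ → ℕ} (hmx : ∀ a < N, w a ≤ mx)
    (hd : ∑ a ∈ range N, w a ≤ 2) (c : ℕ) :
    2 * (∑ a ∈ range N, if χ a = c then w a else 0) ≤ 2 * mx +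
      ∑ a ∈ range N, ∑ b ∈ range N, if χ a = χ b then (if a ≠ b then w a * w b else 0) else 0 := by
  set C := (range N).filter (χ · = c) with hC
  have hsub : C ⊆ range N := filter_subset _ _
  have e := sum_mul_self_eq C w
  rw [← sum_filter]
  have hs : ∑ a ∈ C, w a ≤ 2 := (sum_le_sum_of_subset hsub).trans hd
  have h1 : ∑ a ∈ C, w a ^ 2 ≤ mx * ∑ a ∈ C, w a := by
    rw [mul_sum]
    refine sum_le_sum fun a ha => ?_
    rw [sq]
    exact Nat.mul_le_mul_right _ (hmx a (mem_range.1 (hsub ha)))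
  have h2 : (∑ a ∈ C, ∑ b ∈ C, if a ≠ b then w a * w b else 0) ≤ ∑ a ∈ range N, ∑ b ∈ range N,
      if χ a = χ b then (if a ≠ b then w a * w b else 0) else 0 := by
    refine (sum_le_sum fun a ha => ?_).trans (sum_le_sum_of_subset hsub)
    refine (sum_le_sum fun b hb => ?_).trans (sum_le_sum_of_subset hsub)
    rw [if_pos ((mem_filter.1 ha).2.trans (mem_filter.1 hb).2.symm)]
  -- Needed for `s = 1`, where the quadratic relations alone do not exclude `mx = 0`.
  have h3 : mx = 0 → ∑ a ∈ C, w a = 0 := fun h =>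
    sum_eq_zero fun a ha => Nat.eq_zero_of_le_zero (h ▸ hmx a (mem_range.1 (hsub ha)))
  generalize (∑ a ∈ range N, ∑ b ∈ range N,
    if χ a = χ b then (if a ≠ b then w a * w b else 0) else 0) = P at *
  generalize (∑ a ∈ C, ∑ b ∈ C, if a ≠ b then w a * w b else 0) = P' at *
  generalize ∑ a ∈ C, w a ^ 2 = q at *
  generalize ∑ a ∈ C, w a = s at *
  interval_cases s <;> omega

/-- The upper bound is attained by joining the class of a heaviest neighbor `m`. Without joined
monochromatic weight, `m` itself suffices. Otherwise two neighbors of weight one share a color, they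
use up the whole degree, and `m` is one of them. -/
theorem le_two_mul_class {N m : ℕ} {w χ : ℕ → ℕ} (hm : m < N)
    (hd : ∑ a ∈ range N, w a ≤ 2) (hmax : ∀ a < N, w a ≤ w m) :
    2 * w m + (∑ a ∈ range N, ∑ b ∈ range N,
      if χ a = χ b then (if a ≠ b then w a * w b else 0) else 0) ≤
      2 * ∑ a ∈ range N, if χ a = χ m then w a else 0 := by
  set P := ∑ a ∈ range N, ∑ b ∈ range N,
    if χ a = χ b then (if a ≠ b then w a * w b else 0) else 0 with hP
  have hmem := mem_range.2 hm
  have hge : w m ≤ ∑ a ∈ range N, if χ a = χ m then w a else 0 := by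
    simpa using single_le_sum (f := fun a => if χ a = χ m then w a else 0)
      (fun a _ => Nat.zero_le _) hmem
  rcases Nat.eq_zero_or_pos P with h0 | hpos
  · omega
  obtain ⟨a, ha, hpa⟩ := exists_ne_zero_of_sum_ne_zero hpos.ne'
  obtain ⟨b, hb, hpb⟩ := exists_ne_zero_of_sum_ne_zero hpa
  have hab : χ a = χ b := by by_contra h; simp [h] at hpb
  have hne : a ≠ b := by intro h; simp [h] at hpb
  rw [if_pos hab, if_pos hne] at hpb
  have hwa : 1 ≤ w a := Nat.pos_of_ne_zero (left_ne_zero_of_mul hpb)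
  have hwb : 1 ≤ w b := Nat.pos_of_ne_zero (right_ne_zero_of_mul hpb)
  have hwm : 1 ≤ w m := hwa.trans (hmax a (mem_range.1 ha))
  have hpair : ∀ f : ℕ → ℕ, f a + f b ≤ ∑ x ∈ range N, f x := fun f => by
    rw [← sum_pair hne]
    exact sum_le_sum_of_subset (by intro x hx; simp at hx; rcases hx with rfl | rfl <;> assumption)
  -- A third vertex of positive weight would push the degree above two.
  have hmab : m = a ∨ m = b := by
    by_contra h
    push Not at h
    have : ∑ x ∈ {m, a, b}, w x ≤ ∑ x ∈ range N, w x :=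
      sum_le_sum_of_subset
        (by intro x hx; simp at hx; rcases hx with rfl | rfl | rfl <;> assumption)
    rw [sum_insert (by simp [h.1, h.2]), sum_pair hne] at this
    omega
  have hχ : χ a = χ m ∧ χ b = χ m := by rcases hmab with rfl | rfl <;> simp [hab]
  have hs := hpair fun x => if χ x = χ m then w x else 0
  simp only [hχ.1, hχ.2, if_true] at hs
  have hdd := hpair w
  have hsq := hpair fun x => w x ^ 2
  have e := sum_mul_self_eq (range N) w
  have hPle : P ≤ ∑ a ∈ range N, ∑ b ∈ range N, if a ≠ b then w a * w b else 0 := by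
    refine sum_le_sum fun x _ => sum_le_sum fun y _ => ?_
    split_ifs <;> simp
  have hd2 : ∑ x ∈ range N, w x = 2 := by omega
  have ha1 : w a = 1 := by omega
  have hb1 : w b = 1 := by omega
  have hm1 : w m = 1 := by rcases hmab with rfl | rfl <;> assumption
  rw [hd2] at e
  rw [ha1, hb1] at hsq hs
  omega

/-- One direction keeps the coloring; the other recolors `v` like a heaviest neighbor. Truncated
subtraction in the target is harmless: once the target has reached zero, every coloring meets it. -/
theorem sol_elim {k N v : ℕ} {U : Finset ℕ} {W : ℕ → ℕ → ℕ} (hW : Valid k N U W) (hv : v ∈ U)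
    (hred : Reducible k N W v) (L : ℕ) :
    Sol k N W L ↔
      Sol k N (elim W v (wdeg N W v ≤ 2)) (L - 2 * (range N).sup (W v)) := by
  obtain ⟨hkv, hvN⟩ := mem_Ico.1 (hW.sub hv)
  have hdiag := hW.diag v hvN hkv
  have hsymm : ∀ a < N, W a v = W v a := fun a ha => hW.symm a ha v hvN
  have hle : ∀ a < N, W v a ≤ (range N).sup (W v) := fun a ha => le_sup (f := W v) (mem_range.2 ha)
  obtain ⟨m, hm, hmx⟩ := exists_mem_eq_sup (range N) ⟨v, mem_range.2 hvN⟩ (W v)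
  rw [mem_range] at hm
  constructor
  · rintro ⟨χ, hχ, hL⟩
    refine ⟨χ, hχ, ?_⟩
    rw [valOn_split hvN hsymm hdiag] at hL
    rw [valOn_elim hdiag]
    by_cases hD : wdeg N W v ≤ 2
    · have := two_mul_class_le (χ := χ) hle hD (χ v)
      simp only [hD, and_true]
      omega
    -- All neighbors are now terminals, so each color class contains at most one of them and nothing
    -- has to be joined.
    · have hT := hred.resolve_left hD
      have hcls : (∑ a ∈ range N, if χ a = χ v then W v a else 0) ≤ (range N).sup (W v) := by
        have h1 : ∀ a ∈ range N, (if χ a = χ v then W v a else 0) =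
            if a = χ v then W v a else 0 := by
          intro a ha
          rw [mem_range] at ha
          by_cases hak : a < k
          · rw [hχ.1 a hak]
          · simp [hT a ha (by omega)]
        rw [sum_congr rfl h1, sum_ite_eq']
        split_ifs with h
        · exact hle _ (mem_range.1 h)
        · exact Nat.zero_le _
      omega
  · rintro ⟨χ, hχ, hL⟩
    set χ' : ℕ → ℕ := fun a => if a = v then χ m else χ a with hχ'
    have hcol : IsColoring k χ' := by
      refine ⟨fun t ht => ?_, fun a => ?_⟩
      · simp only [hχ']
        rw [if_neg (by omega), hχ.1 t ht]
      · simp only [hχ']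
        split_ifs
        exacts [hχ.2 _, hχ.2 _]
    refine ⟨χ', hcol, ?_⟩
    rw [valOn_split hvN hsymm hdiag]
    rw [valOn_elim hdiag] at hL
    have h1 : valOn (range N) (fun a b => if a = v ∨ b = v then 0 else W a b) χ' =
        valOn (range N) (fun a b => if a = v ∨ b = v then 0 else W a b) χ := by
      unfold valOn
      refine sum_congr rfl fun a _ => sum_congr rfl fun b _ => ?_
      by_cases ha : a = v
      · simp [ha]
      by_cases hb : b = v
      · simp [hb]
      simp [hχ', ha, hb]
    have h2 : (∑ a ∈ range N, if χ' a = χ' v then W v a else 0) =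
        ∑ a ∈ range N, if χ a = χ m then W v a else 0 := by
      refine sum_congr rfl fun a _ => ?_
      by_cases ha : a = v
      · simp [ha, hdiag]
      · simp [hχ', ha]
    rw [h1, h2]
    by_cases hD : wdeg N W v ≤ 2
    · have := le_two_mul_class (χ := χ) hm hD (fun a ha => hmx ▸ hle a ha)
      simp only [hD, and_true] at hL
      omega
    · have hge : W v m ≤ ∑ a ∈ range N, if χ a = χ m then W v a else 0 := by
        simpa using single_le_sum (f := fun a => if χ a = χ m then W v a else 0)
          (fun a _ => Nat.zero_le _) (mem_range.2 hm)
      simp only [hD, and_false, if_false, ite_self, sum_const_zero] at hL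
      omega

theorem Valid.elim {k N v : ℕ} {U : Finset ℕ} {W : ℕ → ℕ → ℕ} (hW : Valid k N U W) (hv : v ∈ U) :
    Valid k N (U.erase v) (elim W v (wdeg N W v ≤ 2)) := by
  obtain ⟨hkv, hvN⟩ := mem_Ico.1 (hW.sub hv)
  refine ⟨fun a ha b hb => ?_, fun a ha hka haU b hb => ?_, fun a ha hka => ?_, ?_⟩
  · simp only [Weighted.elim, hW.symm a ha b hb, mul_comm (W v a), or_comm (a := a = v),
      ne_comm (a := a)]
  · simp only [Weighted.elim]
    by_cases hav : a = v
    · simp [hav]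
    have haU' : a ∉ U := fun h => haU (mem_erase.2 ⟨hav, h⟩)
    rw [hW.zero a ha hka haU' b hb, hW.symm v hvN a ha, hW.zero a ha hka haU' v hvN]
    simp
  · simp [Weighted.elim, hW.diag a ha hka]
  · exact (erase_subset _ _).trans hW.sub

/-- Eliminating `v` removes twice its degree `d` and adds at most `d ^ 2`, and only when `d ≤ 2`.
Hence weights stay polynomially bounded however many vertices are eliminated. -/
theorem sum_elim_le {k N v : ℕ} {U : Finset ℕ} {W : ℕ → ℕ → ℕ} (hW : Valid k N U W) (hv : v ∈ U) :
    ∑ a ∈ range N, ∑ b ∈ range N, elim W v (wdeg N W v ≤ 2) a b ≤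
      ∑ a ∈ range N, ∑ b ∈ range N, W a b := by
  obtain ⟨hkv, hvN⟩ := mem_Ico.1 (hW.sub hv)
  have hdiag := hW.diag v hvN hkv
  have h1 := valOn_split hvN (fun a ha => hW.symm a ha v hvN) hdiag fun _ => 0
  have h2 := valOn_elim (N := N) hdiag (wdeg N W v ≤ 2) fun _ => 0
  simp only [valOn, if_true] at h1 h2
  rw [h1, h2]
  refine Nat.add_le_add_left ?_ _
  by_cases hD : wdeg N W v ≤ 2
  · have e := sum_mul_self_eq (range N) (W v)
    change (wdeg N W v) ^ 2 = _ at e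
    change _ ≤ 2 * wdeg N W v
    simp only [hD, and_true]
    have : wdeg N W v ^ 2 ≤ 2 * wdeg N W v := by rw [sq]; exact Nat.mul_le_mul_right _ hD
    omega
  · simp [hD]

/-! ### Instances without reducible vertices -/

theorem valOn_mono {s t : Finset ℕ} (h : s ⊆ t) (W : ℕ → ℕ → ℕ) (χ : ℕ → ℕ) :
    valOn s W χ ≤ valOn t W χ :=
  (sum_le_sum fun _ _ => sum_le_sum_of_subset h).trans (sum_le_sum_of_subset h)

theorem valOn_insert_ge {s : Finset ℕ} {v b : ℕ} {W : ℕ → ℕ → ℕ} {χ : ℕ → ℕ} (hv : v ∉ s)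
    (hb : b ∈ s) (hχ : χ v = χ b) : valOn s W χ + (W v b + W b v) ≤ valOn (insert v s) W χ := by
  unfold valOn
  rw [sum_insert hv]
  have h1 : W v b ≤ ∑ c ∈ insert v s, if χ v = χ c then W v c else 0 := by
    have := single_le_sum (f := fun c => if χ v = χ c then W v c else 0)
      (fun a _ => Nat.zero_le _) (mem_insert_of_mem hb : b ∈ insert v s)
    simpa [hχ] using this
  have h2 : (∑ a ∈ s, ∑ c ∈ s, if χ a = χ c then W a c else 0) + W b v ≤
      ∑ a ∈ s, ∑ c ∈ insert v s, if χ a = χ c then W a c else 0 := by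
    simp only [sum_insert hv, sum_add_distrib]
    have := single_le_sum (f := fun c => if χ c = χ v then W c v else 0)
      (fun a _ => Nat.zero_le _) hb
    simp only [hχ, if_true] at this ⊢
    omega
  omega

/-- Greedy growth: `R` consists of the open vertices already colored, and the terminals together
with `R` carry monochromatic weight at least `2 * R.card`. The induction is on the number of
vertices still missing. -/
theorem exists_coloring_two_mul_card {k N : ℕ} {U : Finset ℕ} {W : ℕ → ℕ → ℕ} (hk : 1 ≤ k)
    (hkN : k ≤ N) (hW : Valid k N U W) (hdeg : ∀ v ∈ U, 2 ≤ wdeg N W v) (n : ℕ) (R : Finset ℕ)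
    (hR : R ⊆ U) (hn : (U \ R).card = n) (χ : ℕ → ℕ) (hχ : IsColoring k χ)
    (hval : 2 * R.card ≤ valOn (range k ∪ R) W χ) :
    ∃ χ, IsColoring k χ ∧ 2 * U.card ≤ valOn (range N) W χ := by
  have hTR : range k ∪ R ⊆ range N := union_subset (range_subset_range.2 hkN)
    (hR.trans fun x hx => mem_range.2 (mem_Ico.1 (hW.sub hx)).2)
  induction n generalizing R χ with
  | zero =>
    have : R = U := hR.antisymm (by rwa [card_eq_zero, sdiff_eq_empty_iff_subset] at hn)
    subst this
    exact ⟨χ, hχ, hval.trans (valOn_mono hTR W χ)⟩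
  | succ n ih =>
    by_cases hex : ∃ v ∈ U \ R, ∃ b ∈ range k ∪ R, W v b ≠ 0
    -- Coloring `v` like its neighbor `b` makes the edge happy in both orders, which gains at least
    -- 2.
    · obtain ⟨v, hv, b, hb, hvb⟩ := hex
      obtain ⟨hvU, hvR⟩ := mem_sdiff.1 hv
      obtain ⟨hkv, hvN⟩ := mem_Ico.1 (hW.sub hvU)
      have hvs : v ∉ range k ∪ R := by simp [hvR, hkv]
      set χ' : ℕ → ℕ := fun a => if a = v then χ b else χ a with hχ'
      have hsub : insert v R ⊆ U := insert_subset hvU hR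
      have hval' : valOn (range k ∪ R) W χ' = valOn (range k ∪ R) W χ := by
        refine sum_congr rfl fun a ha => sum_congr rfl fun c hc => ?_
        have h1 : a ≠ v := fun h => hvs (h ▸ ha)
        have h2 : c ≠ v := fun h => hvs (h ▸ hc)
        simp [hχ', h1, h2]
      have hins := valOn_insert_ge (W := W) (χ := χ') hvs hb (by simp [hχ'])
      have hsy := hW.symm v hvN b (mem_range.1 (hTR hb))
      refine ih (insert v R) hsub ?_ χ' ⟨fun t ht => ?_, fun a => ?_⟩ ?_ ?_
      · rw [sdiff_insert, card_erase_of_mem hv, hn]; rfl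
      · simp only [hχ']
        rw [if_neg (by omega), hχ.1 t ht]
      · simp only [hχ']
        split_ifs
        exacts [hχ.2 _, hχ.2 _]
      · rw [union_insert, card_insert_of_notMem hvR]
        omega
      · rw [union_insert]
        exact insert_subset (mem_range.2 hvN) hTR
    -- No edge joins the missing vertices to the colored ones, so giving them all color 0 makes
    -- every edge at them happy; each has degree at least two, which counts 2 per vertex in ordered
    -- pairs.
    · push Not at hex
      set χ' : ℕ → ℕ := fun a => if a ∈ U \ R then 0 else χ a with hχ'
      have hnotin : ∀ a ∈ range k ∪ R, a ∉ U \ R := by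
        intro a ha haU
        obtain ⟨h1, h2⟩ := mem_sdiff.1 haU
        have := (mem_Ico.1 (hW.sub h1)).1
        rcases mem_union.1 ha with h | h
        · have := mem_range.1 h; omega
        · exact h2 h
      refine ⟨χ', ⟨fun t ht => ?_, fun a => ?_⟩, ?_⟩
      · simp only [hχ']
        rw [if_neg (hnotin t (by simp [ht])), hχ.1 t ht]
      · simp only [hχ']
        split_ifs
        exacts [hk, hχ.2 _]
      · have hdisj : Disjoint (range k ∪ R) (U \ R) := by
          rw [disjoint_left]; exact hnotin
        have hURN : U \ R ⊆ range N :=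
          fun x hx => mem_range.2 (mem_Ico.1 (hW.sub (mem_sdiff.1 hx).1)).2
        have h1 : valOn (range k ∪ R) W χ' = valOn (range k ∪ R) W χ := by
          refine sum_congr rfl fun a ha => sum_congr rfl fun c hc => ?_
          simp only [hχ', if_neg (hnotin a ha), if_neg (hnotin c hc)]
        have h2 : ∀ v ∈ U \ R, 2 ≤ ∑ b ∈ range N, if χ' v = χ' b then W v b else 0 := by
          intro v hv
          refine (hdeg v (mem_sdiff.1 hv).1).trans (sum_le_sum fun b hb => ?_)
          by_cases hbU : b ∈ U \ R
          · simp only [hχ', if_pos hv, if_pos hbU, if_true, le_refl]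
          · suffices W v b = 0 by simp [this]
            by_cases hbs : b ∈ range k ∪ R
            · exact hex v hv b hbs
            · simp only [mem_union, mem_range, not_or, not_lt] at hbs
              have hbU' : b ∉ U := fun h => hbU (mem_sdiff.2 ⟨h, hbs.2⟩)
              rw [hW.symm v (mem_range.1 (hURN hv)) b (mem_range.1 hb)]
              exact hW.zero b (mem_range.1 hb) hbs.1 hbU' v (mem_range.1 (hURN hv))
        have h3 : valOn (range k ∪ R) W χ' + 2 * (U \ R).card ≤ valOn (range N) W χ' := by
          unfold valOn
          refine le_trans (Nat.add_le_add (sum_le_sum fun a _ => sum_le_sum_of_subset hTR) ?_)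
            ((sum_union hdisj).symm.le.trans (sum_le_sum_of_subset (union_subset hTR hURN)))
          have := card_nsmul_le_sum (U \ R) _ 2 h2
          simpa [mul_comm] using this
        have h4 := card_sdiff_add_card_eq_card hR
        omega

/-- Irreducible instances have solutions of value at least the number of open vertices. -/
theorem sol_of_le_two_mul_card {k N L : ℕ} {U : Finset ℕ} {W : ℕ → ℕ → ℕ} (hk : 1 ≤ k)
    (hkN : k ≤ N) (hW : Valid k N U W) (hirr : ∀ v ∈ U, ¬ Reducible k N W v)
    (hL : L ≤ 2 * U.card) : Sol k N W L := by
  have hdeg : ∀ v ∈ U, 2 ≤ wdeg N W v := fun v hv => by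
    by_contra h
    exact hirr v hv (Or.inl (by omega))
  obtain ⟨χ, hχ, hv⟩ := exists_coloring_two_mul_card hk hkN hW hdeg _ ∅ (by simp) rfl
    (fun a => if a < k then a else 0)
    ⟨fun t ht => by simp [ht], fun v => by
      by_cases h : v < k
      · simp [h]
      · simp only [h, if_false]; omega⟩ (by simp)
  exact ⟨χ, hχ, hL.trans hv⟩

/-- With three colors, irreducible instances have solutions of larger value. -/
theorem sol_three_of_le {N L : ℕ} {U : Finset ℕ} {W : ℕ → ℕ → ℕ}
    (hkN : 3 ≤ N) (hW : Valid 3 N U W) (hirr : ∀ v ∈ U, ¬ Reducible 3 N W v)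
    (hL : 3 * L ≤ 7 * U.card) : Sol 3 N W L := by
  have hUN : U ⊆ range N := fun x hx => mem_range.2 (mem_Ico.1 (hW.sub hx)).2
  have hTN : range 3 ⊆ range N := range_subset_range.2 hkN
  have hdisj : Disjoint U (range 3) := by
    rw [disjoint_left]
    intro a ha h
    have := (mem_Ico.1 (hW.sub ha)).1
    have := mem_range.1 h
    omega
  set χ : ℕ → ℕ → ℕ := fun i a => if a < 3 then a else i with hχ
  have hcol : ∀ i < 3, IsColoring 3 (χ i) := by
    refine fun i hi => ⟨fun t ht => by simp [hχ, ht], fun v => ?_⟩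
    simp only [hχ]
    split_ifs <;> assumption
  set DU := ∑ v ∈ U, ∑ b ∈ U, W v b with hDU
  set DT := ∑ v ∈ U, ∑ b ∈ range 3, W v b with hDT
  -- Otherwise `v` would be adjacent to terminals only, hence reducible.
  have hone : ∀ v ∈ U, 1 ≤ ∑ b ∈ U, W v b := by
    intro v hv
    have hvN := mem_range.1 (hUN hv)
    by_contra h
    have h0 : ∑ b ∈ U, W v b = 0 := by omega
    rw [sum_eq_zero_iff] at h0
    refine hirr v hv (Or.inr fun a ha hka => ?_)
    by_cases haU : a ∈ U
    · exact h0 a haU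
    · rw [hW.symm v hvN a ha]
      exact hW.zero a ha hka haU v hvN
  have hdeg : ∀ v ∈ U, 3 ≤ ∑ b ∈ U, W v b + ∑ b ∈ range 3, W v b := by
    intro v hv
    have hvN := mem_range.1 (hUN hv)
    have h1 : 3 ≤ wdeg N W v := by
      by_contra h
      exact hirr v hv (Or.inl (by omega))
    rw [← sum_union hdisj]
    refine h1.trans (le_of_eq ?_)
    unfold wdeg
    symm
    refine sum_subset (union_subset hUN hTN) fun a ha hna => ?_
    simp only [mem_union, mem_range, not_or, not_lt] at hna ha
    rw [hW.symm v hvN a ha]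
    exact hW.zero a ha hna.2 hna.1 v hvN
  have hU1 : U.card ≤ DU := by simpa using card_nsmul_le_sum U _ 1 hone
  have hU3 : U.card * 3 ≤ DU + DT := by
    rw [hDU, hDT, ← sum_add_distrib]
    simpa using card_nsmul_le_sum U _ 3 hdeg
  have hU : ∀ v ∈ U, ¬ v < 3 := fun v hv => by
    have := (mem_Ico.1 (hW.sub hv)).1; omega
  have hvali : ∀ i, DU + (∑ v ∈ U, ∑ b ∈ range 3, if i = b then W v b else 0) +
      (∑ b ∈ range 3, ∑ v ∈ U, if i = b then W v b else 0) ≤ valOn (range N) W (χ i) := by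
    intro i
    refine le_trans ?_ (valOn_mono (union_subset hUN hTN) W (χ i))
    unfold valOn
    rw [sum_union hdisj]
    simp only [sum_union hdisj, sum_add_distrib]
    have e1 : (∑ v ∈ U, ∑ b ∈ U, if χ i v = χ i b then W v b else 0) = DU :=
      sum_congr rfl fun v hv => sum_congr rfl fun b hb => by simp [hχ, hU v hv, hU b hb]
    have e2 : (∑ v ∈ U, ∑ b ∈ range 3, if χ i v = χ i b then W v b else 0) =
        ∑ v ∈ U, ∑ b ∈ range 3, if i = b then W v b else 0 :=
      sum_congr rfl fun v hv => sum_congr rfl fun b hb => by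
        simp [hχ, hU v hv, mem_range.1 hb]
    have e3 : (∑ b ∈ range 3, ∑ v ∈ U, if χ i b = χ i v then W b v else 0) =
        ∑ b ∈ range 3, ∑ v ∈ U, if i = b then W v b else 0 :=
      sum_congr rfl fun b hb => sum_congr rfl fun v hv => by
        rw [hW.symm v (mem_range.1 (hUN hv)) b (mem_range.1 (hTN hb))]
        simp [hχ, hU v hv, mem_range.1 hb, eq_comm]
    rw [e1, e2, e3]
    omega
  -- Edges inside `U` are happy in all three constant colorings; an edge to a terminal is happy in
  -- exactly one of them, in both orders.
  have hsum : 3 * DU + 2 * DT ≤ ∑ i ∈ range 3, valOn (range N) W (χ i) := by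
    refine le_trans (le_of_eq ?_) (sum_le_sum fun i _ => hvali i)
    have e4 : (∑ i ∈ range 3, ∑ v ∈ U, ∑ b ∈ range 3, if i = b then W v b else 0) = DT := by
      rw [sum_comm]
      refine sum_congr rfl fun v _ => ?_
      rw [sum_comm]
      exact sum_congr rfl fun b hb => by rw [sum_ite_eq', if_pos hb]
    have e5 : (∑ i ∈ range 3, ∑ b ∈ range 3, ∑ v ∈ U, if i = b then W v b else 0) = DT := by
      rw [← e4]
      exact sum_congr rfl fun i _ => sum_comm
    rw [sum_add_distrib, sum_add_distrib, e4, e5]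
    simp
    ring
  -- Pigeonhole: `3 * DU + 2 * DT = DU + 2 * (DU + DT)`, which is at least `(1 + 2 * 3) * U.card`.
  obtain ⟨i, hi, hi'⟩ : ∃ i ∈ range 3, L ≤ valOn (range N) W (χ i) := by
    by_contra h
    push Not at h
    have := sum_lt_sum_of_nonempty (by simp) h
    simp at this
    omega
  exact ⟨χ i, hcol i (mem_range.1 hi), hi'⟩

end Weighted

/-! ## Counting covers by inclusion and exclusion -/

namespace Weighted

open Finset

/-- The set of the binary digits below `u` that are set in `X`. -/
def bits (u X : ℕ) : Finset ℕ := (range u).filter fun p => X / 2 ^ p % 2 = 1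

theorem mem_bits {u X p : ℕ} : p ∈ bits u X ↔ p < u ∧ X / 2 ^ p % 2 = 1 := by simp [bits]

theorem bits_subset (u X : ℕ) : bits u X ⊆ range u := filter_subset _ _

theorem bits_injOn (u : ℕ) : Set.InjOn (bits u) (range (2 ^ u) : Finset ℕ) := by
  intro X hX Y hY h
  rw [coe_range, Set.mem_Iio] at hX hY
  refine Nat.eq_of_testBit_eq fun p => ?_
  by_cases hp : p < u
  · rw [Nat.testBit_eq_decide_div_mod_eq, Nat.testBit_eq_decide_div_mod_eq]
    have := congrArg (p ∈ ·) h
    simp only [mem_bits, hp, true_and, eq_iff_iff] at this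
    simp [this]
  · have h2 : 2 ^ u ≤ 2 ^ p := Nat.pow_le_pow_right (by norm_num) (by omega)
    rw [Nat.testBit_lt_two_pow (hX.trans_le h2), Nat.testBit_lt_two_pow (hY.trans_le h2)]

theorem image_bits (u : ℕ) : (range (2 ^ u)).image (bits u) = (range u).powerset := by
  refine eq_of_subset_of_card_le (fun s hs => ?_) ?_
  · obtain ⟨X, -, rfl⟩ := mem_image.1 hs
    exact mem_powerset.2 (bits_subset u X)
  · rw [card_image_of_injOn (bits_injOn u)]
    simp

theorem sum_bits {M : Type*} [AddCommMonoid M] (u : ℕ) (f : Finset ℕ → M) :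
    ∑ X ∈ range (2 ^ u), f (bits u X) = ∑ s ∈ (range u).powerset, f s := by
  rw [← image_bits, sum_image (bits_injOn u)]

/-- Subtracting a power of two that occurs in the binary expansion produces no borrow; this is how
the program removes one element from a coded set. -/
theorem bits_sub_two_pow {u X j : ℕ} (hj : X / 2 ^ j % 2 = 1) :
    bits u (X - 2 ^ j) = (bits u X).erase j := by
  have hpos : 0 < 2 ^ j := by positivity
  set h := X / 2 ^ j / 2 with hh
  have hX : 2 ^ j * (2 * h + 1) + X % 2 ^ j = X := by
    have : 2 * h + 1 = X / 2 ^ j := by omega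
    rw [this]; exact Nat.div_add_mod X _
  have hY : X - 2 ^ j = 2 ^ j * (2 * h) + X % 2 ^ j := by
    rw [Nat.mul_add, mul_one] at hX; omega
  have hl : X % 2 ^ j < 2 ^ j := Nat.mod_lt _ hpos
  ext p
  have e : ∀ Z, (Z / 2 ^ p % 2 = 1) ↔ Z.testBit p = true := fun Z => by
    rw [Nat.testBit_eq_decide_div_mod_eq]; simp
  rw [mem_erase, mem_bits, mem_bits, e, e, hY]
  nth_rewrite 2 [← hX]
  rw [Nat.testBit_two_pow_mul_add _ hl, Nat.testBit_two_pow_mul_add _ hl]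
  rcases lt_trichotomy p j with hp | rfl | hp
  · simp [hp, hp.ne]
  · simp [Nat.testBit_zero]
  · obtain ⟨m, rfl⟩ : ∃ m, p = j + 1 + m := ⟨p - (j + 1), by omega⟩
    have h1 : j + 1 + m - j = m + 1 := by omega
    have h2 : ¬ j + 1 + m < j := by omega
    have h3 : (2 * h + 1) / 2 = h := by omega
    simp only [h1, h2, if_false, Nat.testBit_succ, h3]
    simp [show j + 1 + m ≠ j by omega]

/-- The sums over subsets, after treating the elements below `j`. -/
def zeta (a : Finset ℕ → ℕ) : ℕ → Finset ℕ → ℕ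
  | 0, s => a s
  | j + 1, s => zeta a j s + if j ∈ s then zeta a j (s.erase j) else 0

/-- After `j` stages, elements below `j` may have been dropped in all possible ways, while elements
from `j` on are still fixed. -/
theorem zeta_eq (a : Finset ℕ → ℕ) (j : ℕ) (s : Finset ℕ) :
    zeta a j s = ∑ t ∈ (s.filter (· < j)).powerset, a (t ∪ s.filter (j ≤ ·)) := by
  induction j generalizing s with
  | zero => simp [zeta]
  | succ j ih =>
    rw [zeta, ih]
    by_cases hj : j ∈ s
    · rw [if_pos hj, ih]
      have h1 : s.filter (· < j + 1) = insert j (s.filter (· < j)) := by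
        ext x; simp only [mem_filter, mem_insert]
        constructor
        · rintro ⟨h1, h2⟩
          by_cases hx : x = j
          · exact Or.inl hx
          · exact Or.inr ⟨h1, by omega⟩
        · rintro (rfl | ⟨h1, h2⟩)
          · exact ⟨hj, by omega⟩
          · exact ⟨h1, by omega⟩
      have h2 : (s.erase j).filter (· < j) = s.filter (· < j) := by
        ext x; simp only [mem_filter, mem_erase]
        constructor
        · rintro ⟨⟨-, h1⟩, h2⟩; exact ⟨h1, h2⟩
        · rintro ⟨h1, h2⟩; exact ⟨⟨by omega, h1⟩, h2⟩
      have h3 : (s.erase j).filter (j ≤ ·) = s.filter (j + 1 ≤ ·) := by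
        ext x; simp only [mem_filter, mem_erase]
        constructor
        · rintro ⟨⟨h0, h1⟩, h2⟩; exact ⟨h1, by omega⟩
        · rintro ⟨h1, h2⟩; exact ⟨⟨by omega, h1⟩, by omega⟩
      have h4 : s.filter (j ≤ ·) = insert j (s.filter (j + 1 ≤ ·)) := by
        ext x; simp only [mem_filter, mem_insert]
        constructor
        · rintro ⟨h1, h2⟩
          by_cases hx : x = j
          · exact Or.inl hx
          · exact Or.inr ⟨h1, by omega⟩
        · rintro (rfl | ⟨h1, h2⟩)
          · exact ⟨hj, le_rfl⟩
          · exact ⟨h1, by omega⟩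
      rw [h1, sum_powerset_insert (by simp), h2, h3, h4, add_comm]
      congr 1
      exact sum_congr rfl fun t _ => by rw [union_insert, insert_union]
    · have h1 : s.filter (· < j + 1) = s.filter (· < j) := by
        refine filter_congr fun x hx => ?_
        have : x ≠ j := fun h => hj (h ▸ hx)
        omega
      have h2 : s.filter (j ≤ ·) = s.filter (j + 1 ≤ ·) := by
        refine filter_congr fun x hx => ?_
        have : x ≠ j := fun h => hj (h ▸ hx)
        omega
      rw [if_neg hj, h1, h2, add_zero]

theorem zeta_full (a : Finset ℕ → ℕ) {u : ℕ} {s : Finset ℕ} (hs : s ⊆ range u) :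
    zeta a u s = ∑ t ∈ s.powerset, a t := by
  have h1 : s.filter (· < u) = s := filter_true_of_mem fun x hx => mem_range.1 (hs hx)
  have h2 : s.filter (u ≤ ·) = ∅ := filter_false_of_mem fun x hx => by
    have := mem_range.1 (hs hx); omega
  simp [zeta_eq, h1, h2]

/-- The families of `k` subsets covering `F`. -/
def covers (k : ℕ) (F : Finset ℕ) : Finset (Fin k → Finset ℕ) :=
  (Fintype.piFinset fun _ => F.powerset).filter fun x => univ.biUnion x = F

theorem mem_covers {k : ℕ} {F : Finset ℕ} {x : Fin k → Finset ℕ} :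
    x ∈ covers k F ↔ univ.biUnion x = F := by
  simp only [covers, mem_filter, Fintype.mem_piFinset, mem_powerset, and_iff_right_iff_imp]
  rintro rfl i
  exact subset_biUnion_of_mem x (mem_univ i)

theorem card_covers_le (k u : ℕ) : (covers k (range u)).card ≤ 2 ^ (u * k) := by
  refine (card_filter_le _ _).trans (le_of_eq ?_)
  simp [Fintype.card_piFinset, pow_mul]

/-- The sets between `Z` and `F` correspond to the subsets of `F \ Z`, and their signs cancel unless
that difference is empty. -/
theorem sum_superset_neg_one_pow {Z F : Finset ℕ} (h : Z ⊆ F) :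
    (∑ s ∈ F.powerset, if Z ⊆ s then (-1 : ℤ) ^ (F.card + s.card) else 0) =
      if Z = F then 1 else 0 := by
  have hI : F.powerset.filter (Z ⊆ ·) = (F \ Z).powerset.image (Z ∪ ·) := by
    rw [← Icc_eq_image_powerset h]
    ext s; simp [and_comm]
  rw [← sum_filter, hI, sum_image]
  · have h1 : ∀ t ∈ (F \ Z).powerset, (-1 : ℤ) ^ (F.card + (Z ∪ t).card) =
        (-1) ^ (F.card + Z.card) * (-1) ^ t.card := by
      intro t ht
      have hd : Disjoint Z t := disjoint_of_subset_right (mem_powerset.1 ht) disjoint_sdiff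
      rw [card_union_of_disjoint hd, ← pow_add, add_assoc]
    rw [sum_congr rfl h1, ← mul_sum, sum_powerset_neg_one_pow_card]
    by_cases hZ : Z = F
    · subst hZ; simp [← two_mul]
    · have : F \ Z ≠ ∅ := fun he => hZ (h.antisymm (sdiff_eq_empty_iff_subset.1 he))
      simp [hZ, this]
  · intro s hs t ht hst
    simp only [coe_powerset, Set.mem_preimage, Set.mem_powerset_iff, coe_subset] at hs ht
    have h1 : ∀ r ⊆ F \ Z, (Z ∪ r) \ Z = r := fun r hr => by
      rw [union_sdiff_cancel_left (disjoint_of_subset_right hr disjoint_sdiff)]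
    rw [← h1 s hs, ← h1 t ht]
    simp only at hst
    rw [hst]

/-- Expanding the product chooses a family of subsets of `s`, that is, a family whose union lies in
`s`. After exchanging the sums, the alternating sum retains exactly the families with union `F`. -/
theorem inclusion_exclusion {k : ℕ} (F : Finset ℕ) (a : Fin k → Finset ℕ → ℕ) :
    ∑ s ∈ F.powerset, (-1 : ℤ) ^ (F.card + s.card) * ∏ i, ∑ t ∈ s.powerset, (a i t : ℤ) =
      ∑ x ∈ covers k F, ∏ i, (a i (x i) : ℤ) := by
  have h1 : ∀ s ∈ F.powerset, (-1 : ℤ) ^ (F.card + s.card) * ∏ i, ∑ t ∈ s.powerset, (a i t : ℤ) =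
      ∑ x ∈ Fintype.piFinset fun _ : Fin k => F.powerset, (∏ i, (a i (x i) : ℤ)) *
        if univ.biUnion x ⊆ s then (-1 : ℤ) ^ (F.card + s.card) else 0 := by
    intro s hs
    rw [prod_univ_sum, mul_sum]
    simp only [mul_ite, mul_zero]
    rw [← sum_filter]
    refine sum_congr ?_ fun x _ => mul_comm _ _
    ext x
    simp only [Fintype.mem_piFinset, mem_powerset, mem_filter, biUnion_subset, mem_univ,
      true_implies]
    exact ⟨fun h => ⟨fun i => (h i).trans (mem_powerset.1 hs), h⟩, fun h => h.2⟩
  rw [sum_congr rfl h1, sum_comm, covers, sum_filter]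
  refine sum_congr rfl fun x hx => ?_
  have hxF : univ.biUnion x ⊆ F := biUnion_subset.2 fun i _ =>
    mem_powerset.1 (Fintype.mem_piFinset.1 hx i)
  rw [← mul_sum, sum_superset_neg_one_pow hxF]
  simp

/-- Inclusion and exclusion, with the positive and the negative terms collected separately. -/
theorem even_sum_eq (k u : ℕ) (a : ℕ → Finset ℕ → ℕ) :
    (∑ X ∈ range (2 ^ u), if (u + (bits u X).card) % 2 = 0 then
        ∏ i ∈ range k, zeta (a i) u (bits u X) else 0) =
      (∑ X ∈ range (2 ^ u), if (u + (bits u X).card) % 2 = 0 then 0 else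
        ∏ i ∈ range k, zeta (a i) u (bits u X)) +
      ∑ x ∈ covers k (range u), ∏ i : Fin k, a i (x i) := by
  have h := inclusion_exclusion (range u) fun i : Fin k => a i
  rw [card_range, ← sum_bits u fun s => (-1 : ℤ) ^ (u + s.card) *
    ∏ i : Fin k, ∑ t ∈ s.powerset, (a i t : ℤ)] at h
  have h2 : ∀ X ∈ range (2 ^ u), (-1 : ℤ) ^ (u + (bits u X).card) *
      ∏ i : Fin k, ∑ t ∈ (bits u X).powerset, (a i t : ℤ) =
      (((if (u + (bits u X).card) % 2 = 0 then
        ∏ i ∈ range k, zeta (a i) u (bits u X) else 0 : ℕ)) : ℤ) -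
      ((if (u + (bits u X).card) % 2 = 0 then 0 else
        ∏ i ∈ range k, zeta (a i) u (bits u X) : ℕ) : ℤ) := by
    intro X _
    have h3 : (∏ i : Fin k, ∑ t ∈ (bits u X).powerset, (a i t : ℤ)) =
        ((∏ i ∈ range k, zeta (a i) u (bits u X) : ℕ) : ℤ) := by
      rw [prod_range]
      push_cast
      refine prod_congr rfl fun i _ => ?_
      rw [zeta_full _ (bits_subset u X)]
      push_cast; rfl
    rw [h3]
    split_ifs with hpar
    · rw [(Nat.even_iff.2 hpar).neg_one_pow]; simp
    · rw [(Nat.odd_iff.2 (by omega)).neg_one_pow]; simp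
  rw [sum_congr rfl h2, sum_sub_distrib, sub_eq_iff_eq_add'] at h
  exact_mod_cast h

/-- A sum of fewer than `R` powers of `R` reveals the smallest exponents. -/
theorem sum_pow_mod_ne_zero_iff {ι : Type*} (S : Finset ι) (E : ι → ℕ) {R : ℕ} (hR : S.card < R)
    (m : ℕ) : (∑ x ∈ S, R ^ E x) % R ^ (m + 1) ≠ 0 ↔ ∃ x ∈ S, E x ≤ m := by
  classical
  have hR0 : 0 < R := by omega
  have hdvd : ∀ T ⊆ S, (∀ x ∈ T, ¬ E x ≤ m) → R ^ (m + 1) ∣ ∑ x ∈ T, R ^ E x := by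
    intro T _ hT
    exact dvd_sum fun x hx => pow_dvd_pow _ (by have := hT x hx; omega)
  constructor
  · intro h
    by_contra hno
    push Not at hno
    exact h (Nat.mod_eq_zero_of_dvd (hdvd S Subset.rfl fun x hx => by have := hno x hx; omega))
  · rintro ⟨x, hx, hxm⟩
    -- Terms with exponent above `m` vanish modulo `R ^ (m + 1)`; the others number fewer than `R`,
    -- so their positive sum stays below the modulus.
    rw [← sum_filter_add_sum_filter_not S (fun x => E x ≤ m)]
    obtain ⟨B, hB⟩ := hdvd (S.filter fun x => ¬ E x ≤ m) (filter_subset _ _)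
      fun x hx => (mem_filter.1 hx).2
    rw [hB, Nat.add_mul_mod_self_left]
    have hle : (∑ x ∈ S.filter (fun x => E x ≤ m), R ^ E x) ≤ S.card * R ^ m := by
      refine (sum_le_card_nsmul _ _ (R ^ m) fun y hy => ?_).trans ?_
      · exact Nat.pow_le_pow_right hR0 (mem_filter.1 hy).2
      · exact Nat.mul_le_mul_right _ (card_filter_le _ _)
    have hlt : S.card * R ^ m < R ^ (m + 1) := by
      rw [pow_succ, mul_comm]
      exact Nat.mul_lt_mul_of_pos_left hR (Nat.pow_pos hR0)
    rw [Nat.mod_eq_of_lt (hle.trans_lt hlt)]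
    have := single_le_sum (f := fun x => R ^ E x) (fun y _ => Nat.zero_le _)
      (mem_filter.2 ⟨hx, hxm⟩ : x ∈ S.filter (fun x => E x ≤ m))
    have h2 : 0 < R ^ E x := Nat.pow_pos hR0
    omega

/-! ### Color classes -/

/-- The monochromatic weight of the class consisting of terminal `i` and the vertices `V p`,
`p ∈ t`. -/
def classWeight (W : ℕ → ℕ → ℕ) (V : ℕ → ℕ) (i : ℕ) (t : Finset ℕ) : ℕ :=
  W i i + ∑ p ∈ t, (2 * W (V p) i + ∑ q ∈ t, W (V p) (V q))

theorem classWeight_mono {W : ℕ → ℕ → ℕ} {V : ℕ → ℕ} {i : ℕ} {s t : Finset ℕ} (h : s ⊆ t) :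
    classWeight W V i s ≤ classWeight W V i t := by
  refine Nat.add_le_add_left ((sum_le_sum fun p _ => ?_).trans (sum_le_sum_of_subset h)) _
  exact Nat.add_le_add_left (sum_le_sum_of_subset h) _

/-- The elements of `range u` whose vertex has color `i`. -/
def colorClass (u : ℕ) (V χ : ℕ → ℕ) (i : ℕ) : Finset ℕ := (range u).filter fun p => χ (V p) = i

/-- Distinct terminals never share a color, so every class has one terminal. The diagonal `W i i`
records precolored edges that are already happy. -/
theorem valOn_eq_sum_classWeight {k N u : ℕ} {W : ℕ → ℕ → ℕ} {U : Finset ℕ} {V χ : ℕ → ℕ}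
    (hkN : k ≤ N) (hW : Valid k N U W) (hV : Set.InjOn V (range u : Finset ℕ))
    (hU : (range u).image V = U) (hχ : IsColoring k χ) :
    valOn (range N) W χ = ∑ i ∈ range k, classWeight W V i (colorClass u V χ i) := by
  have hUN : U ⊆ range N := fun x hx => mem_range.2 (mem_Ico.1 (hW.sub hx)).2
  have hTN : range k ⊆ range N := range_subset_range.2 hkN
  have hVN : ∀ p ∈ range u, V p < N := fun p hp =>
    mem_range.1 (hUN (hU ▸ mem_image_of_mem V hp))
  have hdisj : Disjoint (range k) U := by
    rw [disjoint_left]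
    intro a h ha
    have := (mem_Ico.1 (hW.sub ha)).1
    have := mem_range.1 h
    omega
  have h1 : valOn (range N) W χ = valOn (range k ∪ U) W χ := by
    have hz : ∀ a ∈ range N, a ∉ range k ∪ U → ∀ b ∈ range N, W a b = 0 := by
      intro a ha hna b hb
      simp only [mem_union, mem_range, not_or, not_lt] at hna
      exact hW.zero a (mem_range.1 ha) hna.1 hna.2 b (mem_range.1 hb)
    unfold valOn
    symm
    refine (sum_congr rfl fun a ha => ?_).trans
      (sum_subset (union_subset hTN hUN) fun a ha hna => ?_)
    · refine sum_subset (union_subset hTN hUN) fun b hb hnb => ?_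
      have haN := union_subset hTN hUN ha
      rw [hW.symm a (mem_range.1 haN) b (mem_range.1 hb), hz b hb hnb a haN]
      simp
    · exact sum_eq_zero fun b hb => by rw [hz a ha hna b hb]; simp
  rw [h1, ← hU] at *
  unfold valOn
  rw [sum_union (hU ▸ hdisj)]
  simp only [sum_union hdisj, sum_add_distrib, sum_image hV]
  have e1 : (∑ a ∈ range k, ∑ b ∈ range k, if χ a = χ b then W a b else 0) =
      ∑ i ∈ range k, W i i := by
    refine sum_congr rfl fun a ha => ?_
    rw [sum_eq_single_of_mem a ha]
    · simp
    · intro b hb hba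
      rw [hχ.1 a (mem_range.1 ha), hχ.1 b (mem_range.1 hb), if_neg (Ne.symm hba)]
  have e2 : (∑ a ∈ range k, ∑ p ∈ range u, if χ a = χ (V p) then W a (V p) else 0) =
      ∑ i ∈ range k, ∑ p ∈ colorClass u V χ i, W (V p) i := by
    refine sum_congr rfl fun a ha => ?_
    rw [colorClass, sum_filter]
    refine sum_congr rfl fun p hp => ?_
    rw [hχ.1 a (mem_range.1 ha), hW.symm _ (mem_range.1 (hTN ha)) _ (hVN p hp)]
    simp only [eq_comm]
  have e3 : (∑ p ∈ range u, ∑ b ∈ range k, if χ (V p) = χ b then W (V p) b else 0) =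
      ∑ i ∈ range k, ∑ p ∈ colorClass u V χ i, W (V p) i := by
    rw [sum_comm]
    refine sum_congr rfl fun b hb => ?_
    rw [colorClass, sum_filter]
    refine sum_congr rfl fun p hp => ?_
    rw [hχ.1 b (mem_range.1 hb)]
  have e4 : (∑ p ∈ range u, ∑ q ∈ range u, if χ (V p) = χ (V q) then W (V p) (V q) else 0) =
      ∑ i ∈ range k, ∑ p ∈ colorClass u V χ i, ∑ q ∈ colorClass u V χ i, W (V p) (V q) := by
    simp only [colorClass, sum_filter]
    rw [sum_comm (s := range k)]
    refine sum_congr rfl fun p _ => ?_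
    rw [sum_ite_eq, if_pos (mem_range.2 (hχ.2 _))]
    exact sum_congr rfl fun q _ => by simp only [eq_comm]
  rw [e1, e2, e3, e4]
  simp only [classWeight, sum_add_distrib, ← mul_sum]
  omega

/-- The class weight is part of the value of the coloring giving all open vertices color `i`, hence
at most the total weight. -/
theorem classWeight_le {k N u : ℕ} {W : ℕ → ℕ → ℕ} {U : Finset ℕ} {V : ℕ → ℕ}
    (hkN : k ≤ N) (hW : Valid k N U W) (hV : Set.InjOn V (range u : Finset ℕ))
    (hU : (range u).image V = U) {i : ℕ} (hi : i < k) {t : Finset ℕ} (ht : t ⊆ range u) :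
    classWeight W V i t ≤ ∑ a ∈ range N, ∑ b ∈ range N, W a b := by
  set χ : ℕ → ℕ := fun a => if a < k then a else i with hχ
  have hcol : IsColoring k χ := by
    refine ⟨fun t ht => by simp [hχ, ht], fun v => ?_⟩
    simp only [hχ]
    split_ifs <;> assumption
  have hcls : colorClass u V χ i = range u := by
    refine filter_true_of_mem fun p hp => ?_
    have := (mem_Ico.1 (hW.sub (hU ▸ mem_image_of_mem V hp))).1
    simp only [hχ]
    rw [if_neg (by omega)]
  calc classWeight W V i t ≤ classWeight W V i (colorClass u V χ i) :=
        classWeight_mono (by rwa [hcls])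
    _ ≤ ∑ i ∈ range k, classWeight W V i (colorClass u V χ i) :=
        single_le_sum (f := fun i => classWeight W V i (colorClass u V χ i))
          (fun _ _ => Nat.zero_le _) (mem_range.2 hi)
    _ = valOn (range N) W χ := (valOn_eq_sum_classWeight hkN hW hV hU hcol).symm
    _ ≤ _ := sum_le_sum fun a _ => sum_le_sum fun b _ => by split_ifs <;> simp

/-- A cover of `u` elements with total cardinality at most `u` is a partition, so disjointness can
be replaced by a count, which an exponent can measure. -/
theorem sol_iff_exists_cover {k N u L : ℕ} {W : ℕ → ℕ → ℕ} {U : Finset ℕ} {V : ℕ → ℕ}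
    (hkN : k ≤ N) (hk : 1 ≤ k) (hW : Valid k N U W) (hV : Set.InjOn V (range u : Finset ℕ))
    (hU : (range u).image V = U) :
    Sol k N W L ↔ ∃ x ∈ covers k (range u), ∑ i, (x i).card ≤ u ∧
      L ≤ ∑ i : Fin k, classWeight W V i (x i) := by
  have hdisj : ∀ χ : ℕ → ℕ, ∀ i ∈ (univ : Finset (Fin k)), ∀ j ∈ (univ : Finset (Fin k)), i ≠ j →
      Disjoint (colorClass u V χ i) (colorClass u V χ j) := by
    intro χ i _ j _ hij
    rw [disjoint_left]
    intro p hp hp'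
    exact hij (Fin.ext ((mem_filter.1 hp).2.symm.trans (mem_filter.1 hp').2))
  have hcov : ∀ χ, IsColoring k χ →
      univ.biUnion (fun i : Fin k => colorClass u V χ i) = range u := by
    intro χ hχ
    ext p
    simp only [mem_biUnion, mem_univ, true_and, colorClass, mem_filter]
    exact ⟨fun ⟨i, h, _⟩ => h, fun h => ⟨⟨χ (V p), hχ.2 _⟩, h, rfl⟩⟩
  have hcard : ∀ χ, IsColoring k χ → ∑ i : Fin k, (colorClass u V χ i).card = u := by
    intro χ hχ
    rw [← card_biUnion (hdisj χ), hcov χ hχ, card_range]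
  constructor
  · rintro ⟨χ, hχ, hL⟩
    refine ⟨fun i => colorClass u V χ i, mem_covers.2 (hcov χ hχ), (hcard χ hχ).le, ?_⟩
    rwa [valOn_eq_sum_classWeight hkN hW hV hU hχ, sum_range] at hL
  · rintro ⟨x, hx, hc, hL⟩
    rw [mem_covers] at hx
    have hex : ∀ p : ℕ, ∃ i : Fin k, p < u → p ∈ x i := by
      intro p
      by_cases hp : p < u
      · have : p ∈ univ.biUnion x := hx ▸ mem_range.2 hp
        obtain ⟨i, -, hi⟩ := mem_biUnion.1 this
        exact ⟨i, fun _ => hi⟩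
      · exact ⟨⟨0, hk⟩, fun h => absurd h hp⟩
    choose g hg using hex
    set χ : ℕ → ℕ := fun a => if a < k then a else g (Function.invFunOn V (range u : Finset ℕ) a)
      with hχdef
    have hχV : ∀ p < u, χ (V p) = g p := by
      intro p hp
      have hp' : p ∈ (range u : Finset ℕ) := mem_range.2 hp
      have := (mem_Ico.1 (hW.sub (hU ▸ mem_image_of_mem V hp'))).1
      simp only [hχdef]
      rw [if_neg (by omega), hV.leftInvOn_invFunOn (mem_coe.2 hp')]
    have hχ : IsColoring k χ := by
      refine ⟨fun t ht => by simp [hχdef, ht], fun v => ?_⟩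
      simp only [hχdef]
      split_ifs with h
      · exact h
      · exact (g _).2
    have hsub : ∀ i : Fin k, colorClass u V χ i ⊆ x i := by
      intro i p hp
      obtain ⟨h1, h2⟩ := mem_filter.1 hp
      rw [mem_range] at h1
      rw [hχV p h1] at h2
      have := hg p h1
      rwa [Fin.ext h2] at this
    refine ⟨χ, hχ, hL.trans ?_⟩
    rw [valOn_eq_sum_classWeight hkN hW hV hU hχ, sum_range]
    -- The classes of the chosen coloring lie inside the sets `x i` and already have total
    -- cardinality `u`, so no inclusion is strict.
    have heq : ∀ i ∈ (univ : Finset (Fin k)), (colorClass u V χ i).card = (x i).card := by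
      refine (sum_eq_sum_iff_of_le fun i _ => card_le_card (hsub i)).1 ?_
      refine le_antisymm (sum_le_sum fun i _ => card_le_card (hsub i)) ?_
      rw [hcard χ hχ]; exact hc
    refine sum_le_sum fun i hi => le_of_eq ?_
    rw [eq_of_subset_of_card_le (hsub i) (heq i hi).ge]

/-- The decision by counting weighted covers. -/
theorem sol_iff_mod {k N u L Q r : ℕ} {W : ℕ → ℕ → ℕ} {U : Finset ℕ} {V : ℕ → ℕ}
    (hkN : k ≤ N) (hk : 1 ≤ k) (hW : Valid k N U W) (hV : Set.InjOn V (range u : Finset ℕ))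
    (hU : (range u).image V = U) (hQ : k * (∑ a ∈ range N, ∑ b ∈ range N, W a b) < Q)
    (hL : L ≤ Q) (hr : u * k < r) :
    Sol k N W L ↔ (∑ x ∈ covers k (range u), ∏ i : Fin k,
      2 ^ (r * (((x i).card + 1) * Q - classWeight W V i (x i)))) %
        2 ^ (r * (Q * (u + k) - L + 1)) ≠ 0 := by
  set S := ∑ a ∈ range N, ∑ b ∈ range N, W a b with hS
  have hterm : ∀ x : Fin k → Finset ℕ,
      (∏ i : Fin k, 2 ^ (r * (((x i).card + 1) * Q - classWeight W V i (x i)))) =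
      (2 ^ r) ^ ∑ i : Fin k, (((x i).card + 1) * Q - classWeight W V i (x i)) := by
    intro x
    rw [← prod_pow_eq_pow_sum]
    exact prod_congr rfl fun i _ => by rw [pow_mul]
  rw [sum_congr rfl fun x _ => hterm x, pow_mul, sum_pow_mod_ne_zero_iff _ _
    ((card_covers_le k u).trans_lt (Nat.pow_lt_pow_right (by norm_num) hr)),
    sol_iff_exists_cover hkN hk hW hV hU]
  refine exists_congr fun x => and_congr_right fun hx => ?_
  have hxs : ∀ i, x i ⊆ range u := fun i => by
    rw [← mem_covers.1 hx]; exact subset_biUnion_of_mem x (mem_univ i)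
  have hcl : ∀ i : Fin k, classWeight W V i (x i) ≤ S := fun i =>
    classWeight_le hkN hW hV hU i.2 (hxs i)
  have hSk : S ≤ k * S := Nat.le_mul_of_pos_left _ hk
  -- The `+ 1` keeps the subtraction from being truncated for an empty `x i`, whose class weight `W
  -- i i` may be positive. It shifts the total exponent by `k * Q`.
  have hsum : ∑ i : Fin k, (((x i).card + 1) * Q - classWeight W V i (x i)) +
      ∑ i : Fin k, classWeight W V i (x i) = (∑ i, (x i).card + k) * Q := by
    rw [← sum_add_distrib, sum_congr rfl fun i _ => Nat.sub_add_cancel ?_, ← sum_mul,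
      sum_add_distrib]
    · simp
    · have := hcl i
      nlinarith
  have hfk : ∑ i : Fin k, classWeight W V i (x i) ≤ k * S := by
    simpa using sum_le_sum fun i (_ : i ∈ (univ : Finset (Fin k))) => hcl i
  have hcu : u ≤ ∑ i, (x i).card := by
    have := card_biUnion_le (s := (univ : Finset (Fin k))) (t := x)
    rwa [mem_covers.1 hx, card_range] at this
  generalize ∑ i : Fin k, (((x i).card + 1) * Q - classWeight W V i (x i)) = e at *
  generalize ∑ i : Fin k, classWeight W V i (x i) = f at *
  generalize ∑ i, (x i).card = c at *
  have hQL : L ≤ Q * (u + k) := hL.trans (Nat.le_mul_of_pos_right _ (by omega))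
  constructor
  · rintro ⟨h1, h2⟩
    have : c = u := le_antisymm h1 hcu
    subst this
    rw [mul_comm] at hsum
    omega
  -- One surplus element raises the exponent by `Q`, which exceeds any total weight of the classes;
  -- so a small exponent forces cardinality `u`.
  · intro h
    have h1 : c ≤ u := by
      by_contra hlt
      have h2 : (u + 1 + k) * Q ≤ (c + k) * Q := Nat.mul_le_mul_right _ (by omega)
      have h3 : (u + 1 + k) * Q = Q * (u + k) + Q := by ring
      omega
    have : c = u := le_antisymm h1 hcu
    subst this
    rw [mul_comm] at hsum
    exact ⟨le_rfl, by omega⟩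

end Weighted

/-! ## From colored graphs to weighted instances -/

namespace Weighted

open Finset

/-- The vertex representing the vertex `a` of the graph: the terminal of its color, or `a + k`. -/
def root (w : ℕ → ℕ) (k a : ℕ) : ℕ := if w (2 + a) ≠ 0 then w (2 + a) - 1 else a + k

/-- The weights of the instance written in `w`. -/
def initW (w : ℕ → ℕ) (k x y : ℕ) : ℕ :=
  ∑ a ∈ range (w 0), ∑ b ∈ range (w 0),
    if root w k a = x ∧ root w k b = y then w (2 + w 0 + w 0 * a + b) else 0

/-- The vertices representing the uncolored vertices. -/
def initU (w : ℕ → ℕ) (k : ℕ) : Finset ℕ :=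
  ((range (w 0)).filter fun a => w (2 + a) = 0).image (· + k)

theorem mem_initU {w : ℕ → ℕ} {k x : ℕ} :
    x ∈ initU w k ↔ ∃ a < w 0, w (2 + a) = 0 ∧ a + k = x := by
  simp [initU, and_assoc]

/-- `w` is an input word of the right format. -/
structure IsWord (w : ℕ → ℕ) (k : ℕ) : Prop where
  color_le : ∀ a < w 0, w (2 + a) ≤ k
  adj_le : ∀ a < w 0, ∀ b < w 0, w (2 + w 0 + w 0 * a + b) ≤ 1
  adj_self : ∀ a < w 0, w (2 + w 0 + w 0 * a + a) = 0
  adj_symm : ∀ a < w 0, ∀ b < w 0, w (2 + w 0 + w 0 * a + b) = w (2 + w 0 + w 0 * b + a)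

theorem root_lt {w : ℕ → ℕ} {k a : ℕ} (hw : IsWord w k) (ha : a < w 0) :
    root w k a < w 0 + k := by
  have := hw.color_le a ha
  unfold root
  split_ifs <;> omega

theorem root_eq_ge {w : ℕ → ℕ} {k a x : ℕ} (hw : IsWord w k) (ha : a < w 0) (hk : 1 ≤ k)
    (hx : k ≤ x) (h : root w k a = x) : w (2 + a) = 0 ∧ a + k = x := by
  have := hw.color_le a ha
  unfold root at h
  split_ifs at h with h1
  · omega
  · exact ⟨not_not.1 h1, h⟩

/-- Only terminals can have positive diagonal weight: an uncolored vertex represents itself alone,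
and the graph has no loops. -/
theorem valid_init {w : ℕ → ℕ} {k : ℕ} (hw : IsWord w k) (hk : 1 ≤ k) :
    Valid k (w 0 + k) (initU w k) (initW w k) := by
  refine ⟨fun x _ y _ => ?_, fun x _ hkx hxU y _ => ?_, fun x _ hkx => ?_, fun x hx => ?_⟩
  · unfold initW
    rw [sum_comm]
    refine sum_congr rfl fun b hb => sum_congr rfl fun a ha => ?_
    rw [hw.adj_symm a (mem_range.1 ha) b (mem_range.1 hb)]
    simp only [and_comm]
  · refine sum_eq_zero fun a ha => sum_eq_zero fun b _ => if_neg fun h => hxU ?_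
    exact mem_initU.2 ⟨a, mem_range.1 ha, root_eq_ge hw (mem_range.1 ha) hk hkx h.1⟩
  · refine sum_eq_zero fun a ha => sum_eq_zero fun b hb => ?_
    split_ifs with h
    · have h1 := (root_eq_ge hw (mem_range.1 ha) hk hkx h.1).2
      have h2 := (root_eq_ge hw (mem_range.1 hb) hk hkx h.2).2
      have : a = b := by omega
      subst this
      exact hw.adj_self a (mem_range.1 ha)
    · rfl
  · obtain ⟨a, ha, -, rfl⟩ := mem_initU.1 hx
    exact mem_Ico.2 ⟨by omega, by omega⟩

/-- Contraction preserves the value: each ordered adjacent pair contributes to exactly one pair of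
representatives. -/
theorem valOn_initW {w : ℕ → ℕ} {k : ℕ} (hw : IsWord w k) (χ : ℕ → ℕ) :
    valOn (range (w 0 + k)) (initW w k) χ = ∑ a ∈ range (w 0), ∑ b ∈ range (w 0),
      if χ (root w k a) = χ (root w k b) then w (2 + w 0 + w 0 * a + b) else 0 := by
  set N := w 0 + k with hN
  have h1 : valOn (range N) (initW w k) χ = ∑ x ∈ range N, ∑ a ∈ range (w 0), ∑ y ∈ range N,
      ∑ b ∈ range (w 0), if χ x = χ y then (if root w k a = x ∧ root w k b = y then
        w (2 + w 0 + w 0 * a + b) else 0) else 0 := by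
    refine sum_congr rfl fun x _ => ?_
    rw [sum_comm]
    refine sum_congr rfl fun y _ => ?_
    split_ifs
    · rfl
    · simp
  rw [h1, sum_comm]
  refine sum_congr rfl fun a ha => ?_
  have h2 : ∀ x ∈ range N, (∑ y ∈ range N, ∑ b ∈ range (w 0), if χ x = χ y then
      (if root w k a = x ∧ root w k b = y then w (2 + w 0 + w 0 * a + b) else 0) else 0) =
      if root w k a = x then (∑ b ∈ range (w 0), if χ x = χ (root w k b) then
        w (2 + w 0 + w 0 * a + b) else 0) else 0 := by
    intro x _
    rw [sum_comm]
    split_ifs with hx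
    · refine sum_congr rfl fun b hb => ?_
      rw [sum_eq_single_of_mem (root w k b) (mem_range.2 (root_lt hw (mem_range.1 hb)))]
      · simp [hx]
      · intro y _ hy
        simp [Ne.symm hy]
    · simp [hx]
  rw [sum_congr rfl h2, sum_ite_eq, if_pos (mem_range.2 (root_lt hw (mem_range.1 ha)))]

theorem sum_initW_le {w : ℕ → ℕ} {k : ℕ} (hw : IsWord w k) :
    ∑ x ∈ range (w 0 + k), ∑ y ∈ range (w 0 + k), initW w k x y ≤ w 0 * w 0 := by
  have h := valOn_initW hw fun _ => 0
  simp only [valOn, if_true] at h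
  rw [h]
  refine (sum_le_sum fun a ha => sum_le_sum fun b hb =>
    hw.adj_le a (mem_range.1 ha) b (mem_range.1 hb)).trans ?_
  simp

end Weighted

/-! ### Happy edges and the input word -/

open Finset in
/-- Counting ordered pairs counts every happy edge twice. -/
theorem two_mul_ncard_happyEdges {n : ℕ} {κ : Type} [DecidableEq κ] (G : SimpleGraph (Fin n))
    [DecidableRel G.Adj] (c : Fin n → κ) :
    2 * (happyEdges G c).ncard =
      ∑ a, ∑ b, if c a = c b then (if G.Adj a b then 1 else 0) else 0 := by
  let H : SimpleGraph (Fin n) :=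
    { Adj := fun a b => G.Adj a b ∧ c a = c b
      symm := ⟨fun a b h => ⟨h.1.symm, h.2.symm⟩⟩
      loopless := ⟨fun a h => G.loopless.irrefl a h.1⟩ }
  have h1 : happyEdges G c = H.edgeSet := by
    ext e
    induction e with
    | _ a b =>
      simp only [happyEdges, Set.mem_ofPred_eq, SimpleGraph.mem_edgeSet, Sym2.mem_iff,
        forall_eq_or_imp, forall_eq]
      change _ ↔ G.Adj a b ∧ c a = c b
      simp [eq_comm]
  classical
  rw [h1, ← H.coe_edgeFinset, Set.ncard_coe_finset, ← H.sum_degrees_eq_twice_card_edges]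
  refine sum_congr rfl fun a _ => ?_
  rw [← H.card_neighborFinset_eq_degree, H.neighborFinset_eq_filter, card_filter]
  refine sum_congr rfl fun b _ => ?_
  change (if G.Adj a b ∧ c a = c b then 1 else 0) = _
  split_ifs <;> simp_all

namespace MHE

open Finset Weighted

variable {k : ℕ} (I : MHE k)

theorem init_zero : RAM.init I.code 0 = I.n := rfl

theorem init_color (v : Fin I.n) :
    RAM.init I.code (2 + v) = (I.c v).elim 0 (fun i => (i : ℕ) + 1) := by
  have hv := v.2
  rw [add_comm]
  simp only [RAM.init, code, List.getD_cons_succ]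
  rw [List.getD_append _ _ _ _ (by simp), List.getD_eq_getElem _ _ (by simp), List.getElem_ofFn]

open Classical in
theorem init_adj (a b : Fin I.n) :
    RAM.init I.code (2 + I.n + I.n * a + b) = if I.G.Adj a b then 1 else 0 := by
  have hlt : I.n * a + b < I.n * I.n := by
    calc I.n * a + b < I.n * a + I.n := by omega
      _ = I.n * (a + 1) := by ring
      _ ≤ I.n * I.n := Nat.mul_le_mul_left _ a.2
  have h1 : 2 + I.n + I.n * (a : ℕ) + b = (I.n + (I.n * a + b)) + 1 + 1 := by ring
  rw [h1]
  simp only [RAM.init, code, List.getD_cons_succ]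
  rw [List.getD_append_right _ _ _ _ (by simp)]
  simp only [List.length_ofFn, Nat.add_sub_cancel_left]
  rw [List.getD_eq_getElem _ _ (by simpa using hlt), List.getElem_ofFn]
  have hd : Fin.divNat (⟨I.n * a + b, hlt⟩ : Fin (I.n * I.n)) = a := by
    apply Fin.ext
    simp only [Fin.coe_divNat]
    rw [Nat.mul_add_div (by omega), Nat.div_eq_of_lt b.2, add_zero]
  have hm : Fin.modNat (⟨I.n * a + b, hlt⟩ : Fin (I.n * I.n)) = b := by
    apply Fin.ext
    simp only [Fin.coe_modNat]
    rw [Nat.mul_add_mod, Nat.mod_eq_of_lt b.2]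
  rw [hd, hm]

theorem init_of_ge {r : ℕ} (hr : I.n * I.n + I.n + 2 ≤ r) : RAM.init I.code r = 0 := by
  rw [RAM.init, List.getD_eq_default]
  simp [code]
  omega

theorem isWord_init : IsWord (RAM.init I.code) k := by
  classical
  refine ⟨fun a ha => ?_, fun a ha b hb => ?_, fun a ha => ?_, fun a ha b hb => ?_⟩
  · rw [I.init_color ⟨a, ha⟩]
    cases h : I.c ⟨a, ha⟩ with
    | none => simp
    | some i => simp
  · rw [init_zero] at *
    rw [I.init_adj ⟨a, ha⟩ ⟨b, hb⟩]
    split_ifs <;> simp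
  · rw [init_zero] at *
    rw [I.init_adj ⟨a, ha⟩ ⟨a, ha⟩]
    simp
  · rw [init_zero] at *
    rw [I.init_adj ⟨a, ha⟩ ⟨b, hb⟩, I.init_adj ⟨b, hb⟩ ⟨a, ha⟩]
    simp [I.G.adj_comm]

theorem root_some {v : Fin I.n} {i : Fin k} (h : I.c v = some i) :
    root (RAM.init I.code) k v = i := by
  rw [root, I.init_color, h]; simp

theorem root_none {v : Fin I.n} (h : I.c v = none) :
    root (RAM.init I.code) k v = v + k := by
  rw [root, I.init_color, h]; simp

theorem valOn_eq_two_mul_ncard (χ : ℕ → ℕ) (c' : Fin I.n → Fin k)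
    (h : ∀ v : Fin I.n, χ (root (RAM.init I.code) k v) = c' v) :
    valOn (range (I.n + k)) (initW (RAM.init I.code) k) χ = 2 * (happyEdges I.G c').ncard := by
  classical
  rw [two_mul_ncard_happyEdges]
  refine (valOn_initW I.isWord_init χ).trans ?_
  simp only [init_zero]
  rw [sum_range]
  refine sum_congr rfl fun a _ => ?_
  rw [sum_range]
  refine sum_congr rfl fun b _ => ?_
  rw [h, h, I.init_adj]
  simp only [Fin.ext_iff]

/-- Colorings respecting the terminals restrict to extensions of the partial coloring, and each
extension lifts back by shifting uncolored vertices by `k`. -/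
theorem sol_iff_isYes (hk : 0 < k) :
    Sol k (I.n + k) (initW (RAM.init I.code) k) (2 * I.ell) ↔ I.IsYes := by
  constructor
  · rintro ⟨χ, hχ, hL⟩
    refine ⟨fun v => ⟨χ (root (RAM.init I.code) k v), hχ.2 _⟩, fun v i hv => ?_, ?_⟩
    · apply Fin.ext
      simp only [I.root_some hv]
      exact hχ.1 i i.2
    · rw [I.valOn_eq_two_mul_ncard χ (fun v => ⟨χ (root (RAM.init I.code) k v), hχ.2 _⟩)
        fun v => rfl] at hL
      omega
  · rintro ⟨c', hc', hL⟩
    set χ : ℕ → ℕ := fun x => if x < k then x else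
      if hx : x - k < I.n then c' ⟨x - k, hx⟩ else 0 with hχ
    have hcol : IsColoring k χ := by
      refine ⟨fun t ht => by simp [hχ, ht], fun v => ?_⟩
      simp only [hχ]
      split_ifs with h1 h2
      · exact h1
      · exact (c' _).2
      · exact hk
    refine ⟨χ, hcol, ?_⟩
    rw [I.valOn_eq_two_mul_ncard χ c' fun v => ?_]
    · omega
    · cases hv : I.c v with
      | some i => rw [I.root_some hv, hcol.1 i i.2, hc' v i hv]
      | none =>
        rw [I.root_none hv]
        simp [hχ]

theorem ncard_happyEdges_le (c' : Fin I.n → Fin k) :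
    (happyEdges I.G c').ncard ≤ I.n * I.n := by
  classical
  have h := two_mul_ncard_happyEdges I.G c'
  have h2 : (∑ a, ∑ b, if c' a = c' b then (if I.G.Adj a b then 1 else 0) else 0) ≤
      ∑ a : Fin I.n, ∑ b : Fin I.n, 1 := by
    refine sum_le_sum fun a _ => sum_le_sum fun b _ => ?_
    split_ifs <;> simp
  simp only [sum_const, card_univ, Fintype.card_fin, smul_eq_mul, mul_one] at h2
  omega

/-- The instance with the target cut down to more than the number of edges. -/
def clamp : MHE k := { I with ell := I.ell - (I.ell - (I.n * I.n + 1)) }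

/-- No coloring has more than `n * n` happy edges, so every target above that bound is equally
impossible; afterwards the target has polynomial size. -/
theorem clamp_isYes : I.clamp.IsYes ↔ I.IsYes := by
  refine exists_congr fun c' => and_congr_right fun _ => ?_
  have := I.ncard_happyEdges_le c'
  change I.ell - (I.ell - (I.n * I.n + 1)) ≤ (happyEdges I.G c').ncard ↔ _
  omega

theorem init_clamp : RAM.init I.clamp.code =
    Function.update (RAM.init I.code) 1 (I.ell - (I.ell - (I.n * I.n + 1))) := by
  funext r
  rcases r with _ | _ | r
  · rfl
  · simp [RAM.init, code, clamp]
  · rw [Function.update_of_ne (by omega)]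
    simp only [RAM.init, code, clamp, List.getD_cons_succ]
    rfl

end MHE

/-! ## The algorithm -/

namespace ArrayProg

open Ex Cmd Finset Weighted

infixr:60 " ;; " => Cmd.seq

/-- Entry of a one-dimensional array. -/
def Ex.at (x : Var) (i : Ex) : Ex := .arr x i 0

@[simp] theorem Ex.val_at (S : St) (x : Var) (i : Ex) : (Ex.at x i).val S = S x (i.val S) 0 := rfl

/-- Nonzero if and only if the values differ. -/
def Ex.ne (e f : Ex) : Ex := (e - f) + (f - e)

@[simp] theorem Ex.val_ne (S : St) (e f : Ex) :
    (Ex.ne e f).val S = (e.val S - f.val S) + (f.val S - e.val S) := rfl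

/-- Read the color of the vertex `x` into `t` and compute its representative `y`. -/
def rootProg (k : ℕ) (x y : Var) : Cmd :=
  .read .t (2 + var x) ;; .ite (var .t) (.put y (var .t - 1)) (.put y (var x + lit k))

/-- Read the input and build the weighted instance. -/
def loadProg (k : ℕ) : Cmd :=
  .read .n 0 ;; .read .L 1 ;; .put .N (var .n + lit k) ;; .put .L (2 * var .L) ;;
  .countLoop false .a (var .n) (
    rootProg k .a .ra ;; .ite (var .t) .skip (.set .al (var .ra) 0 1) ;;
    .countLoop false .b (var .n) (
      rootProg k .b .rb ;; .read .t (2 + var .n + var .n * var .a + var .b) ;;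
      .set .W (var .ra) (var .rb) (arr .W (var .ra) (var .rb) + var .t)))

/-- Copy row `v` of the weights and compute its sum, its sum over nonterminals, and its maximum. -/
def degProg (k : ℕ) : Cmd :=
  .put .d 0 ;; .put .du 0 ;; .put .mx 0 ;;
  .countLoop false .a (var .N) (
    .set .row (var .a) 0 (arr .W (var .v) (var .a)) ;;
    .put .d (var .d + Ex.at .row (var .a)) ;;
    -- With truncated subtraction this is nonzero exactly for `k ≤ a`, that is, for nonterminals.
    .ite (var .a + 1 - lit k) (.put .du (var .du + Ex.at .row (var .a))) .skip ;;
    .put .mx (var .mx + (Ex.at .row (var .a) - var .mx)))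

/-- Eliminate the vertex `v`. -/
def elimProg : Cmd :=
  .put .L (var .L - 2 * var .mx) ;; .set .al (var .v) 0 0 ;;
  .countLoop false .a (var .N) (.countLoop false .b (var .N) (
    .ite (Ex.ne (var .a) (var .v) * Ex.ne (var .b) (var .v))
      -- Products act as conjunctions, and `3 - d` is nonzero exactly when `d ≤ 2`. The row of `v`
      -- is read from its copy because the loop clears it in `W`.
      (.ite (Ex.ne (var .a) (var .b) * (3 - var .d))
        (.set .W (var .a) (var .b)
          (arr .W (var .a) (var .b) + Ex.at .row (var .a) * Ex.at .row (var .b)))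
        .skip)
      (.set .W (var .a) (var .b) 0)))

/-- Eliminate reducible vertices until none is left. -/
def reduceProg (k : ℕ) : Cmd :=
  .countLoop false .rd (var .n) (.countLoop false .i (var .n) (
    .put .v (var .i + lit k) ;;
    .ite (Ex.at .al (var .v))
      (degProg k ;; .ite ((var .d - 2) * var .du) .skip elimProg) .skip))

/-- List the remaining vertices. -/
def collectProg (k : ℕ) : Cmd :=
  .put .u 0 ;;
  .countLoop false .i (var .n) (
    .ite (Ex.at .al (var .i + lit k))
      (.set .V (var .u) 0 (var .i + lit k) ;; .put .u (var .u + 1)) .skip)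

/-- The binary digit `x` of `X`. -/
def bit (x : Var) : Ex :=
  var .X / Ex.at .pow (var x) - var .X / Ex.at .pow (var x) / 2 * 2

/-- Tabulate the powers of two up to `2 ^ u`. -/
def powProg : Cmd :=
  .set .pow 0 0 1 ;; .countLoop false .p (var .u) (.set .pow (var .p + 1) 0 (2 * Ex.at .pow (var .p)))

/-- Compute `2 ^ e`. -/
def expProg : Cmd := .put .pw 1 ;; .countLoop false .j (var .e) (.put .pw (2 * var .pw))

/-- Compute the weight of the class given by terminal `i` and the set coded by `X`, and one more
than its cardinality. -/
def classProg : Cmd :=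
  .put .s (arr .W (var .i) (var .i)) ;; .put .c 1 ;;
  .countLoop false .p (var .u) (
    .ite (bit .p) (
      .put .c (var .c + 1) ;;
      .put .s (var .s + 2 * arr .W (Ex.at .V (var .p)) (var .i)) ;;
      .countLoop false .q (var .u) (
        .ite (bit .q)
          (.put .s (var .s + arr .W (Ex.at .V (var .p)) (Ex.at .V (var .q)))) .skip))
      .skip)

/-- Tabulate the monomials of the classes. -/
def fillProg (k : ℕ) : Cmd :=
  .countLoop false .i (lit k) (.countLoop true .X (Ex.at .pow (var .u)) (
    classProg ;; .put .e (var .r * (var .c * var .Q - var .s)) ;; expProg ;;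
    .set .A (var .i) (var .X) (var .pw)))

/-- Sum up the tables over subsets. -/
def zetaProg (k : ℕ) : Cmd :=
  .countLoop false .i (lit k) (.countLoop false .p (var .u) (.countLoop true .X (Ex.at .pow (var .u)) (
    .ite (bit .p)
      (.set .A (var .i) (var .X) (arr .A (var .i) (var .X) +
        arr .A (var .i) (var .X - Ex.at .pow (var .p))))
      .skip)))

/-- The alternating sum of the products of the tables. -/
def sumProg (k : ℕ) : Cmd :=
  .put .pos 0 ;; .put .neg 0 ;;
  .countLoop true .X (Ex.at .pow (var .u)) (
    .put .pr 1 ;; .countLoop false .i (lit k) (.put .pr (var .pr * arr .A (var .i) (var .X))) ;;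
    .put .c (var .u) ;; .countLoop false .p (var .u) (.put .c (var .c + bit .p)) ;;
    .ite (var .c - var .c / 2 * 2) (.put .neg (var .neg + var .pr))
      (.put .pos (var .pos + var .pr)))

/-- Decide the remaining instance by counting covers. -/
def dpProg (k : ℕ) : Cmd :=
  -- With total weight at most `n * n` and target at most `2 * (n * n + 1)`, this `Q` exceeds `k`
  -- times the weight and is no smaller than the target; `r` is the least exponent for which `2 ^ r`
  -- exceeds the bound `2 ^ (u * k)` on the number of covers.
  powProg ;; .put .Q (2 * lit k * var .n * var .n + 3) ;; .put .r (var .u * lit k + 1) ;;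
  fillProg k ;; zetaProg k ;; sumProg k ;;
  .put .tot (var .pos - var .neg) ;;
  .put .e (var .r * (var .Q * (var .u + lit k) - var .L + 1)) ;; expProg ;;
  .put .ans (1 - (1 - (var .tot - var .tot / var .pw * var .pw)))

/-- The algorithm; the answer is YES without counting if `α * L ≤ β * u`. -/
def mainProg (k α β : ℕ) : Cmd :=
  loadProg k ;; reduceProg k ;; collectProg k ;;
  .ite (lit α * var .L - lit β * var .u) (dpProg k) (.put .ans 1)

theorem mainProg_wf (k α β : ℕ) : (mainProg k α β).wf = true := rfl

theorem mainProg_bigDeg (k α β : ℕ) : (mainProg k α β).bigDeg = 1 := rfl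

/-! ### Correctness -/

/-- The limits suffice for instances with `w 0` vertices. -/
structure Lim.Fits (l : Lim) (k : ℕ) : Prop where
  pos : 1 ≤ k
  word : IsWord l.w k
  target : l.w 1 ≤ l.w 0 * l.w 0 + 1
  rounds : 2 * (l.w 0 + k + 2) ^ 6 ≤ l.K
  bits : 2 * (l.w 0 + k + 2) * l.K ≤ l.B

namespace Lim.Fits

variable {l : Lim} {k : ℕ} (h : l.Fits k)
include h

theorem two_mul_pow_le {j : ℕ} (hj : j ≤ 6) : 2 * (l.w 0 + k + 2) ^ j ≤ l.K :=
  (Nat.mul_le_mul_left _ (Nat.pow_le_pow_right (by omega) hj)).trans h.rounds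

theorem lt {x : ℕ} (hx : x ≤ l.K) : x < 2 ^ l.B :=
  (Nat.lt_two_pow_self).trans_le (Nat.pow_le_pow_right (by norm_num)
    (hx.trans ((Nat.le_mul_of_pos_left _ (by omega)).trans h.bits)))

end Lim.Fits

end ArrayProg

/-! ### Loading the instance -/

namespace ArrayProg

open Ex Cmd Finset Weighted

theorem Lim.Fits.small {l : Lim} {k : ℕ} (h : l.Fits k) :
    4 * (l.w 0 * l.w 0) + 2 * (l.w 0 * k) + 4 * l.w 0 + 4 * k + 8 ≤ l.K := by
  have := h.two_mul_pow_le (j := 3) (by norm_num)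
  have hk := h.pos
  nlinarith [Nat.zero_le (l.w 0 * l.w 0), Nat.zero_le (l.w 0 * k), Nat.zero_le (k * k),
    Nat.zero_le (l.w 0 * l.w 0 * k), Nat.zero_le (l.w 0 * k * k),
    Nat.zero_le (l.w 0 * l.w 0 * l.w 0), Nat.zero_le (k * k * k)]

theorem tri_rootProg {l : Lim} {k : ℕ} (h : l.Fits k) {S : St} {x y : Var}
    (hx : S x 0 0 < l.w 0) (hxt : x ≠ .t) (hyt : y ≠ .t) :
    Tri l (rootProg k x y) S fun S' =>
      S' .t 0 0 = l.w (2 + S x 0 0) ∧ S' y 0 0 = root l.w k (S x 0 0) := by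
  have hsm := h.small
  have hc := h.word.color_le _ hx
  refine Tri.seq (Tri.read ?_ (Tri.ite (fun ht => Tri.put ?_ ?_) fun ht => Tri.put ?_ ?_)) <;>
    simp only [val_add, val_sub, val_var, val_two, val_one, val_lit, St.upd_apply, hxt,
      hyt.symm, false_and, and_self, if_true, if_false, ne_eq, root] at *
  · nlinarith
  · exact h.lt (by omega)
  · simp [ht]
  · exact h.lt (by omega)
  · simp [ht]

theorem tri_loadProg {l : Lim} {k : ℕ} (h : l.Fits k) :
    Tri l (loadProg k) (fun _ _ _ => 0) fun S => S .n 0 0 = l.w 0 ∧ S .N 0 0 = l.w 0 + k ∧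
      S .L 0 0 = 2 * l.w 1 ∧ S .W = initW l.w k ∧
      ∀ x, S .al x 0 = if x ∈ initU l.w k then 1 else 0 := by
  have hsm := h.small
  have htg := h.target
  refine Tri.seq (Tri.read (by simp) (Tri.seq (Tri.read (by simp) (Tri.seq (Tri.put
    (h.lt ?_) (Tri.seq (Tri.put (h.lt ?_) ?_)))))))
  · simp [St.upd_apply]; omega
  · simp [St.upd_apply]; omega
  refine Tri.countLoop (fun m S => (∀ x y, S .W x y = ∑ a ∈ range m, ∑ b ∈ range (l.w 0),
      if root l.w k a = x ∧ root l.w k b = y then l.w (2 + l.w 0 + l.w 0 * a + b) else 0) ∧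
    ∀ x, S .al x 0 = if ∃ a < m, l.w (2 + a) = 0 ∧ a + k = x then 1 else 0)
    (n := l.w 0) (by simp [St.upd_apply]) ?_ (by simp [St.upd_apply]) ?_ ?_
  · simp only [Lim.rounds]; simp; omega
  · intro m hm S₁ hf₁ ha ⟨hW, hal⟩
    have hn₁ : S₁ .n 0 0 = l.w 0 := by rw [hf₁ .n rfl]; simp [St.upd_apply]
    refine Tri.seq ((tri_rootProg h (by omega) (by decide) (by decide)).mono
      fun S₂ hf₂ ⟨ht₂, hra₂⟩ => Tri.seq ?_)
    have ha₂ : S₂ .a 0 0 = m := by rw [hf₂ .a rfl, ha]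
    rw [ha] at ht₂ hra₂
    have hal₃ : Tri l (.ite (var .t) .skip (.set .al (var .ra) 0 1)) S₂ fun S =>
        ∀ x, S .al x 0 = if ∃ a < m + 1, l.w (2 + a) = 0 ∧ a + k = x then 1 else 0 := by
      refine Tri.ite (fun ht => Tri.skip ?_) fun ht => Tri.set (h.lt ?_) ?_
      · intro x
        rw [hf₂ .al rfl, hal]
        refine if_congr ⟨fun ⟨a, h1, h2⟩ => ⟨a, by omega, h2⟩, fun ⟨a, h1, h2⟩ => ⟨a, ?_, h2⟩⟩
          rfl rfl
        rcases Nat.lt_succ_iff_lt_or_eq.1 h1 with h3 | rfl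
        · exact h3
        · exact absurd h2.1 (by simpa [ht₂] using ht)
      · simp; omega
      · intro x
        have h0 : l.w (2 + m) = 0 := by simpa [ht₂] using ht
        simp only [St.upd_apply, val_var, val_zero, val_one, hra₂, true_and, and_true, root, h0,
          ne_eq, not_true, if_false]
        by_cases hx : x = m + k
        · rw [if_pos hx, if_pos ⟨m, by omega, h0, hx.symm⟩]
        · rw [if_neg hx, hf₂ .al rfl, hal]
          refine if_congr ⟨fun ⟨a, h1, h2⟩ => ⟨a, by omega, h2⟩, fun ⟨a, h1, h2⟩ => ⟨a, ?_, h2⟩⟩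
            rfl rfl
          rcases Nat.lt_succ_iff_lt_or_eq.1 h1 with h3 | rfl
          · exact h3
          · exact absurd h2.2.symm hx
    refine hal₃.mono fun S₃ hf₃ hal₃ => ?_
    refine Tri.countLoop (fun m' S => ∀ x y, S .W x y = (∑ a ∈ range m, ∑ b ∈ range (l.w 0),
        if root l.w k a = x ∧ root l.w k b = y then l.w (2 + l.w 0 + l.w 0 * a + b) else 0) +
        ∑ b ∈ range m', if root l.w k m = x ∧ root l.w k b = y then
          l.w (2 + l.w 0 + l.w 0 * m + b) else 0)
      (n := l.w 0) (by rw [val_var, hf₃ .n rfl, hf₂ .n rfl, hn₁]) ?_ ?_ ?_ ?_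
    · simp only [Lim.rounds]; simp; omega
    · intro x y
      simp only [St.upd_apply, reduceCtorEq, false_and, if_false, range_zero, sum_empty, add_zero]
      rw [hf₃ .W rfl, hf₂ .W rfl, hW]
    · intro m' hm' S₄ hf₄ hb hW₄
      refine Tri.seq ((tri_rootProg h (by omega) (by decide) (by decide)).mono
        fun S₅ hf₅ ⟨ht₅, hrb₅⟩ => Tri.seq (Tri.read ?_ (Tri.set (h.lt ?_) ?_)))
      all_goals
        rw [hb] at hrb₅
        have ha₅ : S₅ .a 0 0 = m := by rw [hf₅ .a rfl, hf₄ .a rfl, hf₃ .a rfl, ha₂]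
        have hb₅ : S₅ .b 0 0 = m' := by rw [hf₅ .b rfl, hb]
        have hn₅ : S₅ .n 0 0 = l.w 0 := by
          rw [hf₅ .n rfl, hf₄ .n rfl, hf₃ .n rfl, hf₂ .n rfl, hn₁]
        have hra₅ : S₅ .ra 0 0 = root l.w k m := by
          rw [hf₅ .ra rfl, hf₄ .ra rfl, hf₃ .ra rfl, hra₂]
        have hW₅ : S₅ .W = S₄ .W := hf₅ .W rfl
      · simp only [val_add, val_mul, val_var, val_two, ha₅, hb₅, hn₅]
        nlinarith
      · simp only [val_add, val_mul, val_arr, val_var, val_two, St.upd_apply, reduceCtorEq,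
          false_and, if_false, and_self, if_true, ha₅, hb₅, hn₅, hra₅, hrb₅, hW₅, hW₄]
        have h1 := h.word.adj_le m hm m' hm'
        have h2 : (∑ a ∈ range m, ∑ b ∈ range (l.w 0), if root l.w k a = root l.w k m ∧
            root l.w k b = root l.w k m' then l.w (2 + l.w 0 + l.w 0 * a + b) else 0) ≤
            ∑ a ∈ range m, ∑ b ∈ range (l.w 0), 1 := by
          refine sum_le_sum fun a ha => sum_le_sum fun b hb => ?_
          have := h.word.adj_le a (by have := mem_range.1 ha; omega) b (mem_range.1 hb)
          split_ifs <;> omega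
        have h3 : (∑ b ∈ range m', if root l.w k m = root l.w k m ∧
            root l.w k b = root l.w k m' then l.w (2 + l.w 0 + l.w 0 * m + b) else 0) ≤
            ∑ b ∈ range m', 1 := by
          refine sum_le_sum fun b hb => ?_
          have := h.word.adj_le m hm b (by have := mem_range.1 hb; omega)
          split_ifs <;> omega
        simp only [sum_const, card_range, smul_eq_mul, mul_one] at h2 h3
        nlinarith
      · intro x y
        simp only [val_add, val_mul, val_arr, val_var, val_two, St.upd_apply, reduceCtorEq,
          false_and, if_false, and_self, if_true, ha₅, hb₅, hn₅, hra₅, hrb₅, hW₅, hW₄, true_and]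
        rw [sum_range_succ]
        by_cases hxy : x = root l.w k m ∧ y = root l.w k m'
        · obtain ⟨rfl, rfl⟩ := hxy
          simp [add_assoc]
        · rw [if_neg hxy, if_neg fun h => hxy ⟨h.1.symm, h.2.symm⟩, add_zero]
    · intro S₄ hf₄ hW₄
      refine ⟨fun x y => ?_, fun x => ?_⟩
      · simp only [St.upd_apply, reduceCtorEq, false_and, if_false]
        rw [hW₄, sum_range_succ]
      · simp only [St.upd_apply, reduceCtorEq, false_and, if_false]
        rw [hf₄ .al rfl, hal₃]
  · intro S hf ⟨hW, hal⟩
    refine ⟨?_, ?_, ?_, ?_, fun x => ?_⟩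
    · rw [hf .n rfl]; simp [St.upd_apply]
    · rw [hf .N rfl]; simp [St.upd_apply]
    · rw [hf .L rfl]; simp [St.upd_apply]
    · funext x y; rw [hW]; rfl
    · rw [hal]; simp only [mem_initU]

end ArrayProg

/-! ### Dependence on the weights below `N`; an arithmetic test for reducibility -/

namespace Weighted

open Finset

theorem Valid.congr {k N : ℕ} {U : Finset ℕ} {W W' : ℕ → ℕ → ℕ} (hW : Valid k N U W)
    (h : ∀ a < N, ∀ b < N, W' a b = W a b) : Valid k N U W' where
  symm a ha b hb := by rw [h a ha b hb, h b hb a ha, hW.symm a ha b hb]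
  zero a ha hk hU b hb := by rw [h a ha b hb, hW.zero a ha hk hU b hb]
  diag a ha hk := by rw [h a ha a ha, hW.diag a ha hk]
  sub := hW.sub

theorem Sol.congr {k N L : ℕ} {W W' : ℕ → ℕ → ℕ} (h : ∀ a < N, ∀ b < N, W' a b = W a b) :
    Sol k N W' L ↔ Sol k N W L := by
  refine exists_congr fun χ => and_congr_right fun _ => ?_
  rw [valOn, valOn, sum_congr rfl fun a ha => sum_congr rfl fun b hb => ?_]
  rw [h a (mem_range.1 ha) b (mem_range.1 hb)]

theorem sum_congr_range {N : ℕ} {W W' : ℕ → ℕ → ℕ} (h : ∀ a < N, ∀ b < N, W' a b = W a b) :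
    ∑ a ∈ range N, ∑ b ∈ range N, W' a b = ∑ a ∈ range N, ∑ b ∈ range N, W a b :=
  sum_congr rfl fun a ha => sum_congr rfl fun b hb => h a (mem_range.1 ha) b (mem_range.1 hb)

theorem wdeg_le_sum {N v : ℕ} (W : ℕ → ℕ → ℕ) (hv : v < N) :
    wdeg N W v ≤ ∑ a ∈ range N, ∑ b ∈ range N, W a b :=
  single_le_sum (f := fun a => ∑ b ∈ range N, W a b) (fun _ _ => Nat.zero_le _) (mem_range.2 hv)

theorem le_wdeg {N v a : ℕ} (W : ℕ → ℕ → ℕ) (ha : a < N) : W v a ≤ wdeg N W v :=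
  single_le_sum (f := W v) (fun _ _ => Nat.zero_le _) (mem_range.2 ha)

theorem reducible_iff {k N v : ℕ} {W : ℕ → ℕ → ℕ} : Reducible k N W v ↔
    (wdeg N W v - 2) * (∑ a ∈ range N, if k ≤ a then W v a else 0) = 0 := by
  rw [Nat.mul_eq_zero, sum_eq_zero_iff, Reducible, Nat.sub_eq_zero_iff_le]
  refine or_congr_right (forall_congr' fun a => ?_)
  rw [mem_range]
  refine imp_congr_right fun _ => ?_
  by_cases h : k ≤ a <;> simp [h]

end Weighted

/-! ### Reduction and listing of the remaining vertices -/

namespace ArrayProg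

open Ex Cmd Finset Weighted

/-- The state holds an instance with the open vertices `U` and the answer `P`. -/
structure Inst (l : Lim) (k : ℕ) (P : Prop) (U : Finset ℕ) (S : St) : Prop where
  n : S .n 0 0 = l.w 0
  N : S .N 0 0 = l.w 0 + k
  al : ∀ x, S .al x 0 = if x ∈ U then 1 else 0
  valid : Valid k (l.w 0 + k) U (S .W)
  sum_le : ∑ a ∈ range (l.w 0 + k), ∑ b ∈ range (l.w 0 + k), S .W a b ≤ l.w 0 * l.w 0
  target : S .L 0 0 ≤ 2 * l.w 1
  sol : Sol k (l.w 0 + k) (S .W) (S .L 0 0) ↔ P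

theorem Inst.congr {l : Lim} {k : ℕ} {P : Prop} {U : Finset ℕ} {S S' : St}
    (h : Inst l k P U S) (hn : S' .n = S .n) (hN : S' .N = S .N) (hal : S' .al = S .al)
    (hW : S' .W = S .W) (hL : S' .L = S .L) : Inst l k P U S' :=
  ⟨hn ▸ h.n, hN ▸ h.N, hal ▸ h.al, hW ▸ h.valid, hW ▸ h.sum_le, hL ▸ h.target,
    hW ▸ hL ▸ h.sol⟩

theorem tri_degProg {l : Lim} {k : ℕ} (h : l.Fits k) {P : Prop} {U : Finset ℕ} {S : St}
    (hI : Inst l k P U S) {v : ℕ} (hv : S .v 0 0 = v) (hvN : v < l.w 0 + k) :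
    Tri l (degProg k) S fun S' =>
      (∀ a < l.w 0 + k, S' .row a 0 = S .W v a) ∧ S' .d 0 0 = wdeg (l.w 0 + k) (S .W) v ∧
      S' .du 0 0 = (∑ a ∈ range (l.w 0 + k), if k ≤ a then S .W v a else 0) ∧
      S' .mx 0 0 = (range (l.w 0 + k)).sup (S .W v) := by
  have hsm := h.small
  have hdeg : wdeg (l.w 0 + k) (S .W) v ≤ l.w 0 * l.w 0 := (wdeg_le_sum _ hvN).trans hI.sum_le
  have hpar : ∀ m < l.w 0 + k, ∑ a ∈ range (m + 1), S .W v a ≤ l.w 0 * l.w 0 := fun m hm =>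
    (sum_le_sum_of_subset (range_subset_range.2 hm)).trans hdeg
  refine Tri.seq (Tri.put (h.lt (by simp)) (Tri.seq (Tri.put (h.lt (by simp))
    (Tri.seq (Tri.put (h.lt (by simp)) ?_)))))
  refine Tri.countLoop (fun m S' => (∀ a < m, S' .row a 0 = S .W v a) ∧
    S' .d 0 0 = ∑ a ∈ range m, S .W v a ∧
    S' .du 0 0 = (∑ a ∈ range m, if k ≤ a then S .W v a else 0) ∧
    S' .mx 0 0 = (range m).sup (S .W v)) (n := l.w 0 + k) ?_ ?_ ?_ ?_ ?_
  · simp [St.upd_apply, hI.N]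
  · simp only [Lim.rounds]; simp; omega
  · simp [St.upd_apply]
  · intro m hm S₁ hf₁ ha ⟨hrow, hd, hdu, hmx⟩
    have hv₁ : S₁ .v 0 0 = v := by rw [hf₁ .v rfl]; simp [St.upd_apply, hv]
    have hW₁ : S₁ .W = S .W := by rw [hf₁ .W rfl]; funext x y; simp [St.upd_apply]
    have hpm := hpar m hm
    rw [sum_range_succ] at hpm
    have hmx' : (range m).sup (S .W v) ≤ ∑ a ∈ range m, S .W v a :=
      Finset.sup_le fun a ha => single_le_sum (f := S .W v) (fun _ _ => Nat.zero_le _) ha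
    have hdu' : (∑ a ∈ range m, if k ≤ a then S .W v a else 0) ≤ ∑ a ∈ range m, S .W v a :=
      sum_le_sum fun a _ => by split_ifs <;> simp
    refine Tri.seq (Tri.set (h.lt ?_) (Tri.seq (Tri.put (h.lt ?_) (Tri.seq ?_))))
    · simp [hv₁, hW₁, ha]; omega
    · simp [St.upd_apply, hv₁, hW₁, ha, hd]; omega
    refine Tri.ite (fun ht => Tri.put (h.lt ?_) (Tri.put (h.lt ?_) ?_))
      fun ht => Tri.skip (Tri.put (h.lt ?_) ?_)
    all_goals
      simp only [val_add, val_sub, val_var, val_arr, val_at, val_zero, val_one, val_lit,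
        St.upd_apply, reduceCtorEq, false_and, if_false, and_self, if_true, true_and, and_true,
        hv₁, hW₁, ha, hd, hdu, hmx] at ht ⊢
    · omega
    · omega
    · refine ⟨fun a ha => ?_, by rw [sum_range_succ], ?_, ?_⟩
      · by_cases h1 : a = m
        · simp [h1]
        · rw [if_neg h1, hrow a (by omega)]
      · rw [sum_range_succ, if_pos (by omega)]
      · rw [range_add_one, sup_insert]
        change _ = max (S .W v m) ((range m).sup (S .W v))
        omega
    · omega
    · refine ⟨fun a ha => ?_, by rw [sum_range_succ], ?_, ?_⟩
      · by_cases h1 : a = m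
        · simp [h1]
        · rw [if_neg h1, hrow a (by omega)]
      · rw [sum_range_succ, if_neg (by omega), add_zero]
      · rw [range_add_one, sup_insert]
        change _ = max (S .W v m) ((range m).sup (S .W v))
        omega
  · intro S₁ _ hI₁
    exact hI₁

theorem tri_elimProg {l : Lim} {k : ℕ} (h : l.Fits k) {P : Prop} {U : Finset ℕ} {S : St}
    (hI : Inst l k P U S) {v : ℕ} (hv : S .v 0 0 = v) (hvN : v < l.w 0 + k)
    (hrow : ∀ a < l.w 0 + k, S .row a 0 = S .W v a)
    (hd : S .d 0 0 = wdeg (l.w 0 + k) (S .W) v) :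
    Tri l elimProg S fun S' => S' .L 0 0 = S .L 0 0 - 2 * S .mx 0 0 ∧
      (∀ x, S' .al x 0 = if x = v then 0 else S .al x 0) ∧
      ∀ a < l.w 0 + k, ∀ b < l.w 0 + k,
        S' .W a b = elim (S .W) v (wdeg (l.w 0 + k) (S .W) v ≤ 2) a b := by
  have hsm := h.small
  set N := l.w 0 + k with hN
  set D := wdeg N (S .W) v ≤ 2 with hD
  have htg := hI.target
  have hell := h.target
  have hWle : ∀ a < N, ∀ b < N, S .W a b ≤ l.w 0 * l.w 0 := fun a ha b hb =>
    ((le_wdeg _ hb).trans (wdeg_le_sum _ ha)).trans hI.sum_le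
  refine Tri.seq (Tri.put (h.lt (by simp; omega)) (Tri.seq (Tri.set (h.lt (by simp)) ?_)))
  set S₀ := (S.upd .L 0 0 (S .L 0 0 - 2 * S .mx 0 0)).upd .al v 0 0 with hS₀
  have hS₀' : ((S.upd .L 0 0 ((var .L - 2 * var .mx).val S)).upd .al
      ((var .v).val (S.upd .L 0 0 ((var .L - 2 * var .mx).val S)))
      (val (S.upd .L 0 0 ((var .L - 2 * var .mx).val S)) 0)
      (val (S.upd .L 0 0 ((var .L - 2 * var .mx).val S)) 0)) = S₀ := by
    simp [hS₀, St.upd_apply, hv]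
  rw [hS₀']
  have hother : ∀ y, y ≠ .L → y ≠ .al → S₀ y = S y := fun y h1 h2 => by
    rw [hS₀, St.upd_of_ne _ h2, St.upd_of_ne _ h1]
  clear_value S₀ D
  refine Tri.countLoop (fun m S' => ∀ a b, S' .W a b =
      if a < m ∧ b < N then elim (S .W) v (wdeg N (S .W) v ≤ 2) a b else S .W a b)
    (n := N) ?_ ?_ ?_ ?_ ?_
  · rw [val_var, hother .N (by decide) (by decide), hI.N]
  · simp only [Lim.rounds]; simp; omega
  · intro a b
    simp [St.upd_apply, hother .W (by decide) (by decide)]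
  · intro m hm S₁ hf₁ ha hW₁
    refine Tri.countLoop (fun m' S' => ∀ a b, S' .W a b = if a < m ∧ b < N ∨ a = m ∧ b < m' then
        elim (S .W) v (wdeg N (S .W) v ≤ 2) a b else S .W a b) (n := N) ?_ ?_ ?_ ?_ ?_
    · rw [val_var, hf₁ .N rfl, hother .N (by decide) (by decide), hI.N]
    · simp only [Lim.rounds]; simp; omega
    · intro a b
      simp [St.upd_apply, hW₁]
    · intro m' hm' S₂ hf₂ hb hW₂
      have hv₂ : S₂ .v 0 0 = v := by
        rw [hf₂ .v rfl, hf₁ .v rfl, hother .v (by decide) (by decide), hv]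
      have ha₂ : S₂ .a 0 0 = m := by rw [hf₂ .a rfl, ha]
      have hd₂ : S₂ .d 0 0 = wdeg N (S .W) v := by
        rw [hf₂ .d rfl, hf₁ .d rfl, hother .d (by decide) (by decide), hd]
      have hrow₂ : ∀ a < N, S₂ .row a 0 = S .W v a := by
        rw [hf₂ .row rfl, hf₁ .row rfl, hother .row (by decide) (by decide)]; exact hrow
      have hWmm : S₂ .W m m' = S .W m m' := by rw [hW₂, if_neg (by omega)]
      have hstep : ∀ x, x = elim (S .W) v (wdeg N (S .W) v ≤ 2) m m' → ∀ a b,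
          (if a = m ∧ b = m' then x else S₂ .W a b) =
          if a < m ∧ b < N ∨ a = m ∧ b < m' + 1 then
            elim (S .W) v (wdeg N (S .W) v ≤ 2) a b else S .W a b := by
        rintro x rfl a b
        by_cases hab : a = m ∧ b = m'
        · obtain ⟨rfl, rfl⟩ := hab
          simp
        · rw [if_neg hab, hW₂]
          exact if_congr (by omega) rfl rfl
      refine Tri.ite (fun ht => Tri.ite (fun ht' => Tri.set (h.lt ?_) ?_) fun ht' => Tri.skip ?_)
        fun ht => Tri.set (h.lt ?_) ?_
      · simp only [val_add, val_mul, val_var, val_arr, val_at, ha₂, hb, hWmm,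
          hrow₂ m hm, hrow₂ m' hm']
        have h1 := hWle m hm m' hm'
        have h2 := hWle v hvN m hm
        have h3 := hWle v hvN m' hm'
        have h4 := Nat.mul_le_mul h2 h3
        have h5 := h.two_mul_pow_le (j := 4) (by norm_num)
        have h6 : l.w 0 * l.w 0 * (l.w 0 * l.w 0) ≤ (l.w 0 + k + 2) ^ 4 := by
          have := Nat.pow_le_pow_left (show l.w 0 ≤ l.w 0 + k + 2 by omega) 4
          nlinarith
        have h7 : l.w 0 * l.w 0 ≤ (l.w 0 + k + 2) ^ 4 := by
          refine le_trans ?_ h6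
          rcases Nat.eq_zero_or_pos (l.w 0 * l.w 0) with h0 | h0
          · rw [h0]
          · exact Nat.le_mul_of_pos_left _ h0
        omega
      · intro a b
        simp only [St.upd_apply, val_add, val_mul, val_sub, val_var, val_arr, val_at, val_ne,
          val_three, reduceCtorEq, false_and, if_false, true_and, ha₂, hb, hv₂, hd₂, hWmm,
          hrow₂ m hm, hrow₂ m' hm'] at ht ht' ⊢
        refine hstep _ ?_ a b
        have h1 := left_ne_zero_of_mul ht
        have h2 := right_ne_zero_of_mul ht
        have h3 := left_ne_zero_of_mul ht'
        have h4 := right_ne_zero_of_mul ht'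
        rw [elim, if_neg (by omega), if_pos (by omega)]
      · intro a b
        simp only [St.upd_apply, val_mul, val_sub, val_var, val_ne,
          val_three, reduceCtorEq, false_and, if_false, ha₂, hb, hv₂, hd₂] at ht ht' ⊢
        have h1 := left_ne_zero_of_mul ht
        have h2 := right_ne_zero_of_mul ht
        rw [← hstep (S .W m m') ?_ a b]
        · split_ifs with hab
          · rw [hab.1, hab.2, hWmm]
          · rfl
        · rw [Nat.mul_eq_zero] at ht'
          rw [elim, if_neg (by omega), if_neg (by omega), add_zero]
      · simp
      · intro a b
        simp only [St.upd_apply, val_mul, val_var, val_ne,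
          val_zero, reduceCtorEq, false_and, if_false, true_and, ha₂, hb, hv₂] at ht ⊢
        refine hstep _ ?_ a b
        rw [Nat.mul_eq_zero] at ht
        rw [elim, if_pos (by omega)]
    · intro S₂ hf₂ hW₂ a b
      simp only [St.upd_apply, reduceCtorEq, false_and, if_false]
      rw [hW₂]
      exact if_congr (by omega) rfl rfl
  · intro S₁ hf₁ hW₁
    refine ⟨?_, fun x => ?_, fun a ha b hb => ?_⟩
    · rw [hf₁ .L rfl, hS₀]; simp [St.upd_apply]
    · rw [hf₁ .al rfl, hS₀]; simp [St.upd_apply]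
    · rw [hW₁, if_pos ⟨ha, hb⟩]

/-- A full scan either eliminates a vertex or shows that none is reducible; since at most `n`
vertices are open, `n` scans suffice. -/
theorem tri_reduceProg {l : Lim} {k : ℕ} (h : l.Fits k) {P : Prop} {U : Finset ℕ} {S : St}
    (hI : Inst l k P U S) :
    Tri l (reduceProg k) S fun S' => ∃ U', Inst l k P U' S' ∧
      ∀ v ∈ U', ¬ Reducible k (l.w 0 + k) (S' .W) v := by
  have hsm := h.small
  have hcard : ∀ U S, Inst l k P U S → U.card ≤ l.w 0 := fun U S hI => by
    simpa using card_le_card hI.valid.sub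
  refine Tri.countLoop (fun m S' => ∃ U', Inst l k P U' S' ∧ (U'.card + m ≤ l.w 0 ∨
    ∀ v ∈ U', ¬ Reducible k (l.w 0 + k) (S' .W) v)) (n := l.w 0) (by simp [hI.n]) ?_ ?_ ?_ ?_
  · simp only [Lim.rounds]; simp; omega
  · refine ⟨U, hI.congr ?_ ?_ ?_ ?_ ?_, Or.inl (hcard U S hI)⟩ <;>
      exact St.upd_of_ne _ (by decide) _ _ _
  · rintro m hm S₀ - - ⟨U₀, hI₀, hU₀⟩
    -- Either the scan has changed nothing and the vertices seen are irreducible, or the open set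
    -- has shrunk. The second case also remembers a reducible vertex at the start of the scan, which
    -- rules out that the instance was already irreducible then.
    refine Tri.countLoop (fun m' S' => ∃ U', Inst l k P U' S' ∧
      ((U' = U₀ ∧ S' .W = S₀ .W ∧
        ∀ v < m' + k, v ∈ U₀ → ¬ Reducible k (l.w 0 + k) (S₀ .W) v) ∨
      (U'.card < U₀.card ∧ ∃ v ∈ U₀, Reducible k (l.w 0 + k) (S₀ .W) v)))
      (n := l.w 0) (by simp [hI₀.n]) ?_ ?_ ?_ ?_
    · simp only [Lim.rounds]; simp; omega
    · refine ⟨U₀, hI₀.congr ?_ ?_ ?_ ?_ ?_, Or.inl ⟨rfl, ?_, fun v hv hvU => ?_⟩⟩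
      all_goals first
        | exact St.upd_of_ne _ (by decide) _ _ _
        | (have := (mem_Ico.1 (hI₀.valid.sub hvU)).1; omega)
    · rintro m' hm' S₁ - hi ⟨U₁, hI₁, hU₁⟩
      refine Tri.seq (Tri.put (h.lt (by simp [hi]; omega)) ?_)
      set S₂ := S₁.upd .v 0 0 ((var .i + lit k).val S₁) with hS₂
      have hv₂ : S₂ .v 0 0 = m' + k := by simp [hS₂, St.upd_apply, hi]
      have hI₂ : Inst l k P U₁ S₂ := by
        refine hI₁.congr ?_ ?_ ?_ ?_ ?_ <;> exact St.upd_of_ne _ (by decide) _ _ _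
      have hW₂ : S₂ .W = S₁ .W := St.upd_of_ne _ (by decide) _ _ _
      clear_value S₂
      have hskip : (m' + k ∈ U₁ → ¬ Reducible k (l.w 0 + k) (S₂ .W) (m' + k)) →
          ∀ S', S' .n = S₂ .n → S' .N = S₂ .N → S' .al = S₂ .al → S' .W = S₂ .W →
          S' .L = S₂ .L → ∃ U', Inst l k P U' S' ∧ ((U' = U₀ ∧ S' .W = S₀ .W ∧
            ∀ v < m' + 1 + k, v ∈ U₀ → ¬ Reducible k (l.w 0 + k) (S₀ .W) v) ∨
            (U'.card < U₀.card ∧ ∃ v ∈ U₀, Reducible k (l.w 0 + k) (S₀ .W) v)) := by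
        intro hred S' hn hN hal hW hL
        refine ⟨U₁, hI₂.congr hn hN hal hW hL, hU₁.imp_left ?_⟩
        rintro ⟨rfl, hWe, hirr⟩
        refine ⟨rfl, by rw [hW, hW₂, hWe], fun v hv hvU => ?_⟩
        by_cases hvm : v = m' + k
        · subst hvm
          rw [hW₂, hWe] at hred
          exact hred hvU
        · exact hirr v (by omega) hvU
      have hal : (Ex.at .al (var .v)).val S₂ = if m' + k ∈ U₁ then 1 else 0 := by
        rw [val_at, val_var, hv₂, hI₂.al]
      refine Tri.ite (fun ht => ?_) fun ht => Tri.skip ?_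
      · have hmem : m' + k ∈ U₁ := by
          by_contra hn
          rw [hal, if_neg hn] at ht
          exact ht rfl
        refine Tri.seq ((tri_degProg h hI₂ hv₂ (by omega)).mono
          fun S₃ hf₃ ⟨hrow, hd, hdu, hmx⟩ => ?_)
        have hI₃ : Inst l k P U₁ S₃ := hI₂.congr (hf₃ _ rfl) (hf₃ _ rfl) (hf₃ _ rfl)
          (hf₃ _ rfl) (hf₃ _ rfl)
        have hv₃ : S₃ .v 0 0 = m' + k := by rw [hf₃ .v rfl, hv₂]
        have hW₃ : S₃ .W = S₂ .W := hf₃ .W rfl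
        have htest : ((var .d - 2) * var .du).val S₃ = 0 ↔
            Reducible k (l.w 0 + k) (S₂ .W) (m' + k) := by
          rw [reducible_iff, ← hd, ← hdu]; rfl
        refine Tri.ite (fun ht' => Tri.skip ?_) fun ht' => ?_
        · refine hskip (fun _ hr => ht' (htest.2 hr)) _ ?_ ?_ ?_ ?_ ?_ <;>
            exact (St.upd_of_ne _ (by decide) _ _ _).trans (hf₃ _ rfl)
        · have hred := htest.1 ht'
          rw [← hW₃] at hrow hd hmx hred
          refine (tri_elimProg h hI₃ hv₃ (by omega) hrow hd).mono
            fun S₄ hf₄ ⟨hL₄, hal₄, hW₄⟩ => ⟨U₁.erase (m' + k), ?_, Or.inr ⟨?_, ?_⟩⟩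
          · rw [hmx] at hL₄
            have hI₄ : Inst l k P (U₁.erase (m' + k)) S₄ := by
              refine ⟨by rw [hf₄ .n rfl, hI₃.n], by rw [hf₄ .N rfl, hI₃.N], fun x => ?_,
                (hI₃.valid.elim hmem).congr hW₄, ?_, ?_, ?_⟩
              · rw [hal₄, hI₃.al]
                by_cases hx : x = m' + k
                · simp [hx]
                · simp [hx]
              · rw [sum_congr_range hW₄]
                exact (sum_elim_le hI₃.valid hmem).trans hI₃.sum_le
              · rw [hL₄]
                exact (Nat.sub_le _ _).trans hI₃.target
              · rw [Sol.congr hW₄, hL₄, ← sol_elim hI₃.valid hmem hred]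
                exact hI₃.sol
            refine hI₄.congr ?_ ?_ ?_ ?_ ?_ <;> exact St.upd_of_ne _ (by decide) _ _ _
          · have hlt : (U₁.erase (m' + k)).card < U₁.card := card_erase_lt_of_mem hmem
            rcases hU₁ with ⟨rfl, -, -⟩ | ⟨hlt', -⟩
            · exact hlt
            · omega
          · rcases hU₁ with ⟨rfl, hWe, -⟩ | ⟨-, hex⟩
            · rw [hW₃, hW₂, hWe] at hred
              exact ⟨_, hmem, hred⟩
            · exact hex
      · have hmem : m' + k ∉ U₁ := by
          intro hn
          rw [hal, if_pos hn] at ht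
          exact one_ne_zero ht
        refine hskip (fun hn => absurd hn hmem) _ ?_ ?_ ?_ ?_ ?_ <;>
          exact St.upd_of_ne _ (by decide) _ _ _
    · rintro S₁ - ⟨U₁, hI₁, hU₁⟩
      refine ⟨U₁, hI₁.congr ?_ ?_ ?_ ?_ ?_, ?_⟩
      iterate 5 exact St.upd_of_ne _ (by decide) _ _ _
      rw [St.upd_of_ne _ (by decide)]
      rcases hU₁ with ⟨rfl, hWe, hirr⟩ | ⟨hlt, v, hv, hvr⟩
      · refine Or.inr fun v hv => ?_
        rw [hWe]
        exact hirr v (mem_Ico.1 (hI₀.valid.sub hv)).2 hv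
      · rcases hU₀ with hU₀ | hU₀
        · exact Or.inl (by omega)
        · exact absurd hvr (hU₀ v hv)
  · rintro S' - ⟨U', hI', hU'⟩
    refine ⟨U', hI', ?_⟩
    rcases hU' with hU' | hU'
    · have : U' = ∅ := card_eq_zero.1 (by omega)
      simp [this]
    · exact hU'

theorem tri_collectProg {l : Lim} {k : ℕ} (h : l.Fits k) {P : Prop} {U : Finset ℕ} {S : St}
    (hI : Inst l k P U S) :
    Tri l (collectProg k) S fun S' => S' .u 0 0 = U.card ∧
      (range U.card).image (fun p => S' .V p 0) = U ∧
      Set.InjOn (fun p => S' .V p 0) (range U.card : Finset ℕ) := by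
  have hsm := h.small
  have hcard : U.card ≤ l.w 0 := by simpa using card_le_card hI.valid.sub
  refine Tri.seq (Tri.put (h.lt (by simp)) ?_)
  refine Tri.countLoop (fun m S' => S' .u 0 0 = (U.filter (· < m + k)).card ∧
      (range (U.filter (· < m + k)).card).image (fun p => S' .V p 0) = U.filter (· < m + k))
    (n := l.w 0) (by simp [St.upd_apply, hI.n]) ?_ ?_ ?_ ?_
  · simp only [Lim.rounds]; simp; omega
  · have : U.filter (· < k) = ∅ := filter_false_of_mem fun x hx => by
      have := (mem_Ico.1 (hI.valid.sub hx)).1; omega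
    simp [this, St.upd_apply]
  · intro m hm S₁ hf₁ hi ⟨hu, hV⟩
    have hal : (Ex.at .al (var .i + lit k)).val S₁ = if m + k ∈ U then 1 else 0 := by
      rw [val_at, hf₁ .al rfl, val_add, val_var, val_lit, hi, St.upd_of_ne _ (by decide), hI.al]
    refine Tri.ite (fun ht => ?_) fun ht => Tri.skip ?_
    · have hmem : m + k ∈ U := by
        by_contra hn
        rw [hal, if_neg hn] at ht
        exact ht rfl
      have hfil : U.filter (· < m + 1 + k) = insert (m + k) (U.filter (· < m + k)) := by
        ext x
        simp only [mem_filter, mem_insert]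
        constructor
        · rintro ⟨h1, h2⟩
          by_cases hx : x = m + k
          · exact Or.inl hx
          · exact Or.inr ⟨h1, by omega⟩
        · rintro (rfl | ⟨h1, h2⟩)
          · exact ⟨hmem, by omega⟩
          · exact ⟨h1, by omega⟩
      have hlt : (U.filter (· < m + k)).card < l.w 0 := by
        refine lt_of_lt_of_le (card_lt_card ?_) hcard
        exact filter_ssubset.2 ⟨m + k, hmem, by omega⟩
      refine Tri.seq (Tri.set (h.lt (by simp [hi]; omega))
        (Tri.put (h.lt (by simp [St.upd_apply, hu]; omega)) ?_))
      rw [hfil, card_insert_of_notMem (by simp)]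
      refine ⟨by simp [St.upd_apply, hu], ?_⟩
      rw [range_add_one, image_insert]
      congr 1
      · simp [St.upd_apply, hu, hi]
      · conv_rhs => rw [← hV]
        refine image_congr fun p hp => ?_
        have hp' := mem_range.1 (mem_coe.1 hp)
        simp [St.upd_apply, hu, hp'.ne]
    · have hmem : m + k ∉ U := by
        intro hn
        rw [hal, if_pos hn] at ht
        exact one_ne_zero ht
      have hfil : U.filter (· < m + 1 + k) = U.filter (· < m + k) := by
        refine filter_congr fun x hx => ?_
        have : x ≠ m + k := fun hx' => hmem (hx' ▸ hx)
        omega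
      rw [hfil]
      refine ⟨by simp [St.upd_apply, hu], ?_⟩
      conv_rhs => rw [← hV]
      exact image_congr fun p _ => by simp [St.upd_apply]
  · intro S' _ ⟨hu, hV⟩
    have hfil : U.filter (· < l.w 0 + k) = U :=
      filter_true_of_mem fun x hx => (mem_Ico.1 (hI.valid.sub hx)).2
    rw [hfil] at hu hV
    refine ⟨hu, hV, ?_⟩
    rw [← card_image_iff, hV, card_range]

end ArrayProg

/-! ### Bounds for the numbers in the counting phase -/

namespace Weighted

open Finset

theorem bits_succ (m X : ℕ) :
    bits (m + 1) X = if X / 2 ^ m % 2 = 1 then insert m (bits m X) else bits m X := by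
  rw [bits, range_add_one, filter_insert]; rfl

theorem notMem_bits_self (m X : ℕ) : m ∉ bits m X := by simp [mem_bits]

theorem bits_mono {m u : ℕ} (h : m ≤ u) (X : ℕ) : bits m X ⊆ bits u X :=
  filter_subset_filter _ (range_subset_range.2 h)

theorem card_bits_le (u X : ℕ) : (bits u X).card ≤ u := by
  simpa using card_le_card (bits_subset u X)

theorem zeta_le {a : Finset ℕ → ℕ} {M : ℕ} {F : Finset ℕ} (ha : ∀ s ⊆ F, a s ≤ M) (j : ℕ)
    {s : Finset ℕ} (hs : s ⊆ F) : zeta a j s ≤ 2 ^ j * M := by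
  induction j generalizing s with
  | zero => simpa [zeta] using ha s hs
  | succ j ih =>
    have h1 := ih hs
    have h2 := ih ((erase_subset j s).trans hs)
    rw [zeta, pow_succ]
    split_ifs <;> nlinarith

/-- Every intermediate value of the accumulator in `classProg` is at most the final class weight, so
it stays within the bit bound. -/
theorem partial_classWeight_le {W : ℕ → ℕ → ℕ} {V : ℕ → ℕ} {i m m' u X : ℕ} (hm : m ∈ bits u X)
    (hm' : m' ≤ u) : W i i + ∑ p ∈ bits m X, (2 * W (V p) i + ∑ q ∈ bits u X, W (V p) (V q)) +
      2 * W (V m) i + ∑ q ∈ bits m' X, W (V m) (V q) ≤ classWeight W V i (bits u X) := by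
  have h1 : insert m (bits m X) ⊆ bits u X :=
    insert_subset hm (bits_mono (mem_bits.1 hm).1.le X)
  have h2 := sum_le_sum_of_subset h1
    (f := fun p => 2 * W (V p) i + ∑ q ∈ bits u X, W (V p) (V q))
  rw [sum_insert (notMem_bits_self m X)] at h2
  have h3 := sum_le_sum_of_subset (bits_mono hm' X) (f := fun q => W (V m) (V q))
  unfold classWeight
  omega

end Weighted

/-! ### Correctness of the counting phase -/

namespace ArrayProg

open Ex Cmd Finset Weighted

theorem Lim.lt_pow (l : Lim) {x e : ℕ} (hx : x ≤ 2 ^ e) (he : e < l.B) : x < 2 ^ l.B :=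
  hx.trans_lt (Nat.pow_lt_pow_right (by norm_num) he)

namespace Lim.Fits

variable {l : Lim} {k : ℕ} (h : l.Fits k)
include h

/-- This quantity dominates the exponents of both the class monomials and the final modulus. The
three factors of degrees 2, 3 and 1 explain the sixth power in `Fits.rounds`. -/
theorem exponent_le {u : ℕ} (hu : u ≤ l.w 0) :
    (u * k + 1) * ((2 * k * l.w 0 * l.w 0 + 3) * (l.w 0 + k) + 1) ≤ l.K := by
  have h1 : u * k + 1 ≤ (l.w 0 + k + 2) ^ 2 := by
    have := Nat.mul_le_mul_right k hu
    nlinarith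
  have h2 : 2 * k * l.w 0 * l.w 0 + 3 ≤ 2 * (l.w 0 + k + 2) ^ 3 := by
    have e1 : k * (l.w 0 * l.w 0) ≤ (l.w 0 + k) * ((l.w 0 + k) * (l.w 0 + k)) :=
      Nat.mul_le_mul (by omega) (Nat.mul_le_mul (by omega) (by omega))
    have e2 : (l.w 0 + k + 2) ^ 3 = (l.w 0 + k) * ((l.w 0 + k) * (l.w 0 + k)) +
        6 * ((l.w 0 + k) * (l.w 0 + k)) + 12 * (l.w 0 + k) + 8 := by ring
    have e3 : 2 * k * l.w 0 * l.w 0 = 2 * (k * (l.w 0 * l.w 0)) := by ring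
    omega
  have h3 : (2 * k * l.w 0 * l.w 0 + 3) * (l.w 0 + k) + 1 ≤
      2 * (l.w 0 + k + 2) ^ 3 * (l.w 0 + k + 2) := by
    refine le_trans ?_ (Nat.mul_le_mul_right _ h2)
    rw [Nat.mul_add _ _ 2]
    omega
  calc _ ≤ (l.w 0 + k + 2) ^ 2 * (2 * (l.w 0 + k + 2) ^ 3 * (l.w 0 + k + 2)) :=
        Nat.mul_le_mul h1 h3
    _ = 2 * (l.w 0 + k + 2) ^ 6 := by ring
    _ ≤ l.K := h.rounds

/-- Table entries are at most `2 ^ K`, their subset sums at most `2 ^ (u + K)`, products of `k` of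
these at most `2 ^ ((u + K) * k)`, and `2 ^ u` products are added. -/
theorem bits_lt {u : ℕ} (hu : u ≤ l.w 0) : u + (u + l.K) * k < l.B := by
  have hsm := h.small
  refine lt_of_lt_of_le ?_ h.bits
  have h1 : (u + l.K) * k ≤ 2 * l.K * k := Nat.mul_le_mul_right _ (by omega)
  have h2 : 2 * (l.w 0 + k + 2) * l.K = 2 * l.K * k + 2 * (l.w 0 * l.K) + 4 * l.K := by ring
  omega

theorem add_lt {u : ℕ} (hu : u ≤ l.w 0) : u + l.K < l.B := by
  have := h.bits_lt hu
  have h1 : (u + l.K) * 1 ≤ (u + l.K) * k := Nat.mul_le_mul_left _ h.pos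
  omega

end Lim.Fits

theorem tri_powProg {l : Lim} {k u : ℕ} (h : l.Fits k) {S : St} (hu : S .u 0 0 = u)
    (hun : u ≤ l.w 0) : Tri l powProg S fun S' => ∀ p ≤ u, S' .pow p 0 = 2 ^ p := by
  have hsm := h.small
  refine Tri.seq (Tri.set (h.lt (by simp; omega)) ?_)
  refine Tri.countLoop (fun m S' => ∀ p ≤ m, S' .pow p 0 = 2 ^ p) (n := u)
    (by simp [St.upd_apply, hu]) ?_ ?_ ?_ ?_
  · simp only [Lim.rounds]; simp; omega
  · intro p hp
    obtain rfl : p = 0 := by omega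
    simp [St.upd_apply]
  · intro m hm S₁ _ hp hpow
    refine Tri.set ?_ fun p hp' => ?_
    · refine l.lt_pow (e := m + 1) ?_ ?_
      · simp [hp, hpow m le_rfl, pow_succ, mul_comm]
      · have := h.add_lt (u := m + 1) (by omega)
        omega
    · simp only [St.upd_apply, val_add, val_mul, val_var, val_at, val_one, val_two, val_zero, hp,
        hpow m le_rfl, reduceCtorEq, false_and, if_false, true_and, and_true]
      by_cases h1 : p = m + 1
      · simp [h1, pow_succ, mul_comm]
      · rw [if_neg h1, hpow p (by omega)]
  · exact fun S' _ hS' => hS'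

theorem val_bit {S : St} {x : Var} {X p : ℕ} (hX : S .X 0 0 = X) (hp : S x 0 0 = p)
    (hpow : S .pow p 0 = 2 ^ p) : (bit x).val S = X / 2 ^ p % 2 := by
  simp only [bit, val_sub, val_mul, val_div, val_var, val_at, val_two, hX, hp, hpow]
  omega

theorem tri_expProg {l : Lim} {k e : ℕ} (h : l.Fits k) {S : St} (he : S .e 0 0 = e)
    (heK : e ≤ l.K) : Tri l expProg S fun S' => S' .pw 0 0 = 2 ^ e := by
  have hsm := h.small
  refine Tri.seq (Tri.put (h.lt (by simp; omega)) ?_)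
  refine Tri.countLoop (fun m S' => S' .pw 0 0 = 2 ^ m) (n := e)
    (by simp [St.upd_apply, he]) ?_ (by simp [St.upd_apply]) ?_ ?_
  · simpa [Lim.rounds]
  · intro m hm S₁ _ _ hpw
    refine Tri.put ?_ ?_
    · refine l.lt_pow (e := m + 1) ?_ ?_
      · simp [hpw, pow_succ, mul_comm]
      · have := h.add_lt (Nat.zero_le _)
        omega
    · simp [St.upd_apply, hpw, pow_succ, mul_comm]
  · exact fun S' _ hS' => hS'

theorem tri_classProg {l : Lim} {k u i X : ℕ} (h : l.Fits k) {S : St} (hu : S .u 0 0 = u)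
    (hun : u ≤ l.w 0) (hi : S .i 0 0 = i) (hX : S .X 0 0 = X)
    (hpow : ∀ p ≤ u, S .pow p 0 = 2 ^ p)
    (hcw : classWeight (S .W) (fun p => S .V p 0) i (bits u X) ≤ l.w 0 * l.w 0) :
    Tri l classProg S fun S' =>
      S' .s 0 0 = classWeight (S .W) (fun p => S .V p 0) i (bits u X) ∧
      S' .c 0 0 = (bits u X).card + 1 := by
  have hsm := h.small
  have hWii : S .W i i ≤ l.w 0 * l.w 0 := le_trans (Nat.le_add_right _ _) hcw
  refine Tri.seq (Tri.put (h.lt (by simp [hi]; omega)) (Tri.seq (Tri.put (h.lt (by simp; omega)) ?_)))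
  refine Tri.countLoop (fun m S' => S' .s 0 0 = S .W i i + ∑ p ∈ bits m X, (2 * S .W (S .V p 0) i +
      ∑ q ∈ bits u X, S .W (S .V p 0) (S .V q 0)) ∧ S' .c 0 0 = (bits m X).card + 1)
    (n := u) (by simp [St.upd_apply, hu]) ?_ ?_ ?_ ?_
  · simp only [Lim.rounds]; simp; omega
  · simp [St.upd_apply, hi, bits]
  · intro m hm S₁ hf₁ hp ⟨hs, hc⟩
    have hX₁ : S₁ .X 0 0 = X := by rw [hf₁ .X rfl]; simp [St.upd_apply, hX]
    have hi₁ : S₁ .i 0 0 = i := by rw [hf₁ .i rfl]; simp [St.upd_apply, hi]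
    have hu₁ : S₁ .u 0 0 = u := by rw [hf₁ .u rfl]; simp [St.upd_apply, hu]
    have hW₁ : S₁ .W = S .W := by rw [hf₁ .W rfl]; funext x y; simp [St.upd_apply]
    have hV₁ : S₁ .V = S .V := by rw [hf₁ .V rfl]; funext x y; simp [St.upd_apply]
    have hpow₁ : S₁ .pow = S .pow := by rw [hf₁ .pow rfl]; funext x y; simp [St.upd_apply]
    have hbit := val_bit hX₁ hp (by rw [hpow₁, hpow m hm.le])
    refine Tri.ite (fun ht => ?_) fun ht => Tri.skip ?_
    · have hb1 : X / 2 ^ m % 2 = 1 := by rw [hbit] at ht; omega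
      have hmem : m ∈ bits u X := mem_bits.2 ⟨hm, hb1⟩
      have hpart := fun m' hm' => (partial_classWeight_le (W := S .W) (V := fun p => S .V p 0)
        (i := i) (m' := m') hmem hm').trans hcw
      have hcard := card_bits_le m X
      refine Tri.seq (Tri.put (h.lt (by simp [hc]; omega)) (Tri.seq (Tri.put (h.lt ?_) ?_)))
      · simp only [val_add, val_mul, val_var, val_arr, val_at, val_two, St.upd_apply,
          reduceCtorEq, false_and, if_false, hs, hp, hi₁, hW₁, hV₁]
        have := hpart 0 (Nat.zero_le _)
        omega
      refine Tri.countLoop (fun m' S' => S' .s 0 0 = S .W i i +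
          ∑ p ∈ bits m X, (2 * S .W (S .V p 0) i + ∑ q ∈ bits u X, S .W (S .V p 0) (S .V q 0)) +
          2 * S .W (S .V m 0) i + ∑ q ∈ bits m' X, S .W (S .V m 0) (S .V q 0))
        (n := u) (by simp [St.upd_apply, hu₁]) ?_ ?_ ?_ ?_
      · simp only [Lim.rounds]; simp; omega
      · simp [St.upd_apply, hs, hp, hi₁, hW₁, hV₁, bits]
      · intro m' hm' S₂ hf₂ hq hs₂
        have hX₂ : S₂ .X 0 0 = X := by rw [hf₂ .X rfl]; simp [St.upd_apply, hX₁]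
        have hp₂ : S₂ .p 0 0 = m := by rw [hf₂ .p rfl]; simp [St.upd_apply, hp]
        have hW₂ : S₂ .W = S .W := by rw [hf₂ .W rfl, ← hW₁]; funext x y; simp [St.upd_apply]
        have hV₂ : S₂ .V = S .V := by rw [hf₂ .V rfl, ← hV₁]; funext x y; simp [St.upd_apply]
        have hpow₂ : S₂ .pow = S .pow := by
          rw [hf₂ .pow rfl, ← hpow₁]; funext x y; simp [St.upd_apply]
        have hbit₂ := val_bit hX₂ hq (by rw [hpow₂, hpow m' hm'.le])
        refine Tri.ite (fun ht' => Tri.put (h.lt ?_) ?_) fun ht' => Tri.skip ?_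
        · have hb2 : X / 2 ^ m' % 2 = 1 := by rw [hbit₂] at ht'; omega
          have := hpart (m' + 1) hm'
          rw [bits_succ m', if_pos hb2, sum_insert (notMem_bits_self m' X)] at this
          simp only [val_add, val_var, val_arr, val_at, hs₂, hp₂, hq, hW₂, hV₂]
          omega
        · have hb2 : X / 2 ^ m' % 2 = 1 := by rw [hbit₂] at ht'; omega
          rw [bits_succ m', if_pos hb2, sum_insert (notMem_bits_self m' X)]
          simp only [St.upd_apply, val_add, val_var, val_arr, val_at, hs₂, hp₂, hq, hW₂, hV₂,
            reduceCtorEq, false_and, if_false, and_self, if_true]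
          omega
        · have hb2 : ¬ X / 2 ^ m' % 2 = 1 := by rw [hbit₂] at ht'; omega
          rw [bits_succ m', if_neg hb2]
          simp only [St.upd_apply, reduceCtorEq, false_and, if_false]
          exact hs₂
      · intro S₂ hf₂ hs₂
        rw [bits_succ m, if_pos hb1, sum_insert (notMem_bits_self m X),
          card_insert_of_notMem (notMem_bits_self m X)]
        simp only [St.upd_apply, reduceCtorEq, false_and, if_false]
        refine ⟨by rw [hs₂]; omega, ?_⟩
        rw [hf₂ .c rfl]
        simp [St.upd_apply, hc]
    · have hb1 : ¬ X / 2 ^ m % 2 = 1 := by rw [hbit] at ht; omega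
      rw [bits_succ m, if_neg hb1]
      simp only [St.upd_apply, reduceCtorEq, false_and, if_false]
      exact ⟨hs, hc⟩
  · exact fun S' _ hS' => hS'

theorem tri_fillProg {l : Lim} {k u : ℕ} (h : l.Fits k) {S : St} (hu : S .u 0 0 = u)
    (hun : u ≤ l.w 0) (huE : 2 ^ u ≤ l.E) (hpow : ∀ p ≤ u, S .pow p 0 = 2 ^ p)
    (hQ : S .Q 0 0 = 2 * k * l.w 0 * l.w 0 + 3) (hr : S .r 0 0 = u * k + 1)
    (hcw : ∀ i < k, ∀ t ⊆ range u,
      classWeight (S .W) (fun p => S .V p 0) i t ≤ l.w 0 * l.w 0) :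
    Tri l (fillProg k) S fun S' => ∀ i < k, ∀ X < 2 ^ u, S' .A i X =
      2 ^ ((u * k + 1) * (((bits u X).card + 1) * (2 * k * l.w 0 * l.w 0 + 3) -
        classWeight (S .W) (fun p => S .V p 0) i (bits u X))) := by
  have hsm := h.small
  set F : ℕ → ℕ → ℕ := fun i X => (u * k + 1) * (((bits u X).card + 1) *
    (2 * k * l.w 0 * l.w 0 + 3) - classWeight (S .W) (fun p => S .V p 0) i (bits u X)) with hF
  have hFK : ∀ i X, F i X ≤ l.K := by
    intro i X
    refine le_trans (Nat.mul_le_mul_left _ ?_) (h.exponent_le hun)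
    have h1 : (bits u X).card + 1 ≤ l.w 0 + k := by
      have := card_bits_le u X
      have := h.pos
      omega
    have h2 := Nat.mul_le_mul_right (2 * k * l.w 0 * l.w 0 + 3) h1
    rw [mul_comm (l.w 0 + k)] at h2
    omega
  refine Tri.countLoop (fun m S' => ∀ i < m, ∀ X < 2 ^ u, S' .A i X = 2 ^ F i X) (n := k) rfl ?_
    (fun i hi => absurd hi (Nat.not_lt_zero i)) ?_ fun S' _ hS' => hS'
  · simp only [Lim.rounds]; simp; omega
  intro m hm S₁ hf₁ hi hA₁
  have hval : (Ex.at .pow (var .u)).val S₁ = 2 ^ u := by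
    rw [val_at, val_var, hf₁ .u rfl, hf₁ .pow rfl, hu, hpow u le_rfl]
  refine Tri.countLoop (fun m' S' => (∀ i < m, ∀ X < 2 ^ u, S' .A i X = 2 ^ F i X) ∧
    ∀ X < m', S' .A m X = 2 ^ F m X) (n := 2 ^ u) ?_ ?_ ?_ ?_ ?_
  · exact hval
  · simpa [Lim.rounds]
  · refine ⟨fun i hi X hX => ?_, fun X hX => absurd hX (Nat.not_lt_zero X)⟩
    simp [St.upd_apply, hA₁ i hi X hX]
  · rintro m' hm' S₂ hf₂ hX ⟨hA, hA'⟩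
    have hi₂ : S₂ .i 0 0 = m := by rw [hf₂ .i rfl, hi]
    have hW₂ : S₂ .W = S .W := by rw [hf₂ .W rfl, hf₁ .W rfl]
    have hV₂ : S₂ .V = S .V := by rw [hf₂ .V rfl, hf₁ .V rfl]
    have hu₂ : S₂ .u 0 0 = u := by rw [hf₂ .u rfl, hf₁ .u rfl, hu]
    have hpow₂ : S₂ .pow = S .pow := by rw [hf₂ .pow rfl, hf₁ .pow rfl]
    refine Tri.seq ((tri_classProg h hu₂ hun hi₂ hX (by rw [hpow₂]; exact hpow) (by
      rw [hW₂, hV₂]; exact hcw m hm _ (bits_subset _ _))).mono fun S₃ hf₃ ⟨hs, hc⟩ => ?_)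
    have he : (var .r * (var .c * var .Q - var .s)).val S₃ = F m m' := by
      simp only [val_mul, val_sub, val_var, hs, hc, hW₂, hV₂, hF]
      rw [hf₃ .r rfl, hf₃ .Q rfl, hf₂ .r rfl, hf₂ .Q rfl, hf₁ .r rfl, hf₁ .Q rfl, hr, hQ]
    refine Tri.seq (Tri.put (h.lt (he ▸ hFK m m')) (Tri.seq ((tri_expProg h
      (by simp [St.upd_apply, ← he]) (hFK m m')).mono fun S₄ hf₄ hpw => Tri.set ?_ ?_)))
    · rw [val_var, hpw]
      refine l.lt_pow le_rfl ?_
      have := h.add_lt (Nat.zero_le _)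
      have := hFK m m'
      omega
    · have hi₄ : S₄ .i 0 0 = m := by
        rw [hf₄ .i rfl, St.upd_of_ne _ (by decide), hf₃ .i rfl, hi₂]
      have hX₄ : S₄ .X 0 0 = m' := by
        rw [hf₄ .X rfl, St.upd_of_ne _ (by decide), hf₃ .X rfl, hX]
      have hA₄ : S₄ .A = S₂ .A := by
        rw [hf₄ .A rfl, St.upd_of_ne _ (by decide), hf₃ .A rfl]
      simp only [St.upd_apply, val_var, hi₄, hX₄, hA₄, hpw, reduceCtorEq, false_and, if_false,
        true_and]
      refine ⟨fun i hi X hX => ?_, fun X hX => ?_⟩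
      · rw [if_neg (by omega), hA i hi X hX]
      · by_cases h1 : X = m'
        · simp [h1]
        · rw [if_neg h1, hA' X (by omega)]
  · rintro S₂ - ⟨hA, hA'⟩ i hi X hX
    simp only [St.upd_apply, reduceCtorEq, false_and, if_false]
    rcases Nat.lt_succ_iff_lt_or_eq.1 hi with h1 | rfl
    · exact hA i h1 X hX
    · exact hA' X hX

theorem tri_zetaProg {l : Lim} {k u : ℕ} (h : l.Fits k) {S : St} (hu : S .u 0 0 = u)
    (hun : u ≤ l.w 0) (huE : 2 ^ u ≤ l.E) (hpow : ∀ p ≤ u, S .pow p 0 = 2 ^ p)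
    (a : ℕ → Finset ℕ → ℕ) (ha : ∀ i < k, ∀ s ⊆ range u, a i s ≤ 2 ^ l.K)
    (hA : ∀ i < k, ∀ X < 2 ^ u, S .A i X = a i (bits u X)) :
    Tri l (zetaProg k) S fun S' => ∀ i < k, ∀ X < 2 ^ u,
      S' .A i X = zeta (a i) u (bits u X) := by
  have hsm := h.small
  refine Tri.countLoop (fun m S' => ∀ i < k, ∀ X < 2 ^ u,
      S' .A i X = zeta (a i) (if i < m then u else 0) (bits u X)) (n := k) rfl ?_ ?_ ?_ ?_
  · simp only [Lim.rounds]; simp; omega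
  · intro i hi X hX
    simp [St.upd_apply, hA i hi X hX, zeta]
  · intro m hm S₁ hf₁ hi hA₁
    refine Tri.countLoop (fun j S' => ∀ i < k, ∀ X < 2 ^ u, S' .A i X =
      zeta (a i) (if i < m then u else if i = m then j else 0) (bits u X)) (n := u) ?_ ?_ ?_ ?_ ?_
    · rw [val_var, hf₁ .u rfl, hu]
    · simp only [Lim.rounds]; simp; omega
    · intro i hi X hX
      simp [St.upd_apply, hA₁ i hi X hX]
    · intro j hj S₂ hf₂ hp hA₂
      -- The table is updated in place. The entry read at `X - 2 ^ j` has already been visited, but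
      -- its set lacks `j`, so stage `j` left it unchanged.
      refine Tri.countLoop (fun x S' => ∀ i < k, ∀ X < 2 ^ u, S' .A i X =
        zeta (a i) (if i < m then u else if i = m then (if X < x then j + 1 else j) else 0)
          (bits u X)) (n := 2 ^ u) ?_ ?_ ?_ ?_ ?_
      · rw [val_at, val_var, hf₂ .u rfl, hf₂ .pow rfl, hf₁ .u rfl, hf₁ .pow rfl, hu,
          hpow u le_rfl]
      · simpa [Lim.rounds]
      · intro i hi X hX
        simp [St.upd_apply, hA₂ i hi X hX]
      · intro x hx S₃ hf₃ hX₃ hA₃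
        have hp₃ : S₃ .p 0 0 = j := by rw [hf₃ .p rfl, hp]
        have hi₃ : S₃ .i 0 0 = m := by rw [hf₃ .i rfl, hf₂ .i rfl, hi]
        have hpow₃ : S₃ .pow j 0 = 2 ^ j := by
          rw [hf₃ .pow rfl, hf₂ .pow rfl, hf₁ .pow rfl, hpow j hj.le]
        have hbit := val_bit hX₃ hp₃ hpow₃
        have hold : S₃ .A m x = zeta (a m) j (bits u x) := by
          rw [hA₃ m hm x hx]; simp
        have hrest : ∀ i < k, ∀ X < 2 ^ u, ¬ (i = m ∧ X = x) → S₃ .A i X = zeta (a i)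
            (if i < m then u else if i = m then (if X < x + 1 then j + 1 else j) else 0)
              (bits u X) := by
          intro i hi X hX hne
          rw [hA₃ i hi X hX]
          by_cases h1 : i = m
          · have : X < x ↔ X < x + 1 := by omega
            simp only [this]
          · simp [h1]
        refine Tri.ite (fun ht => ?_) fun ht => Tri.skip fun i hi X hX => ?_
        · have hb : x / 2 ^ j % 2 = 1 := by rw [hbit] at ht; omega
          have hle : 2 ^ j ≤ x := by
            by_contra hlt
            rw [Nat.div_eq_of_lt (by omega)] at hb
            omega
          have hpos : 0 < 2 ^ j := by positivity
          have hnew : (arr .A (var .i) (var .X) +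
              arr .A (var .i) (var .X - Ex.at .pow (var .p))).val S₃ =
              zeta (a m) (j + 1) (bits u x) := by
            simp only [val_add, val_arr, val_sub, val_var, val_at, hi₃, hX₃, hp₃, hpow₃, hold]
            rw [hA₃ m hm (x - 2 ^ j) (by omega), bits_sub_two_pow hb]
            have hlt : x - 2 ^ j < x := by omega
            have hmem : j ∈ bits u x := mem_bits.2 ⟨hj, hb⟩
            simp [zeta, hlt, hmem]
          refine Tri.set ?_ fun i hi X hX => ?_
          · rw [hnew]
            refine l.lt_pow (e := u + l.K) ?_ (h.add_lt hun)
            refine (zeta_le (ha m hm) _ (bits_subset u x)).trans ?_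
            rw [pow_add 2 u]
            exact Nat.mul_le_mul_right _ (Nat.pow_le_pow_right two_pos hj)
          · rw [hnew]
            simp only [St.upd_apply, val_var, hi₃, hX₃, reduceCtorEq, false_and, if_false,
              true_and]
            by_cases h1 : i = m ∧ X = x
            · obtain ⟨rfl, rfl⟩ := h1
              simp
            · rw [if_neg h1, hrest i hi X hX h1]
        · have hb : ¬ x / 2 ^ j % 2 = 1 := by rw [hbit] at ht; omega
          simp only [St.upd_apply, reduceCtorEq, false_and, if_false]
          by_cases h1 : i = m ∧ X = x
          · obtain ⟨rfl, rfl⟩ := h1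
            have hmem : j ∉ bits u X := fun hm => hb (mem_bits.1 hm).2
            rw [hold]
            simp [zeta, hmem]
          · exact hrest i hi X hX h1
      · intro S₃ _ hA₃ i hi X hX
        simp only [St.upd_apply, reduceCtorEq, false_and, if_false]
        rw [hA₃ i hi X hX]
        simp [hX]
    · intro S₂ _ hA₂ i hi X hX
      simp only [St.upd_apply, reduceCtorEq, false_and, if_false]
      rw [hA₂ i hi X hX]
      congr 1
      split_ifs <;> omega
  · intro S' _ hS' i hi X hX
    rw [hS' i hi X hX, if_pos hi]

theorem tri_sumProg {l : Lim} {k u : ℕ} (h : l.Fits k) {S : St} (hu : S .u 0 0 = u)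
    (hun : u ≤ l.w 0) (huE : 2 ^ u ≤ l.E) (hpow : ∀ p ≤ u, S .pow p 0 = 2 ^ p)
    (z : ℕ → ℕ → ℕ) (hz : ∀ i < k, ∀ X < 2 ^ u, z i X ≤ 2 ^ (u + l.K))
    (hA : ∀ i < k, ∀ X < 2 ^ u, S .A i X = z i X) :
    Tri l (sumProg k) S fun S' =>
      S' .pos 0 0 = (∑ X ∈ range (2 ^ u), if (u + (bits u X).card) % 2 = 0 then
        ∏ i ∈ range k, z i X else 0) ∧
      S' .neg 0 0 = ∑ X ∈ range (2 ^ u), if (u + (bits u X).card) % 2 = 0 then 0 else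
        ∏ i ∈ range k, z i X := by
  have hsm := h.small
  have hprod : ∀ X < 2 ^ u, ∀ m ≤ k, ∏ i ∈ range m, z i X ≤ 2 ^ ((u + l.K) * k) := by
    intro X hX m hm
    calc ∏ i ∈ range m, z i X ≤ ∏ i ∈ range m, 2 ^ (u + l.K) :=
          prod_le_prod' fun i hi => hz i (by have := mem_range.1 hi; omega) X hX
      _ = 2 ^ ((u + l.K) * m) := by rw [prod_const, card_range, ← pow_mul]
      _ ≤ _ := Nat.pow_le_pow_right (by norm_num) (Nat.mul_le_mul_left _ hm)
  have hsum : ∀ f : ℕ → ℕ, (∀ X < 2 ^ u, f X ≤ ∏ i ∈ range k, z i X) → ∀ m ≤ 2 ^ u,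
      ∑ X ∈ range m, f X < 2 ^ l.B := by
    intro f hf m hm
    refine l.lt_pow ?_ (h.bits_lt hun)
    calc ∑ X ∈ range m, f X ≤ ∑ X ∈ range m, 2 ^ ((u + l.K) * k) :=
          sum_le_sum fun X hX => by
            have hX' : X < 2 ^ u := (mem_range.1 hX).trans_le hm
            exact (hf X hX').trans (hprod X hX' k le_rfl)
      _ ≤ 2 ^ u * 2 ^ ((u + l.K) * k) := by
          rw [sum_const, card_range, smul_eq_mul]
          exact Nat.mul_le_mul_right _ hm
      _ = _ := (pow_add _ _ _).symm
  refine Tri.seq (Tri.put (h.lt (by simp)) (Tri.seq (Tri.put (h.lt (by simp)) ?_)))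
  refine Tri.countLoop (fun m S' =>
      S' .pos 0 0 = (∑ X ∈ range m, if (u + (bits u X).card) % 2 = 0 then
        ∏ i ∈ range k, z i X else 0) ∧
      S' .neg 0 0 = ∑ X ∈ range m, if (u + (bits u X).card) % 2 = 0 then 0 else
        ∏ i ∈ range k, z i X) (n := 2 ^ u) ?_ ?_ ?_ ?_ fun S' _ hS' => hS'
  · simp [St.upd_apply, hu, hpow u le_rfl]
  · simpa [Lim.rounds]
  · simp [St.upd_apply]
  intro x hx S₁ hf₁ hX ⟨hpos, hneg⟩
  have hu₁ : S₁ .u 0 0 = u := by rw [hf₁ .u rfl]; simp [St.upd_apply, hu]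
  have hA₁ : S₁ .A = S .A := by rw [hf₁ .A rfl]; funext x y; simp [St.upd_apply]
  have hpow₁ : S₁ .pow = S .pow := by rw [hf₁ .pow rfl]; funext x y; simp [St.upd_apply]
  refine Tri.seq (Tri.put (h.lt (by simp; omega)) (Tri.seq ?_))
  refine Tri.countLoop (fun m S' => S' .pr 0 0 = ∏ i ∈ range m, z i x) (n := k) rfl ?_
    (by simp [St.upd_apply]) ?_ ?_
  · simp only [Lim.rounds]; simp; omega
  · intro m hm S₂ hf₂ hi hpr
    have hval : (var .pr * arr .A (var .i) (var .X)).val S₂ = ∏ i ∈ range (m + 1), z i x := by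
      have hX₂ : S₂ .X 0 0 = x := by rw [hf₂ .X rfl]; simp [St.upd_apply, hX]
      have hA₂ : S₂ .A = S .A := by rw [hf₂ .A rfl, ← hA₁]; funext x y; simp [St.upd_apply]
      simp only [val_mul, val_arr, val_var, hpr, hi, hX₂, hA₂, hA m hm x hx, prod_range_succ]
    refine Tri.put ?_ ?_
    · rw [hval]
      refine l.lt_pow (hprod x hx _ hm) ?_
      have := h.bits_lt hun
      omega
    · rw [hval]; simp [St.upd_apply]
  intro S₂ hf₂ hpr
  have hu₂ : S₂ .u 0 0 = u := by rw [hf₂ .u rfl]; simp [St.upd_apply, hu₁]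
  refine Tri.seq (Tri.put (h.lt (by simp [hu₂]; omega)) (Tri.seq ?_))
  refine Tri.countLoop (fun m S' => S' .c 0 0 = u + (bits m x).card) (n := u)
    (by simp [St.upd_apply, hu₂]) ?_ (by simp [St.upd_apply, hu₂, bits]) ?_ ?_
  · simp only [Lim.rounds]; simp; omega
  · intro m hm S₃ hf₃ hp hc
    have hX₃ : S₃ .X 0 0 = x := by
      rw [hf₃ .X rfl, St.upd_of_ne _ (by decide), hf₂ .X rfl, St.upd_of_ne _ (by decide), hX]
    have hpow₃ : S₃ .pow m 0 = 2 ^ m := by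
      rw [hf₃ .pow rfl, St.upd_of_ne _ (by decide), hf₂ .pow rfl, St.upd_of_ne _ (by decide),
        hpow₁, hpow m hm.le]
    have hbit := val_bit hX₃ hp hpow₃
    have hval : (var .c + bit .p).val S₃ = u + (bits (m + 1) x).card := by
      rw [val_add, val_var, hc, hbit, bits_succ]
      split_ifs with hb
      · rw [card_insert_of_notMem (notMem_bits_self m x), hb, add_assoc]
      · omega
    refine Tri.put (h.lt ?_) ?_
    · rw [hval]
      have := card_bits_le (m + 1) x
      omega
    · rw [hval]; simp [St.upd_apply]
  intro S₃ hf₃ hc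
  have hpos₃ : S₃ .pos = S₁ .pos := by
    rw [hf₃ .pos rfl, St.upd_of_ne _ (by decide), hf₂ .pos rfl, St.upd_of_ne _ (by decide)]
  have hneg₃ : S₃ .neg = S₁ .neg := by
    rw [hf₃ .neg rfl, St.upd_of_ne _ (by decide), hf₂ .neg rfl, St.upd_of_ne _ (by decide)]
  have hpr₃ : S₃ .pr 0 0 = ∏ i ∈ range k, z i x := by
    rw [hf₃ .pr rfl, St.upd_of_ne _ (by decide), hpr]
  have htest : (var .c - var .c / 2 * 2).val S₃ = (u + (bits u x).card) % 2 := by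
    simp only [val_sub, val_mul, val_div, val_var, val_two, hc]
    omega
  rw [sum_range_succ, sum_range_succ]
  refine Tri.ite (fun ht => ?_) fun ht => ?_
  all_goals
    rw [htest] at ht
    have hvp := (congrFun (congrFun hpos₃ 0) 0).trans hpos
    have hvn := (congrFun (congrFun hneg₃ 0) 0).trans hneg
  · have hs := hsum (fun X => if (u + (bits u X).card) % 2 = 0 then 0 else
      ∏ i ∈ range k, z i X) (fun X _ => by split_ifs <;> simp) (x + 1) hx
    rw [sum_range_succ, if_neg ht] at hs
    rw [if_neg ht, if_neg ht]
    refine Tri.put ?_ ?_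
    · rw [val_add, val_var, val_var, hpr₃, hvn]; exact hs
    · simp [St.upd_apply, hpr₃, hvn, hvp]
  · have hs := hsum (fun X => if (u + (bits u X).card) % 2 = 0 then
      ∏ i ∈ range k, z i X else 0) (fun X _ => by split_ifs <;> simp) (x + 1) hx
    rw [sum_range_succ, if_pos ht] at hs
    rw [if_pos ht, if_pos ht]
    refine Tri.put ?_ ?_
    · rw [val_add, val_var, val_var, hpr₃, hvp]; exact hs
    · simp [St.upd_apply, hpr₃, hvn, hvp]

/-- The difference of the positive and the negative part is the sum over covers, so `sol_iff_mod`
applies; the rest checks that all numbers and loop lengths respect the limits. -/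
theorem tri_dpProg {l : Lim} {k : ℕ} (h : l.Fits k) {P : Prop} {U : Finset ℕ} {S : St}
    (hI : Inst l k P U S) (hu : S .u 0 0 = U.card)
    (hV : (range U.card).image (fun p => S .V p 0) = U)
    (hVi : Set.InjOn (fun p => S .V p 0) (range U.card : Finset ℕ)) (huE : 2 ^ U.card ≤ l.E) :
    Tri l (dpProg k) S fun S' => (P → S' .ans 0 0 = 1) ∧ (¬ P → S' .ans 0 0 = 0) := by
  have hsm := h.small
  have hun : U.card ≤ l.w 0 := by simpa using card_le_card hI.valid.sub
  generalize U.card = u at *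
  set Q := 2 * k * l.w 0 * l.w 0 + 3 with hQdef
  have hex : (u * k + 1) * (Q * (l.w 0 + k) + 1) ≤ l.K := h.exponent_le hun
  have hcw : ∀ i < k, ∀ t ⊆ range u,
      classWeight (S .W) (fun p => S .V p 0) i t ≤ l.w 0 * l.w 0 := fun i hi t ht =>
    (classWeight_le (Nat.le_add_left _ _) hI.valid hVi hV hi ht).trans hI.sum_le
  set a : ℕ → Finset ℕ → ℕ := fun i t => 2 ^ ((u * k + 1) * ((t.card + 1) * Q -
    classWeight (S .W) (fun p => S .V p 0) i t)) with ha
  have hbound : ∀ c ≤ l.w 0 + k, (u * k + 1) * (c * Q) ≤ l.K := by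
    intro c hc
    refine le_trans (Nat.mul_le_mul_left _ ?_) hex
    have := Nat.mul_le_mul_right Q hc
    rw [mul_comm (l.w 0 + k)] at this
    omega
  have hk := h.pos
  have haK : ∀ i < k, ∀ t ⊆ range u, a i t ≤ 2 ^ l.K := by
    intro i _ t ht
    refine Nat.pow_le_pow_right two_pos (le_trans (Nat.mul_le_mul_left _ (Nat.sub_le _ _))
      (hbound _ ?_))
    have := card_le_card ht
    rw [card_range] at this
    omega
  have hQK : Q ≤ l.K := by
    have := hbound 1 (by omega)
    rw [one_mul] at this
    exact (Nat.le_mul_of_pos_left _ (Nat.succ_pos _)).trans this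
  have hrK : u * k + 1 ≤ l.K :=
    (Nat.le_mul_of_pos_right _ (Nat.succ_pos _)).trans hex
  refine Tri.seq ((tri_powProg h hu hun).mono fun S₁ hf₁ hpow => Tri.seq (Tri.put ?_
    (Tri.seq (Tri.put ?_ (Tri.seq ?_)))))
  · simp only [val_add, val_mul, val_lit, val_var, val_two, val_three, hf₁ .n rfl, hI.n]
    exact h.lt hQK
  · simp only [val_add, val_mul, val_lit, val_var, val_one, St.upd_apply, reduceCtorEq, false_and,
      if_false, hf₁ .u rfl, hu]
    exact h.lt hrK
  set S₂ := (S₁.upd .Q 0 0 ((2 * lit k * var .n * var .n + 3).val S₁)).upd .r 0 0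
    ((var .u * lit k + 1).val (S₁.upd .Q 0 0 ((2 * lit k * var .n * var .n + 3).val S₁))) with hS₂
  have hQ₂ : S₂ .Q 0 0 = Q := by simp [hS₂, St.upd_apply, hf₁ .n rfl, hI.n, hQdef]
  have hr₂ : S₂ .r 0 0 = u * k + 1 := by simp [hS₂, St.upd_apply, hf₁ .u rfl, hu]
  have hf₂ : ∀ y, y ≠ .Q → y ≠ .r → S₂ y = S₁ y := fun y h1 h2 => by
    rw [hS₂, St.upd_of_ne _ h2, St.upd_of_ne _ h1]
  clear_value S₂
  have hu₂ : S₂ .u 0 0 = u := by rw [hf₂ .u (by decide) (by decide), hf₁ .u rfl, hu]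
  have hL₂ : S₂ .L = S .L := by rw [hf₂ .L (by decide) (by decide), hf₁ .L rfl]
  have hW₂ : S₂ .W = S .W := by rw [hf₂ .W (by decide) (by decide), hf₁ .W rfl]
  have hV₂ : S₂ .V = S .V := by rw [hf₂ .V (by decide) (by decide), hf₁ .V rfl]
  have hpow₂ : ∀ p ≤ u, S₂ .pow p 0 = 2 ^ p := by
    rw [hf₂ .pow (by decide) (by decide)]; exact hpow
  refine (tri_fillProg h hu₂ hun huE hpow₂ hQ₂ hr₂ (by rw [hW₂, hV₂]; exact hcw)).mono
    fun S₃ hf₃ hA₃ => Tri.seq ?_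
  rw [hW₂, hV₂] at hA₃
  have hu₃ : S₃ .u 0 0 = u := by rw [hf₃ .u rfl, hu₂]
  have hpow₃ : ∀ p ≤ u, S₃ .pow p 0 = 2 ^ p := by rw [hf₃ .pow rfl]; exact hpow₂
  refine (tri_zetaProg h hu₃ hun huE hpow₃ a haK hA₃).mono fun S₄ hf₄ hA₄ => Tri.seq ?_
  have hu₄ : S₄ .u 0 0 = u := by rw [hf₄ .u rfl, hu₃]
  have hpow₄ : ∀ p ≤ u, S₄ .pow p 0 = 2 ^ p := by rw [hf₄ .pow rfl]; exact hpow₃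
  refine (tri_sumProg h hu₄ hun huE hpow₄ (fun i X => zeta (a i) u (bits u X))
    (fun i hi X _ => ?_) hA₄).mono fun S₅ hf₅ ⟨hpos, hneg⟩ => ?_
  · rw [pow_add]
    exact zeta_le (haK i hi) u (bits_subset u X)
  have htot := even_sum_eq k u a
  rw [← hpos, ← hneg] at htot
  set T := ∑ x ∈ covers k (range u), ∏ i : Fin k, a i (x i) with hT
  have htarget := hI.target
  have hell := h.target
  have hkn : l.w 0 * l.w 0 ≤ k * (l.w 0 * l.w 0) := Nat.le_mul_of_pos_left _ hk
  have hQk : Q = 2 * (k * (l.w 0 * l.w 0)) + 3 := by rw [hQdef]; ring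
  have hsol := sol_iff_mod (L := S .L 0 0) (Q := Q) (r := u * k + 1) (Nat.le_add_left _ _) hk
    hI.valid hVi hV (by have := Nat.mul_le_mul_left k hI.sum_le; omega) (by omega)
    (Nat.lt_succ_self _)
  rw [hI.sol] at hsol
  set e := (u * k + 1) * (Q * (u + k) - S .L 0 0 + 1) with he
  change P ↔ T % 2 ^ e ≠ 0 at hsol
  have heK : e ≤ l.K := by
    refine le_trans (Nat.mul_le_mul_left _ (Nat.add_le_add_right ((Nat.sub_le _ _).trans ?_) 1)) hex
    exact Nat.mul_le_mul_left _ (by omega)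
  have hvtot : (var .pos - var .neg).val S₅ = T := by
    simp only [val_sub, val_var]; omega
  have hTB : T < 2 ^ l.B := by
    refine lt_of_le_of_lt (b := ∑ x ∈ covers k (range u), 2 ^ (l.K * k)) (sum_le_sum fun x hx => ?_) ?_
    · calc ∏ i : Fin k, a i (x i) ≤ ∏ i : Fin k, 2 ^ l.K :=
            prod_le_prod' fun i _ => haK i i.2 _ (by
              rw [← mem_covers.1 hx]; exact subset_biUnion_of_mem x (mem_univ i))
        _ = 2 ^ (l.K * k) := by simp [pow_mul]
    · rw [sum_const, smul_eq_mul]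
      refine lt_of_le_of_lt (Nat.mul_le_mul_right _ (card_covers_le k u)) ?_
      rw [← pow_add, ← Nat.add_mul]
      refine l.lt_pow le_rfl ?_
      have := h.bits_lt hun
      omega
  refine Tri.seq (Tri.put (by rw [hvtot]; exact hTB) ?_)
  rw [hvtot]
  have hve : (var .r * (var .Q * (var .u + lit k) - var .L + 1)).val (S₅.upd .tot 0 0 T) = e := by
    simp only [val_add, val_mul, val_sub, val_lit, val_var, val_one, St.upd_apply, reduceCtorEq,
      false_and, if_false, hf₅ .r rfl, hf₅ .Q rfl, hf₅ .u rfl, hf₅ .L rfl, hf₄ .r rfl, hf₄ .Q rfl,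
      hf₄ .L rfl, hu₄, hf₃ .r rfl, hf₃ .Q rfl, hf₃ .L rfl, hr₂, hQ₂, hL₂, he]
  refine Tri.seq (Tri.put (by rw [hve]; exact h.lt heK) ?_)
  rw [hve]
  refine Tri.seq ((tri_expProg h (e := e) (by simp [St.upd_apply]) heK).mono fun S₆ hf₆ hpw => ?_)
  have htot₆ : S₆ .tot 0 0 = T := by rw [hf₆ .tot rfl]; simp [St.upd_apply]
  have hans : (1 - (1 - (var .tot - var .tot / var .pw * var .pw)) : Ex).val S₆ =
      1 - (1 - T % 2 ^ e) := by
    simp only [val_sub, val_mul, val_div, val_var, val_one, htot₆, hpw]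
    rw [Nat.mod_eq_sub_div_mul]
  refine Tri.put (h.lt (by rw [hans]; omega)) ?_
  rw [hans]
  simp only [St.upd_apply, and_self, if_true]
  refine ⟨fun hP => ?_, fun hP => ?_⟩
  · have := hsol.1 hP
    omega
  · have : T % 2 ^ e = 0 := by
      by_contra hne
      exact hP (hsol.2 hne)
    rw [this]

/-- The main program decides the instance written in the input word. -/
theorem tri_mainProg {l : Lim} {k α β : ℕ} (h : l.Fits k)
    (heasy : ∀ (U : Finset ℕ) (W : ℕ → ℕ → ℕ) (L : ℕ), Valid k (l.w 0 + k) U W →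
      (∀ v ∈ U, ¬ Reducible k (l.w 0 + k) W v) → α * L ≤ β * U.card → Sol k (l.w 0 + k) W L)
    (hE : ∀ u L, L ≤ 2 * l.w 1 → β * u < α * L → 2 ^ u ≤ l.E) :
    Tri l (mainProg k α β) (fun _ _ _ => 0) fun S =>
      (Sol k (l.w 0 + k) (initW l.w k) (2 * l.w 1) → S .ans 0 0 = 1) ∧
      (¬ Sol k (l.w 0 + k) (initW l.w k) (2 * l.w 1) → S .ans 0 0 = 0) := by
  refine Tri.seq ((tri_loadProg h).mono fun S₁ _ ⟨hn, hN, hL, hW, hal⟩ => Tri.seq ?_)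
  have hI₁ : Inst l k (Sol k (l.w 0 + k) (initW l.w k) (2 * l.w 1)) (initU l.w k) S₁ :=
    ⟨hn, hN, hal, hW ▸ valid_init h.word h.pos, hW ▸ sum_initW_le h.word, hL.le, by rw [hW, hL]⟩
  refine (tri_reduceProg h hI₁).mono fun S₂ _ ⟨U, hI₂, hirr⟩ => Tri.seq ?_
  refine (tri_collectProg h hI₂).mono fun S₃ hf₃ ⟨hu, hV, hVi⟩ => ?_
  have hI₃ := hI₂.congr (hf₃ .n rfl) (hf₃ .N rfl) (hf₃ .al rfl) (hf₃ .W rfl) (hf₃ .L rfl)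
  have htest : (lit α * var .L - lit β * var .u).val S₃ = α * S₃ .L 0 0 - β * U.card := by
    simp only [val_sub, val_mul, val_lit, val_var, hu]
  refine Tri.ite (fun ht => ?_) fun ht => Tri.put (h.lt ?_) ?_
  · rw [htest] at ht
    exact tri_dpProg h hI₃ hu hV hVi (hE _ _ hI₃.target (by omega))
  · have := h.small
    simp only [val_one]; omega
  · rw [htest] at ht
    rw [← hf₃ .W rfl] at hirr
    have hP := hI₃.sol.1 (heasy U _ _ hI₃.valid hirr (by omega))
    exact ⟨fun _ => by simp [St.upd_apply], fun hn => absurd hP hn⟩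

end ArrayProg

/-! ## The running time -/

namespace ArrayProg

open RAM Weighted

/-- Cut the target down to at most one more than the number of pairs of vertices. -/
def clampExpr : Expr :=
  .sub (.load (.lit 1)) (.sub (.load (.lit 1)) (.add (.mul (.load (.lit 0)) (.load (.lit 0))) (.lit 1)))

/-- The complete program. -/
def fullProg (k α β : ℕ) : Prog :=
  .seq (.store (.lit 1) clampExpr)
    (.seq (mainProg k α β).compile (.store (.lit 0) (Ex.var .ans).compile))

theorem init_code_lt {k : ℕ} (I : MHE k) {m : ℕ} (hn : I.n < m) (hl : I.ell < m) (hk : k < m)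
    (h1 : 1 < m) (r : ℕ) : RAM.init I.code r < m := by
  classical
  rw [RAM.init]
  by_cases hr : r < I.code.length
  · rw [List.getD_eq_getElem _ _ hr]
    have hmem := List.getElem_mem hr
    generalize I.code[r] = x at hmem
    simp only [MHE.code, List.mem_cons, List.mem_append, List.mem_ofFn] at hmem
    rcases hmem with rfl | rfl | ⟨v, rfl⟩ | ⟨p, rfl⟩
    · exact hn
    · exact hl
    · cases I.c v with
      | none => simp only [Option.elim]; omega
      | some i =>
        simp only [Option.elim]
        have := i.2
        omega
    · split_ifs <;> omega
  · rw [List.getD_eq_default _ _ (by omega)]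
    omega

/-- Registers beyond the input word are zero, so all arrays start out zero; the loading phase relies
on this when it accumulates weights. -/
theorem rep_init {k : ℕ} (I : MHE k) :
    Rep (RAM.init I.code) (fun _ _ _ => 0) (RAM.init I.code) := by
  refine ⟨fun _ _ => rfl, fun x i j => I.init_of_ge ?_⟩
  unfold addr
  rw [I.init_zero]
  omega

/-- Bernoulli's inequality for `1.3 ^ n`, squared; this is where the lower bound `1.69 = 1.3 ^ 2` on
the base comes from. -/
theorem sq_succ_le_pow {c : ℝ} (hc : 1.69 ≤ c) (n : ℕ) : ((n : ℝ) + 1) ^ 2 ≤ 12 * c ^ n := by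
  have h1 : 1 + (n : ℝ) * 0.3 ≤ (1 + 0.3) ^ n :=
    one_add_mul_le_pow (by norm_num) n
  have h2 : ((1 : ℝ) + 0.3) ^ n * (1 + 0.3) ^ n ≤ c ^ n := by
    rw [← mul_pow]
    exact pow_le_pow_left₀ (by norm_num) (by norm_num; linarith) n
  have hn : (0 : ℝ) ≤ n := n.cast_nonneg
  nlinarith

/-- The bound for ordinary loops. -/
def loopBound (k n : ℕ) : ℕ := 2 * (n + k + 2) ^ 6

/-- The bound for bit lengths. -/
def bitBound (k n : ℕ) : ℕ := 2 * (n + k + 2) * loopBound k n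

theorem loopBound_le_bitBound (k n : ℕ) : loopBound k n ≤ bitBound k n :=
  Nat.le_mul_of_pos_left _ (by omega)

theorem sq_le_loopBound (k n : ℕ) : n * n + n + k + 2 ≤ loopBound k n := by
  have h : (n + k + 2) ^ 2 ≤ (n + k + 2) ^ 6 := Nat.pow_le_pow_right (by omega) (by norm_num)
  unfold loopBound
  nlinarith

/-- The first instruction handles the original target, whose bit length is not polynomial in `n`.
Its cost, quadratic in that length, is absorbed by `c ^ ell`. -/
theorem sum_cost_le {c e : ℝ} (hc : 1.69 ≤ c) {C₀ C₁ C₂ Kd B E n k ell t₀ t₁ t₂ : ℕ}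
    (h₀ : t₀ ≤ C₀ * (Nat.size ell + n + k + 1 + 1) ^ 2)
    (h₁ : t₁ ≤ C₁ * (Kd * E) * (B + 1) ^ 2) (h₂ : t₂ ≤ C₂ * (B + 1) ^ 2)
    (he : e = c ^ ell) (hE : (E : ℝ) ≤ e) :
    ((t₀ + (t₁ + t₂) : ℕ) : ℝ) ≤ e * (12 * C₀ * (n + k + 2) ^ 2 +
      C₁ * Kd * (B + 1) ^ 2 + C₂ * (B + 1) ^ 2 : ℕ) := by
  have he1 : 1 ≤ e := he ▸ one_le_pow₀ (by linarith)
  have b0 : (t₀ : ℝ) ≤ e * (12 * C₀ * (n + k + 2) ^ 2) := by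
    have hsz : Nat.size ell ≤ ell := Nat.size_le.2 Nat.lt_two_pow_self
    have h1 : Nat.size ell + n + k + 1 + 1 ≤ (ell + 1) * (n + k + 2) := by nlinarith
    have h2 : t₀ ≤ C₀ * ((ell + 1) * (n + k + 2)) ^ 2 :=
      h₀.trans (Nat.mul_le_mul_left _ (Nat.pow_le_pow_left h1 2))
    have h3 : (t₀ : ℝ) ≤ C₀ * ((ell + 1) * (n + k + 2)) ^ 2 := by exact_mod_cast h2
    have h4 := sq_succ_le_pow hc ell
    rw [← he] at h4
    calc (t₀ : ℝ) ≤ C₀ * ((ell + 1) * (n + k + 2)) ^ 2 := h3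
      _ = (ell + 1) ^ 2 * (C₀ * (n + k + 2) ^ 2) := by ring
      _ ≤ 12 * e * (C₀ * (n + k + 2) ^ 2) := by gcongr
      _ = _ := by ring
  have b1 : (t₁ : ℝ) ≤ e * (C₁ * Kd * (B + 1) ^ 2) := by
    have h3 : (t₁ : ℝ) ≤ C₁ * (Kd * E) * (B + 1) ^ 2 := by exact_mod_cast h₁
    calc (t₁ : ℝ) ≤ E * (C₁ * Kd * (B + 1) ^ 2) := h3.trans_eq (by ring)
      _ ≤ _ := by gcongr
  have b2 : (t₂ : ℝ) ≤ e * (C₂ * (B + 1) ^ 2) := by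
    have h3 : (t₂ : ℝ) ≤ C₂ * (B + 1) ^ 2 := by exact_mod_cast h₂
    exact h3.trans (le_mul_of_one_le_left (by positivity) he1)
  push_cast
  linarith

/-- The program decides the problem, and its running time is a polynomial times `c ^ ell`. -/
theorem fullProg_run {k α β : ℕ} {c : ℝ} (hk : 1 ≤ k) (hc : 1.69 ≤ c) (hc2 : c ≤ 2)
    (heasy : ∀ (N : ℕ) (U : Finset ℕ) (W : ℕ → ℕ → ℕ) (L : ℕ), k ≤ N → Valid k N U W →
      (∀ v ∈ U, ¬ Reducible k N W v) → α * L ≤ β * U.card → Sol k N W L)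
    (hexp : ∀ u L ell : ℕ, L ≤ 2 * ell → β * u < α * L → (2 : ℝ) ^ u ≤ c ^ ell) (I : MHE k) :
    ∃ (t : ℕ) (M : Mem), Run (fullProg k α β) (RAM.init I.code) t M ∧
      (I.IsYes → M 0 = 1) ∧ (¬ I.IsYes → M 0 = 0) ∧
      (t : ℝ) ≤ c ^ I.ell * (12 * storeCost (.lit 1) clampExpr * (I.n + k + 2) ^ 2 +
        (mainProg k α β).coeff * loopBound k I.n ^ (mainProg k α β).deg *
          (bitBound k I.n + 1) ^ 2 +
        storeCost (.lit 0) (Ex.var .ans).compile * (bitBound k I.n + 1) ^ 2 : ℕ) := by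
  have hc1 : 1 ≤ c := by linarith
  set J := I.clamp with hJ
  have hJn : J.n = I.n := rfl
  have hJl : J.ell = I.ell - (I.ell - (I.n * I.n + 1)) := rfl
  -- Big loops have `2 ^ u` rounds, a natural number, so bounding it by `c ^ ell` is the same as
  -- bounding it by the floor.
  set l : Lim := ⟨RAM.init J.code, bitBound k I.n, loopBound k I.n, ⌊c ^ J.ell⌋₊⟩ with hl
  have hw0 : l.w 0 = I.n := rfl
  have hw1 : l.w 1 = J.ell := rfl
  have hKB := loopBound_le_bitBound k I.n
  have hsq := sq_le_loopBound k I.n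
  have hfits : l.Fits k := by
    refine ⟨hk, J.isWord_init, ?_, le_rfl, le_rfl⟩
    rw [hw0, hw1, hJl]; omega
  have hcpow : (1 : ℝ) ≤ c ^ J.ell := one_le_pow₀ hc1
  have hEle : (l.E : ℝ) ≤ c ^ J.ell := Nat.floor_le (by linarith)
  have hE1 : 1 ≤ l.E := Nat.le_floor (by simpa using hcpow)
  have htwo : ∀ x, x ≤ l.B → x < 2 ^ l.B := fun x hx =>
    Nat.lt_two_pow_self.trans_le (Nat.pow_le_pow_right two_pos hx)
  have hB1 : 1 ≤ l.B := by change 1 ≤ bitBound k I.n; omega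
  have hEB : l.E < 2 ^ l.B := by
    have h1 : l.E ≤ 2 ^ J.ell := by
      have : (l.E : ℝ) ≤ (2 : ℝ) ^ J.ell :=
        hEle.trans (pow_le_pow_left₀ (by linarith) hc2 _)
      exact_mod_cast this
    refine h1.trans_lt (Nat.pow_lt_pow_right (by norm_num) ?_)
    change J.ell < bitBound k I.n
    omega
  have htri := tri_mainProg hfits (fun U W L => heasy (l.w 0 + k) U W L (Nat.le_add_left _ _))
    (fun u L hL hu => by
      refine Nat.le_floor ?_
      push_cast
      exact hexp u L J.ell hL hu)
  -- the first instruction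
  have hM₀ : ∀ r, RAM.init I.code r < 2 ^ (Nat.size I.ell + I.n + k + 1) := by
    have hle : ∀ a, a ≤ Nat.size I.ell + I.n + k + 1 →
        2 ^ a ≤ 2 ^ (Nat.size I.ell + I.n + k + 1) := fun a ha => Nat.pow_le_pow_right two_pos ha
    refine init_code_lt I ?_ ?_ ?_ ?_
    · exact Nat.lt_two_pow_self.trans_le (hle _ (by omega))
    · exact (Nat.lt_size_self _).trans_le (hle _ (by omega))
    · exact Nat.lt_two_pow_self.trans_le (hle _ (by omega))
    · exact Nat.one_lt_two_pow (by omega)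
  obtain ⟨t₀, hr₀, ht₀⟩ := run_store (by omega) hM₀ (.lit 1) clampExpr
  have hM₁ : Function.update (RAM.init I.code) ((Expr.lit 1).val (RAM.init I.code))
      (clampExpr.val (RAM.init I.code)) = RAM.init J.code := by
    rw [hJ, I.init_clamp]
    rfl
  rw [hM₁] at hr₀
  -- the main program
  have hMJ : ∀ r, RAM.init J.code r < 2 ^ l.B := by
    refine init_code_lt J (htwo _ ?_) (htwo _ ?_) (htwo _ ?_) (htwo _ hB1)
    · change I.n ≤ bitBound k I.n; omega
    · change J.ell ≤ bitBound k I.n; omega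
    · change k ≤ bitBound k I.n; omega
  obtain ⟨t₁, M₁, hr₁, hR₁, hM₁, ht₁⟩ := Cmd.run_compile hB1
    (show 1 ≤ l.K by change 1 ≤ loopBound k I.n; omega) (htwo _ hKB) hE1 hEB (fun r _ => hMJ r)
    (mainProg k α β) (mainProg_wf k α β) (fun _ _ _ => 0) (RAM.init J.code) (rep_init J) hMJ htri.1
  -- the last instruction
  obtain ⟨t₂, hr₂, ht₂⟩ := run_store hB1 hM₁ (.lit 0) (Ex.var .ans).compile
  rw [hR₁.val_compile] at hr₂
  have hans := htri.2
  have hsol : Sol k (l.w 0 + k) (initW l.w k) (2 * l.w 1) ↔ I.IsYes :=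
    (J.sol_iff_isYes hk).trans I.clamp_isYes
  rw [hsol] at hans
  refine ⟨_, _, .seq hr₀ (.seq hr₁ hr₂), fun hy => ?_, fun hy => ?_, ?_⟩
  · simpa [Expr.val] using hans.1 hy
  · simpa [Expr.val] using hans.2 hy
  rw [mainProg_bigDeg, pow_one] at ht₁
  exact sum_cost_le hc ht₀ ht₁ ht₂ rfl (hEle.trans (pow_le_pow_right₀ hc1 (by omega)))

open Polynomial in
theorem solvableInOStar {k α β : ℕ} {c : ℝ} (hk : 1 ≤ k) (hc : 1.69 ≤ c) (hc2 : c ≤ 2)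
    (heasy : ∀ (N : ℕ) (U : Finset ℕ) (W : ℕ → ℕ → ℕ) (L : ℕ), k ≤ N → Valid k N U W →
      (∀ v ∈ U, ¬ Reducible k N W v) → α * L ≤ β * U.card → Sol k N W L)
    (hexp : ∀ u L ell : ℕ, L ≤ 2 * ell → β * u < α * L → (2 : ℝ) ^ u ≤ c ^ ell) :
    SolvableInOStar (MHE.code (k := k)) MHE.IsYes MHE.n (fun I => c ^ I.ell) := by
  let m : ℕ[X] := X + C (k + 2)
  let K : ℕ[X] := C 2 * m ^ 6
  let B : ℕ[X] := C 2 * m * K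
  refine ⟨fullProg k α β, C (12 * storeCost (.lit 1) clampExpr) * m ^ 2 +
    C (mainProg k α β).coeff * K ^ (mainProg k α β).deg * (B + 1) ^ 2 +
    C (storeCost (.lit 0) (Ex.var .ans).compile) * (B + 1) ^ 2, fun I => ?_⟩
  obtain ⟨t, M, hr, hy, hn, ht⟩ := fullProg_run hk hc hc2 heasy hexp I
  refine ⟨t, M, hr, hy, hn, ht.trans (le_of_eq ?_)⟩
  congr 2
  simp only [m, K, B, eval_add, eval_mul, eval_pow, eval_C, eval_X, eval_one, bitBound, loopBound,
    add_assoc]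

end ArrayProg

/-! ### The two running times -/

theorem mainTheorem11 :
    (∀ k : ℕ, 3 ≤ k →
      RAM.SolvableInOStar (MHE.code (k := k)) MHE.IsYes MHE.n (fun I => (2 : ℝ) ^ I.ell)) ∧
    RAM.SolvableInOStar (MHE.code (k := 3)) MHE.IsYes MHE.n (fun I => (1.89 : ℝ) ^ I.ell) := by
  refine ⟨fun k hk => ?_, ?_⟩
  -- When the shortcut fails, `2 * u < L ≤ 2 * ell`, so `u < ell`.
  · refine ArrayProg.solvableInOStar (α := 1) (β := 2) (by omega) (by norm_num) le_rfl
      (fun N U W L hN hW hirr hL => ?_) fun u L ell hL hu => ?_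
    · exact Weighted.sol_of_le_two_mul_card (by omega) hN hW hirr (by omega)
    · exact pow_le_pow_right₀ (by norm_num) (by omega)
  -- When the shortcut fails, `7 * u < 3 * L ≤ 6 * ell`.
  · refine ArrayProg.solvableInOStar (α := 3) (β := 7) (by omega) (by norm_num) (by norm_num)
      (fun N U W L hN hW hirr hL => ?_) fun u L ell hL hu => ?_
    · exact Weighted.sol_three_of_le hN hW hirr hL
    -- Taking seventh powers clears the fraction `6/7` and leaves the numerical fact `2 ^ 6 ≤ 1.89 ^
    -- 7`.
    · refine le_of_pow_le_pow_left₀ (n := 7) (by norm_num) (by positivity) ?_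
      rw [← pow_mul, ← pow_mul]
      calc (2 : ℝ) ^ (u * 7) ≤ 2 ^ (6 * ell) := pow_le_pow_right₀ (by norm_num) (by omega)
        _ = (2 ^ 6) ^ ell := pow_mul _ _ _
        _ ≤ ((1.89 : ℝ) ^ 7) ^ ell := pow_le_pow_left₀ (by norm_num) (by norm_num) _
        _ = (1.89 : ℝ) ^ (ell * 7) := by rw [← pow_mul, mul_comm]
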